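/- **Notation.** Let $K$ be a number field with ring of integers $O_K$. For a maximal ideal $\mathfrak p$ of $O_K$ put $\|a\|_{\mathfrak p}=N(\mathfrak p)^{-\mathrm{ord}_{\mathfrak p}(a)}$. An $O_K$-lattice $\Lambda$ in a $K$-vector space $W$ defines norms $\|w\|_{\mathfrak p}=\inf\{\|a\|_{\mathfrak p} : a\in K,\ w\in a\Lambda_{\mathfrak p}\}$. Let $X$ be a smooth separated $K$-scheme of finite type, of pure dimension $N$, let $P\in X(K)$, and let $\widehat V\subseteq\widehat X_P$ be a smooth formal subscheme of dimension $d$ of the completion of $X$ at $P$; so $\widehat V=\mathrm{Spf}\,A$ with $A\cong K[[T_1,\dots,T_d]]$ a quotient of $\widehat{\mathcal O}_{X,P}$. Let $\mathfrak m$ be the maximal ideal of $A$ and $T_P^*\widehat V=\mathfrak m/\mathfrak m^2$. For $B\subseteq K$, a *model* of $(X,P)$ over $B$ is a flat separated scheme of finite type over $\mathrm{Spec}(B)$ with generic fibre $X$, together with a section over $\mathrm{Spec}(B)$ extending $P$. **LG-germs.** Let $\alpha\ge 0$ be real. $\widehat V$ is an *LG-germ of type $\alpha$* if 1. for every finite place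 $\mathfrak p$, the base change of $\widehat V$ to $K_{\mathfrak p}$ is defined, in algebraic local coordinates at $P$, by power series with positive radius of convergence; 2. there are a finite set $S$ of places containing the infinite ones, a smooth model $\mathcal X_S$ over the ring $O_S$ of $S$-integers with section $\mathcal P_S$, an open neighbourhood $U$ of $\mathcal P_S$, an étale map $g:U\to\mathbb A^N_{O_S}$ over $O_S$ with $g(\mathcal P_S)=0$, and a $K$-isomorphism $\delta:\widehat{\mathbb A}^d_K\to\widehat V$, such that the power series $Z_k(T)=\sum_I a_I(k)T^I$ $(1\le k\le N)$ describing $\widehat g\circ\delta$ satisfy: (a) for each $\mathfrak p\notin S$ there is $C_{\mathfrak p}\ge 1$ with $\|a_I(k)\|_{\mathfrak p}\le C_{\mathfrak p}^{|I|}/\|I!\|_{\mathfrak p}^{\alpha}$ for all $I,k$, and $\prod_{\mathfrak p\notin S}C_{\mathfrak p}<\infty$; (b) the $a_I(k)$ with $|I|=1$ lie in $O_S$, and the linear map $O_S^d\to O_S^N$ they define is injective with torsion-free cokernel. **Jets.** A function $s$ regular near $P$ *vanishes to order $i-1$ along $\widehat V$* if $s|_{\widehat V}\in\mathfrak m^i$;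 its $i$-th jet is then the class $j^i(s)\in\mathfrak m^i/\mathfrak m^{i+1}=S^i(T_P^*\widehat V)$. The same definitions apply to sections $s$ of an invertible sheaf $M$, with $j^i(s)\in S^i(T_P^*\widehat V)\otimes M|_P$. An integral structure on $T_P^*\widehat V$ induces one on each $S^i(T_P^*\widehat V)$. A model $\mathcal X$ over $O_K$ with section $\mathcal P$ gives one on $T^*_P\widehat V$, namely the image of the conormal module of $\mathcal P$, and one on $M|_P$ for every invertible sheaf $M$ on $\mathcal X$, namely $\mathcal P^*M$. **Theorem.** Let $\widehat V$ be an LG-germ of type $\alpha\ge0$ and let $\mathcal X$ be a model of $(X,P)$ over $O_K$, with section $\mathcal P$. *(First part.)* Give $T_P^*\widehat V$ the integral structure induced by $\mathcal X$. There is a constant $C$ such that for every open neighbourhood $U\subseteq\mathcal X$ of $\mathcal P(\mathrm{Spec}\,O_K)$, every $i\ge0$ and every $s\in H^0(U,\mathcal O_{\mathcal X})$ vanishing to order $i-1$ along $\widehat V$, $$\frac1{[K:\mathbb Q]}\sum_{\mathfrak p}\log\|j^i(s)\|_{\mathfrak p}\le\alpha\, i\log i+C\,i .$$ *(Second part.)*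 There are an integral structure on the tangent space $T_P\widehat V$ (a finitely generated $O_K$-submodule spanning it) and a constant $C>0$ such that for every invertible sheaf $M$ on $\mathcal X$ (in particular for $M=L^D$, for every ample $L$ and every $D\ge 0$) and every $i\ge0$, $$\sum_{\mathfrak p}\log\|\gamma_M^i\|_{\mathfrak p}\le[K:\mathbb Q]\,(\alpha\, i\log i+C\,i).$$ Here $E^i\subseteq H^0(\mathcal X,M)\otimes K$ is the space of sections vanishing to order $i-1$ along $\widehat V$, $\gamma_M^i:E^i/E^{i+1}\hookrightarrow S^i(T_P^*\widehat V)\otimes M|_P$ is the jet map, the source carries the quotient norm of the norm given by the lattice $H^0(\mathcal X,M)$, the target carries the norm given by the dual of the chosen integral structure and by $\mathcal P^*M$, and $\|\gamma_M^i\|_{\mathfrak p}$ is the operator norm, which is finite. In both sums all but finitely many terms vanish if the jet, respectively $\gamma_M^i$, is non-zero; otherwise the inequality is understood as trivially true. The convention $0\log 0=0$ is used. -/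

import Mathlib

open CategoryTheory AlgebraicGeometry IsLocalRing NumberField IsDedekindDomain
open scoped TensorProduct Nat

universe u

noncomputable section

namespace LGGerm

/-! ### Norms attached to integral structures -/

section Norms

variable {K : Type u} [Field K] [NumberField K]

/-- The norm `‖w‖_v` on a `K`-vector space `W` attached to an `O_K`-lattice `Λ ⊆ W`: the infimum of
the `|a|_v`, `a ∈ K`, such that `w` lies in `a` times the localisation of `Λ` at `v`.
Here `|a|_v = N(v) ^ (-ord_v a)`, the absolute value for which the product formula holds. -/
def latticeNorm {W : Type u} [AddCommGroup W] [Module K W] [Module (𝓞 K) W]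
    (v : HeightOneSpectrum (𝓞 K)) (Λ : Submodule (𝓞 K) W) (w : W) : ℝ :=
  sInf {r : ℝ | ∃ (a : K) (b : 𝓞 K), b ∉ v.asIdeal ∧ (∃ x ∈ Λ, b • w = a • x) ∧
    r = HeightOneSpectrum.adicAbv K v a}

/-- The quotient norm on `W₁ / W₂`, evaluated at the class of `w ∈ W₁`, of the norm on `W` attached
to the lattice `Λ ⊆ W`. -/
def quotientNorm {W : Type u} [AddCommGroup W] [Module K W] [Module (𝓞 K) W]
    (v : HeightOneSpectrum (𝓞 K)) (Λ : Submodule (𝓞 K) W) (W₂ : Submodule K W) (w : W) : ℝ :=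
  sInf {r : ℝ | ∃ y ∈ W₂, r = latticeNorm v Λ (w + y)}

/-- The lattice of the dual space `T` dual to a lattice `Λ ⊆ T^*`:
all `w` on which the elements of `Λ` take integral values. -/
def dualLattice {W : Type u} [AddCommGroup W] [Module K W] [Module (𝓞 K) W]
    [IsScalarTower (𝓞 K) K W] (Λ : Submodule (𝓞 K) (Module.Dual K W)) : Submodule (𝓞 K) W where
  carrier := {w | ∀ t ∈ Λ, t w ∈ Set.range (algebraMap (𝓞 K) K)}
  zero_mem' := fun t _ => ⟨0, by simp⟩
  add_mem' := by
    intro x y hx hy t ht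
    obtain ⟨a, ha⟩ := hx t ht
    obtain ⟨b, hb⟩ := hy t ht
    exact ⟨a + b, by simp [ha, hb]⟩
  smul_mem' := by
    intro c x hx t ht
    obtain ⟨a, ha⟩ := hx t ht
    refine ⟨c * a, ?_⟩
    rw [← algebraMap_smul K c x, map_smul, map_mul, ha, smul_eq_mul]

end Norms

/-! ### Jets -/

section Jets

variable (R : Type u) [CommRing R] [IsLocalRing R] (N : Type u) [AddCommGroup N] [Module R N]

/-- The submodule `m ^ i N` of an `R`-module `N`, for `m` the maximal ideal of `R`:
the elements that vanish to order `i - 1` at the closed point (that is, modulo `m ^ i`). -/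
def vanishing (i : ℕ) : Submodule R N := (maximalIdeal R ^ i) • (⊤ : Submodule R N)

/-- `m ^ i N / m ^ (i + 1) N`, the kernel of `N / m ^ (i + 1) N → N / m ^ i N`. When `R` is the ring
of functions of a smooth formal germ and `N` is free of rank one, with fibre `N / m N` at the
point, it is canonically `S^i(m / m ^ 2) ⊗ N / m N`. -/
abbrev JetSpace (i : ℕ) : Type u :=
  vanishing R N i ⧸ (vanishing R N (i + 1)).submoduleOf (vanishing R N i)

/-- The `i`-th jet of an element vanishing to order `i - 1`. -/
def jet (i : ℕ) : vanishing R N i →ₗ[R] JetSpace R N i :=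
  ((vanishing R N (i + 1)).submoduleOf (vanishing R N i)).mkQ

variable {R N} {K : Type u} [Field K] [NumberField K] [Algebra K R] [Module K N]
  [IsScalarTower K R N] [Module (𝓞 K) N] [IsScalarTower (𝓞 K) R N]

/-- The integral structure on `S^i(T^*) ⊗ N / m N` induced by integral structures `Λ` on the
cotangent space `T^* = m / m ^ 2` and `E` on `N / m N` (the latter given by representatives in `N`):
the span of the classes of the products `x₁ ⋯ xᵢ e` with `xₖ ∈ m` of class in `Λ` and `e ∈ E`. -/
def jetLattice (Λ : Submodule (𝓞 K) (CotangentSpace R)) (E : Set N) (i : ℕ) :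
    Submodule (𝓞 K) (JetSpace R N i) :=
  Submodule.span (𝓞 K) {w | ∃ (x : Fin i → maximalIdeal R) (e : N) (y : vanishing R N i),
    (∀ k, (maximalIdeal R).toCotangent (x k) ∈ Λ) ∧ e ∈ E ∧
    (y : N) = (∏ k, (x k : R)) • e ∧ w = jet R N i y}

end Jets

/-! ### Formal germs and models -/

section Germs

variable {K : Type u} [Field K] {X : Scheme.{u}}

/-- The point of `X` underlying a `K`-rational point. -/
def pt (P : Spec (.of K) ⟶ X) : X := P (closedPoint K)

/-- The local ring of `X` at the rational point `P`. -/
abbrev LocalRing (P : Spec (.of K) ⟶ X) : Type u := X.presheaf.stalk (pt P)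

/-- The completed local ring at `P`; its formal spectrum is the completion of `X` at `P`. -/
abbrev CompletedLocalRing (P : Spec (.of K) ⟶ X) : Type u :=
  AdicCompletion (maximalIdeal (LocalRing P)) (LocalRing P)

/-- The constants in the local ring. -/
def constants (π : X ⟶ Spec (.of K)) (P : Spec (.of K) ⟶ X) : K →+* LocalRing P :=
  ((Scheme.ΓSpecIso (.of K)).inv ≫ π.appTop ≫ X.presheaf.germ ⊤ (pt P) trivial).hom

/-- A smooth formal subscheme `V` of dimension `d` of the completion of the `K`-scheme `X` at the
rational point `P`. It is the formal spectrum of a `K`-algebra `A` isomorphic to a power series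
ring in `d` variables, and a quotient of the completed local ring. -/
structure FormalGerm (π : X ⟶ Spec (.of K)) (P : Spec (.of K) ⟶ X) (d : ℕ) where
  /-- the ring of functions on the formal germ -/
  A : Type u
  [commRing : CommRing A]
  [algebra : Algebra K A]
  smooth : Nonempty (A ≃ₐ[K] MvPowerSeries (Fin d) K)
  /-- restriction of formal functions from the completion of `X` -/
  res : CompletedLocalRing P →+* A
  res_surjective : Function.Surjective res
  res_constants : ∀ c : K, res (algebraMap _ _ (constants π P c)) = algebraMap K A c

/-- A model over `Spec A` of the `K`-scheme `X` (for `A ⊆ K`): a flat separated scheme of finite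
type with generic fibre `X`, together with a section extending the rational point `P`. -/
structure PointedModel (A : Type u) [CommRing A] [Algebra A K] (π : X ⟶ Spec (.of K))
    (P : Spec (.of K) ⟶ X) where
  /-- the total space -/
  space : Scheme.{u}
  /-- the structure morphism -/
  str : space ⟶ Spec (.of A)
  flat : Flat str
  locallyOfFiniteType : LocallyOfFiniteType str
  quasiCompact : QuasiCompact str
  separated : IsSeparated str
  /-- the inclusion of the generic fibre -/
  gen : X ⟶ space
  isPullback : IsPullback gen π str (Spec.map (CommRingCat.ofHom (algebraMap A K)))
  /-- the section extending `P` -/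
  sec : Spec (.of A) ⟶ space
  sec_str : sec ≫ str = 𝟙 _
  sec_gen : Spec.map (CommRingCat.ofHom (algebraMap A K)) ≫ sec = P ≫ gen

variable {π : X ⟶ Spec (.of K)} {P : Spec (.of K) ⟶ X} {d : ℕ}

attribute [instance] FormalGerm.commRing FormalGerm.algebra

instance (V : FormalGerm π P d) : IsLocalRing V.A :=
  V.smooth.some.symm.toRingEquiv.isLocalRing

section Restriction

variable {B : Type u} [CommRing B] [Algebra B K] (V : FormalGerm π P d) (M : PointedModel B π P)

/-- The image in the model of the rational point `P`. -/
def PointedModel.pt : M.space := M.gen (LGGerm.pt P)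

/-- Restriction to `V` of germs of functions on the model. -/
def FormalGerm.resStalk : M.space.presheaf.stalk M.pt →+* V.A :=
  (V.res.comp (algebraMap (LocalRing P) (CompletedLocalRing P))).comp
    (M.gen.stalkMap (LGGerm.pt P)).hom

/-- Restriction to `V` of a function defined on an open subset `U` of the model containing `P`. -/
def FormalGerm.resOpen (U : M.space.Opens) (hU : M.pt ∈ U) : Γ(M.space, U) →+* V.A :=
  (V.resStalk M).comp (M.space.presheaf.germ U M.pt hU).hom

/-- The constants on the model. -/
def PointedModel.constants : B →+* Γ(M.space, ⊤) :=
  ((Scheme.ΓSpecIso (.of B)).inv ≫ M.str.appTop).hom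

theorem FormalGerm.resOpen_constants (b : B) :
    V.resOpen M ⊤ trivial (M.constants b) = algebraMap K V.A (algebraMap B K b) := by
  rw [← V.res_constants]
  have h1 : (M.gen.stalkMap (LGGerm.pt P)) ((M.space.presheaf.germ ⊤ M.pt trivial)
      (M.constants b)) = LGGerm.constants π P (algebraMap B K b) := by
    have h2 : M.space.presheaf.germ ⊤ M.pt trivial ≫ M.gen.stalkMap (LGGerm.pt P) =
        M.gen.appTop ≫ X.presheaf.germ ⊤ (LGGerm.pt P) trivial :=
      Scheme.Hom.germ_stalkMap M.gen ⊤ (LGGerm.pt P) trivial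
    have h3 : M.str.appTop ≫ M.gen.appTop =
        (Spec.map (CommRingCat.ofHom (algebraMap B K))).appTop ≫ π.appTop := by
      rw [← Scheme.Hom.comp_appTop, ← Scheme.Hom.comp_appTop, M.isPullback.w]
    have h4 : (Scheme.ΓSpecIso (.of B)).inv ≫ M.str.appTop ≫
        M.space.presheaf.germ ⊤ M.pt trivial ≫ M.gen.stalkMap (LGGerm.pt P) =
        CommRingCat.ofHom (algebraMap B K) ≫ (Scheme.ΓSpecIso (.of K)).inv ≫ π.appTop ≫
          X.presheaf.germ ⊤ (LGGerm.pt P) trivial := by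
      rw [h2, reassoc_of% h3, Scheme.ΓSpecIso_inv_naturality_assoc]
    exact congr($(h4) b)
  exact congrArg (fun x => V.res (algebraMap (LocalRing P) (CompletedLocalRing P) x)) h1

end Restriction

end Germs

/-! ### LG-germs -/

section LG

variable {K : Type u} [Field K] [NumberField K] {X : Scheme.{u}} {π : X ⟶ Spec (.of K)}
  {P : Spec (.of K) ⟶ X} {d : ℕ}

/-- A power series over a `v`-adic completion with a positive radius of convergence. -/
def IsConvergent {v : HeightOneSpectrum (𝓞 K)} {n : ℕ}
    (F : MvPowerSeries (Fin n) (v.adicCompletion K)) : Prop :=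
  ∃ r > (0 : ℝ), ∃ c : ℝ, ∀ I : Fin n →₀ ℕ, ‖MvPowerSeries.coeff I F‖ * r ^ I.degree ≤ c

/-- `V` is an analytic germ at the finite place `v`: in a system of algebraic local coordinates
(an identification `Θ` of the completion of `X` at `P` with the completion of the affine space at
the origin, given by elements `z₁, …, z_N` of the local ring), the ideal of the base change of `V`
to the completion of `K` at `v` is generated by convergent power series. -/
def FormalGerm.IsAnalyticAt (V : FormalGerm π P d) (N : ℕ) (v : HeightOneSpectrum (𝓞 K)) : Prop :=
  ∃ (z : Fin N → LocalRing P) (Θ : MvPowerSeries (Fin N) K ≃+* CompletedLocalRing P),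
    (∀ c : K, Θ (MvPowerSeries.C c) = algebraMap _ _ (constants π P c)) ∧
    (∀ k, Θ (MvPowerSeries.X k) = algebraMap _ _ (z k)) ∧
    ∃ E : Set (MvPowerSeries (Fin N) (v.adicCompletion K)), (∀ F ∈ E, IsConvergent F) ∧
      Ideal.map (MvPowerSeries.map (algebraMap K (v.adicCompletion K)))
        (RingHom.ker (V.res.comp Θ.toRingHom)) = Ideal.span E

/-- The growth condition on `N` power series `Z` in `d` variables, outside the set `S` of places:
`|a_I|_v ≤ C_v ^ |I| / |I!|_v ^ α` with `C_v ≥ 1` and `∏ C_v < ∞`. -/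
def GrowthCondition (S : Set (HeightOneSpectrum (𝓞 K))) (α : ℝ) {N : ℕ}
    (Z : Fin N → MvPowerSeries (Fin d) K) : Prop :=
  ∃ C : HeightOneSpectrum (𝓞 K) → ℝ, (∀ v ∉ S, 1 ≤ C v) ∧
    (∀ v ∉ S, ∀ (k : Fin N) (I : Fin d →₀ ℕ),
      HeightOneSpectrum.adicAbv K v (MvPowerSeries.coeff I (Z k)) ≤
        C v ^ I.degree / HeightOneSpectrum.adicAbv K v ((∏ j, (I j)! : ℕ) : K) ^ α) ∧
    Multipliable (fun v : {v : HeightOneSpectrum (𝓞 K) // v ∉ S} => C v)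

/-- The linear terms of `Z` have coefficients in the ring `O_S` of `S`-integers and define an
injective map `O_S ^ d → O_S ^ N` whose cokernel has no torsion. -/
def TangentCondition (S : Set (HeightOneSpectrum (𝓞 K))) {N : ℕ}
    (Z : Fin N → MvPowerSeries (Fin d) K) : Prop :=
  ∃ a : Matrix (Fin N) (Fin d) (S.integer K),
    (∀ k j, (a k j : K) = MvPowerSeries.coeff (Finsupp.single j 1) (Z k)) ∧
    Function.Injective a.mulVec ∧
    ∀ (c : S.integer K) (y : Fin N → S.integer K), c ≠ 0 →
      c • y ∈ Set.range a.mulVec → y ∈ Set.range a.mulVec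

/-- The parametrization `δ` of `V` is an `S`-good germ of type `α` with respect to the model `M`
over `O_S`: there are an open neighbourhood `U` of the section and an étale map
`g : U → 𝔸^N` over `O_S` sending the section to `0`, such that the power series given by the
composition of the parametrization with `g` satisfy both conditions above. -/
def FormalGerm.IsGood (V : FormalGerm π P d) (N : ℕ) (α : ℝ)
    (S : Set (HeightOneSpectrum (𝓞 K))) (M : PointedModel (S.integer K) π P)
    (δ : V.A ≃ₐ[K] MvPowerSeries (Fin d) K) : Prop :=
  ∃ (U : M.space.Opens) (hU : M.pt ∈ U) (z : Fin N → Γ(M.space, U)),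
    M.sec ⁻¹ᵁ U = ⊤ ∧
    Etale (AffineSpace.homOfVector (n := ULift.{u} (Fin N)) (U.ι ≫ M.str)
      (fun k => U.topIso.inv (z k.down))) ∧
    (∀ k, M.sec.app U (z k) = 0) ∧
    GrowthCondition S α (fun k => δ (V.resOpen M U hU (z k))) ∧
    TangentCondition S (fun k => δ (V.resOpen M U hU (z k)))

/-- `V` is an LG-germ of type `α`. Here `N` is the dimension of `X`, and `S` is the set of finite
places in the finite set of places of the definition (which contains all infinite places). -/
def FormalGerm.IsLG (V : FormalGerm π P d) (N : ℕ) (α : ℝ) : Prop :=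
  (∀ v : HeightOneSpectrum (𝓞 K), V.IsAnalyticAt N v) ∧
  ∃ S : Set (HeightOneSpectrum (𝓞 K)), S.Finite ∧
    ∃ M : PointedModel (S.integer K) π P, Smooth M.str ∧
      ∃ δ : V.A ≃ₐ[K] MvPowerSeries (Fin d) K, V.IsGood N α S M δ

end LG

/-! ### Jets of functions and of sections of invertible sheaves -/

section Sections

variable {K : Type u} [Field K] [NumberField K] {X : Scheme.{u}} {π : X ⟶ Spec (.of K)}
  {P : Spec (.of K) ⟶ X} {d : ℕ}

/-- A finite place of `K` as a closed point of `Spec O_K`. -/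
def placePt (v : HeightOneSpectrum (𝓞 K)) : Spec (.of (𝓞 K)) :=
  (⟨v.asIdeal, v.isPrime⟩ : PrimeSpectrum (𝓞 K))

variable (V : FormalGerm π P d) (M : PointedModel (𝓞 K) π P)

/-- The integral structure on the cotangent space of `V` induced by a model: the image of the
conormal module `H^0(Spec O_K, sec^* (I / I ^ 2))` of the section, `I` being the ideal sheaf of the
section. An element of the cotangent space is in the image if and only if it is so locally over
`Spec O_K`, hence if and only if near every closed point of the section it is the differential of a
function vanishing along the section. -/
def FormalGerm.cotangentModel : Submodule (𝓞 K) (CotangentSpace V.A) :=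
  Submodule.span (𝓞 K) {t | ∀ v : HeightOneSpectrum (𝓞 K),
    ∃ (U : M.space.Opens) (hU : M.pt ∈ U) (f : Γ(M.space, U)) (x : maximalIdeal V.A),
      M.sec (placePt v) ∈ U ∧ M.sec.app U f = 0 ∧ (x : V.A) = V.resOpen M U hU f ∧
      t = (maximalIdeal V.A).toCotangent x}

/-- An integral model of the tangent space `T V` of `V` at `P`: a finitely generated
`O_K`-submodule that spans `T V` over `K`. -/
structure TangentModel where
  /-- the lattice -/
  lattice : Submodule (𝓞 K) (Module.Dual K (CotangentSpace V.A))
  fg : lattice.FG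
  span_eq_top : Submodule.span K (lattice : Set (Module.Dual K (CotangentSpace V.A))) = ⊤

/-- The norm at `v` of the `i`-th jet of a function on `V` that vanishes to order `i - 1`, with
respect to the integral structure `Λ` on the cotangent space. -/
def FormalGerm.functionJetNorm (Λ : Submodule (𝓞 K) (CotangentSpace V.A))
    (v : HeightOneSpectrum (𝓞 K)) (i : ℕ) (f : vanishing V.A V.A i) : ℝ :=
  latticeNorm v (jetLattice Λ ({1} : Set V.A) i) (jet V.A V.A i f)

/-- An invertible sheaf: a sheaf of modules locally isomorphic to the structure sheaf. -/
def IsInvertibleSheaf {Y : Scheme.{u}} (L : Y.Modules) : Prop :=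
  ∀ y : Y, ∃ U : Y.Opens, y ∈ U ∧
    Nonempty (L.restrict U.ι ≅ (SheafOfModules.unit U.toScheme.ringCatSheaf : U.toScheme.Modules))

/-- The stalk of a sheaf of modules. -/
def ModuleStalk {Y : Scheme.{u}} (L : Y.Modules) (y : Y) : Type u :=
  ↑(TopCat.Presheaf.stalk L.presheaf y)

instance {Y : Scheme.{u}} (L : Y.Modules) (y : Y) : AddCommGroup (ModuleStalk L y) :=
  inferInstanceAs (AddCommGroup ↑(TopCat.Presheaf.stalk L.presheaf y))

instance {Y : Scheme.{u}} (L : Y.Modules) (y : Y) :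
    Module (Y.presheaf.stalk y) (ModuleStalk L y) :=
  PresheafOfModules.instModuleCarrierStalkCommRingCatCarrierAbPresheafOpensCarrier
    (R := Y.presheaf) L.val y

/-- The germ of a section of a sheaf of modules. -/
def moduleGerm {Y : Scheme.{u}} (L : Y.Modules) (y : Y) (U : Y.Opens) (hy : y ∈ U) :
    Γ(L, U) →+ ModuleStalk L y :=
  (L.presheaf.germ U y hy).hom

theorem moduleGerm_smul {Y : Scheme.{u}} (L : Y.Modules) (y : Y) (U : Y.Opens) (hy : y ∈ U)
    (r : Γ(Y, U)) (m : Γ(L, U)) :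
    moduleGerm L y U hy (r • m) = Y.presheaf.germ U y hy r • moduleGerm L y U hy m :=
  PresheafOfModules.germ_smul (R := Y.presheaf) L.val y U hy r m

variable (L : M.space.Modules)

/-- The algebra structure given by restriction to `V`. -/
instance : Algebra (M.space.presheaf.stalk M.pt) V.A := (V.resStalk M).toAlgebra

/-- `H^0(V, L)`, the sections over `V` of the pull back of a sheaf of modules `L` on the model. -/
def FormalGerm.SheafSections : Type u := V.A ⊗[M.space.presheaf.stalk M.pt] ModuleStalk L M.pt

instance : AddCommGroup (V.SheafSections M L) :=
  inferInstanceAs (AddCommGroup (V.A ⊗[M.space.presheaf.stalk M.pt] ModuleStalk L M.pt))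

instance : Module V.A (V.SheafSections M L) :=
  inferInstanceAs (Module V.A (V.A ⊗[M.space.presheaf.stalk M.pt] ModuleStalk L M.pt))

instance : Module K (V.SheafSections M L) := Module.compHom _ (algebraMap K V.A)

instance : Module (𝓞 K) (V.SheafSections M L) := Module.compHom _ (algebraMap (𝓞 K) V.A)

instance : IsScalarTower K V.A (V.SheafSections M L) :=
  ⟨fun a b m => by rw [Algebra.smul_def, mul_smul]; rfl⟩

instance : IsScalarTower (𝓞 K) V.A (V.SheafSections M L) :=
  ⟨fun a b m => by rw [Algebra.smul_def, mul_smul]; rfl⟩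

instance : IsScalarTower (𝓞 K) K (V.SheafSections M L) :=
  ⟨fun a b m => by
    change algebraMap K V.A (a • b) • m =
      algebraMap (𝓞 K) V.A a • (algebraMap K V.A b • m)
    rw [smul_smul, Algebra.smul_def, map_mul, ← IsScalarTower.algebraMap_apply]⟩

/-- Restriction to `V` of a section of `L` defined near `P`. -/
def FormalGerm.resSection (U : M.space.Opens) (hU : M.pt ∈ U) :
    Γ(L, U) →+ V.SheafSections M L :=
  (TensorProduct.mk (M.space.presheaf.stalk M.pt) V.A (ModuleStalk L M.pt) 1).toAddMonoidHom.comp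
    (moduleGerm L M.pt U hU)

set_option linter.unusedSectionVars false in
theorem FormalGerm.resSection_smul (U : M.space.Opens) (hU : M.pt ∈ U) (r : Γ(M.space, U))
    (s : Γ(L, U)) :
    V.resSection M L U hU (r • s) = V.resOpen M U hU r • V.resSection M L U hU s := by
  change (1 : V.A) ⊗ₜ[M.space.presheaf.stalk M.pt] moduleGerm L M.pt U hU (r • s) =
    V.resOpen M U hU r • ((1 : V.A) ⊗ₜ[M.space.presheaf.stalk M.pt] moduleGerm L M.pt U hU s)
  rw [moduleGerm_smul, TensorProduct.tmul_smul, TensorProduct.smul_tmul',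
    TensorProduct.smul_tmul', Algebra.smul_def, smul_eq_mul]
  rfl

/-- `H^0(M, L)`, as an `O_K`-module. -/
def PointedModel.GlobalSections : Type u := Γ(L, ⊤)

instance : AddCommGroup (M.GlobalSections L) := inferInstanceAs (AddCommGroup Γ(L, ⊤))

instance : Module Γ(M.space, ⊤) (M.GlobalSections L) := inferInstanceAs (Module _ Γ(L, ⊤))

instance : Module (𝓞 K) (M.GlobalSections L) := Module.compHom _ M.constants

/-- Restriction to `V` of global sections of `L`. -/
def FormalGerm.resGlobal : M.GlobalSections L →ₗ[𝓞 K] V.SheafSections M L where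
  toFun s := V.resSection M L ⊤ trivial s
  map_add' s t := map_add (V.resSection M L ⊤ trivial) s t
  map_smul' c s := by
    change V.resSection M L ⊤ trivial (M.constants c • (s : Γ(L, ⊤))) = _
    refine (V.resSection_smul M L ⊤ trivial (M.constants c) s).trans ?_
    rw [V.resOpen_constants, ← IsScalarTower.algebraMap_apply, algebraMap_smul]
    rfl

/-- `H^0(X, L) = K ⊗ H^0(M, L)`, the `K`-vector space with integral structure `H^0(M, L)`. -/
abbrev PointedModel.GenericSections : Type u := K ⊗[𝓞 K] M.GlobalSections L

/-- The integral structure `H^0(M, L)` of `H^0(X, L)`. -/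
def PointedModel.integralSections : Submodule (𝓞 K) (M.GenericSections L) :=
  LinearMap.range (TensorProduct.mk (𝓞 K) K (M.GlobalSections L) 1)

/-- The restriction map `H^0(X, L) → H^0(V, L)`. -/
def FormalGerm.resGeneric : M.GenericSections L →ₗ[K] V.SheafSections M L :=
  (V.resGlobal M L).liftBaseChange K

/-- `E^i`, the kernel of `H^0(X, L) → H^0(V_i, L)`: the sections vanishing to order `i - 1`
along `V`. -/
def FormalGerm.sectionFiltration (i : ℕ) : Submodule K (M.GenericSections L) :=
  ((vanishing V.A (V.SheafSections M L) i).restrictScalars K).comap (V.resGeneric M L)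

/-- The map `E^i → S^i(T^* V) ⊗ L|_P`, whose kernel is `E^(i+1)`; it thus induces the injection
`γ^i : E^i / E^(i+1) → S^i(T^* V) ⊗ L|_P`. -/
def FormalGerm.jetMap (i : ℕ) (s : V.sectionFiltration M L i) :
    JetSpace V.A (V.SheafSections M L) i :=
  jet V.A (V.SheafSections M L) i ⟨V.resGeneric M L s, s.2⟩

/-- The integral structure of `L|_P` at the finite place `v`, given by the pull back of `L` by the
section `Spec O_K → M`: the values at `P` of the sections of `L` near the point of the section
above `v`. -/
def FormalGerm.fibreLattice (v : HeightOneSpectrum (𝓞 K)) : Set (V.SheafSections M L) :=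
  {e | ∃ (U : M.space.Opens) (hU : M.pt ∈ U) (s : Γ(L, U)), M.sec (placePt v) ∈ U ∧
    e = V.resSection M L U hU s}

/-- The ratios `‖γ^i(s)‖_v / ‖s‖_v`, for `s ∈ E^i / E^(i+1)`. Here `E^i / E^(i+1)` carries the
quotient norm of the norm of `H^0(X, L)`, and `S^i(T^* V) ⊗ L|_P` the norm given by the integral
structures `Λ` on `T^* V` and `fibreLattice` on `L|_P`. -/
def FormalGerm.jetRatios (Λ : Submodule (𝓞 K) (CotangentSpace V.A))
    (v : HeightOneSpectrum (𝓞 K)) (i : ℕ) : Set ℝ :=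
  {r | ∃ s : V.sectionFiltration M L i,
    r = latticeNorm v (jetLattice Λ (V.fibreLattice M L v) i) (V.jetMap M L i s) /
      quotientNorm v (M.integralSections L) (V.sectionFiltration M L (i + 1)) s}

/-- The operator norm `‖γ^i‖_v`. -/
def FormalGerm.jetOpNorm (Λ : Submodule (𝓞 K) (CotangentSpace V.A))
    (v : HeightOneSpectrum (𝓞 K)) (i : ℕ) : ℝ :=
  sSup (V.jetRatios M L Λ v i)

end Sections

end LGGerm

end

/-! Everything reduces to Taylor coefficients. In a parametrization of the germ, an `i`-th jet is
the tuple of its coefficients of degree `i`, and its norm at `v` is at most the largest of them, up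
to the `i`-th power of a constant that is 1 at almost all places (`exists_smul_jet_eq`). It is
therefore enough to bound, place by place, the coefficients along `V` of the functions regular at
the point of the section above `v`. The bound sought is `exp (g v * i) / |i!|_v ^ α` with `g ≥ 0`
summable: by the product formula the sum of `-log |i!|_v` is `[K : ℚ] log i! ≤ [K : ℚ] i log i`, and
the sum of the `g v` gives the term linear in `i` (`finsum_log_le`).

At almost all places the bound comes from the growth condition. The étale coordinates `z_k` generate
the maximal ideal at `P` (`PointedModel.maximalIdeal_eq_span`), so finitely many generators `G_l` of
the local ring satisfy relations `h(G) (G_l - G_l(P)) = ∑ z_k p_lk(G)`. Outside finitely many places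
the polynomials are integral and `h(G)` has a unit value at `P`. As the `z_k` have no constant term,
the relations determine the coefficients of the `G_l` degree by degree, and the bounds on the `z_k`
pass to the `G_l` (`mem_boundedSeries_of_relations`); this needs bounded series to form a ring,
which holds because the weight `C ^ |I| / |I!| ^ α` is supermultiplicative. A function regular at
the point above `v` is a quotient of integral polynomials in one fixed list of generators, with a
denominator of unit value, so the exceptional places do not depend on the function
(`PointedModel.localize_mem_boundedSeries`).

At the remaining places analyticity suffices. Convergent equations yield a parametrization, still
defined over `K`, by convergent series (`exists_convergent_parametrization`), through an ultrametric
implicit function theorem (`implicit_growth`) that also carries convergence from the coordinates to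
all algebraic functions. This parametrization varies with `v` and is unrelated to the good one;
comparing it with the integral structure costs a power of a denominator, which is harmless at
finitely many places.

For sections of `L`, a local generator at the point above `v` turns sections into functions regular
there, so the constant does not depend on `L`. The sums over places are finite because the norm of a
non-zero jet is 1 at almost all places: the upper bound tends to 1 while the value group has a gap
above 1, and a non-zero coefficient is almost everywhere a unit. -/

noncomputable section

namespace LGGerm

/-! ### Rings of power series bounded by a supermultiplicative weight -/

section Weights

variable {F σ : Type*} [Field F]

theorem abv_sum_le {abv : AbsoluteValue F ℝ} (hna : IsNonarchimedean abv) {ι : Type*}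
    (s : Finset ι) (f : ι → F) {c : ℝ} (hc : 0 ≤ c) (h : ∀ i ∈ s, abv (f i) ≤ c) :
    abv (∑ i ∈ s, f i) ≤ c := by
  classical
  induction s using Finset.induction_on with
  | empty => simpa using hc
  | insert a s ha ih =>
    rw [Finset.sum_insert ha]
    exact (hna _ _).trans (max_le (h a (by simp)) (ih fun i hi => h i (by simp [hi])))

/-- A supermultiplicative weight on monomials. -/
structure Weight (σ : Type*) where
  /-- the weight of a monomial -/
  toFun : (σ →₀ ℕ) → ℝ
  zero : toFun 0 = 1
  nonneg : ∀ I, 0 ≤ toFun I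
  mul_le : ∀ I J, toFun I * toFun J ≤ toFun (I + J)

/-- The power series whose coefficients in degrees at most `n` are bounded by a weight. -/
def boundedSeries {abv : AbsoluteValue F ℝ} (hna : IsNonarchimedean abv) (w : Weight σ) (n : ℕ) :
    Subring (MvPowerSeries σ F) where
  carrier := {f | ∀ I : σ →₀ ℕ, I.degree ≤ n → abv (MvPowerSeries.coeff I f) ≤ w.toFun I}
  zero_mem' := fun I _ => by simpa using w.nonneg I
  one_mem' := fun I _ => by
    classical
    rw [MvPowerSeries.coeff_one]
    split_ifs with h
    · simp [h, w.zero]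
    · simpa using w.nonneg I
  add_mem' := fun hf hg I hI => by
    rw [map_add]
    exact (hna _ _).trans (max_le (hf I hI) (hg I hI))
  neg_mem' := fun hf I hI => by
    rw [map_neg, AbsoluteValue.map_neg]
    exact hf I hI
  mul_mem' := fun {f g} hf hg I hI => by
    classical
    rw [MvPowerSeries.coeff_mul]
    refine abv_sum_le hna _ _ (w.nonneg I) fun p hp => ?_
    rw [Finset.HasAntidiagonal.mem_antidiagonal] at hp
    have hdeg : p.1.degree + p.2.degree = I.degree := by rw [← hp, map_add]
    rw [map_mul, ← hp]
    exact (mul_le_mul (hf _ (by omega)) (hg _ (by omega)) (abv.nonneg _) (w.nonneg _)).trans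
      (w.mul_le _ _)

variable {abv : AbsoluteValue F ℝ} {hna : IsNonarchimedean abv} {w : Weight σ} {n : ℕ}

theorem mem_boundedSeries {f : MvPowerSeries σ F} : f ∈ boundedSeries hna w n ↔
    ∀ I : σ →₀ ℕ, I.degree ≤ n → abv (MvPowerSeries.coeff I f) ≤ w.toFun I := Iff.rfl

theorem C_mem_boundedSeries {c : F} (hc : abv c ≤ 1) :
    MvPowerSeries.C c ∈ boundedSeries hna w n := fun I _ => by
  classical
  rw [MvPowerSeries.coeff_C]
  split_ifs with h
  · rw [h, w.zero]; exact hc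
  · simpa using w.nonneg I

/-- Without a constant term in `f`, the coefficients of `f * g` up to degree `n + 1` involve `g`
only up to degree `n`. This gain of one degree drives the bootstrapping below. -/
theorem mul_mem_boundedSeries_succ {f g : MvPowerSeries σ F}
    (hf : f ∈ boundedSeries hna w (n + 1)) (hf0 : MvPowerSeries.coeff 0 f = 0)
    (hg : g ∈ boundedSeries hna w n) : f * g ∈ boundedSeries hna w (n + 1) := fun I hI => by
  classical
  rw [MvPowerSeries.coeff_mul]
  refine abv_sum_le hna _ _ (w.nonneg I) fun p hp => ?_
  rw [Finset.HasAntidiagonal.mem_antidiagonal] at hp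
  have hdeg : p.1.degree + p.2.degree = I.degree := by rw [← hp, map_add]
  by_cases h0 : p.1 = 0
  · rw [h0, hf0, zero_mul, map_zero]; exact w.nonneg I
  have h1 : p.1.degree ≠ 0 := by rwa [Ne, Finsupp.degree_eq_zero_iff]
  rw [map_mul, ← hp]
  exact (mul_le_mul (hf _ (by omega)) (hg _ (by omega)) (abv.nonneg _) (w.nonneg _)).trans
    (w.mul_le _ _)

/-- The Cauchy product can be solved for the coefficient of `g` at `I`, since the constant term of
`f` has absolute value 1; the other terms involve `g` in lower degree. -/
theorem abv_coeff_le_of_mul {f g : MvPowerSeries σ F} (hf : f ∈ boundedSeries hna w n)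
    (hf0 : abv (MvPowerSeries.coeff 0 f) = 1) {c : ℝ} (hc : 0 ≤ c)
    (hfg : ∀ I : σ →₀ ℕ, I.degree ≤ n → abv (MvPowerSeries.coeff I (f * g)) ≤ c * w.toFun I)
    (I : σ →₀ ℕ) (hI : I.degree ≤ n) : abv (MvPowerSeries.coeff I g) ≤ c * w.toFun I := by
  classical
  induction hIm : I.degree using Nat.strong_induction_on generalizing I with
  | _ m ih =>
    have h1 := MvPowerSeries.coeff_mul I f g
    rw [← Finset.add_sum_erase _ _ (a := ((0 : σ →₀ ℕ), I)) (by simp)] at h1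
    have h2 : MvPowerSeries.coeff 0 f * MvPowerSeries.coeff I g = MvPowerSeries.coeff I (f * g) -
        ∑ p ∈ (Finset.HasAntidiagonal.antidiagonal I).erase (0, I),
          MvPowerSeries.coeff p.1 f * MvPowerSeries.coeff p.2 g := by
      rw [h1]; ring
    have h3 : abv (MvPowerSeries.coeff I g) =
        abv (MvPowerSeries.coeff 0 f * MvPowerSeries.coeff I g) := by
      rw [map_mul, hf0, one_mul]
    have hcI : 0 ≤ c * w.toFun I := mul_nonneg hc (w.nonneg I)
    rw [h3, h2, sub_eq_add_neg]
    refine (hna _ _).trans (max_le (hfg I (by omega)) ?_)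
    rw [AbsoluteValue.map_neg]
    refine abv_sum_le hna _ _ hcI fun p hp => ?_
    rw [Finset.mem_erase, Finset.HasAntidiagonal.mem_antidiagonal] at hp
    obtain ⟨hp0, hp⟩ := hp
    have hdeg : p.1.degree + p.2.degree = I.degree := by rw [← hp, map_add]
    have h0 : p.1 ≠ 0 := by
      intro h
      apply hp0
      rw [h, zero_add] at hp
      exact Prod.ext h hp
    have h1 : p.1.degree ≠ 0 := by rwa [Ne, Finsupp.degree_eq_zero_iff]
    rw [map_mul, ← hp]
    refine (mul_le_mul (hf _ (by omega)) (ih p.2.degree (by omega) p.2 (by omega) rfl)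
      (abv.nonneg _) (w.nonneg _)).trans ?_
    rw [mul_left_comm]
    exact mul_le_mul_of_nonneg_left (w.mul_le _ _) hc

theorem mem_boundedSeries_of_mul {f g : MvPowerSeries σ F} (hf : f ∈ boundedSeries hna w n)
    (hf0 : abv (MvPowerSeries.coeff 0 f) = 1) (hfg : f * g ∈ boundedSeries hna w n) :
    g ∈ boundedSeries hna w n := fun I hI => by
  have := abv_coeff_le_of_mul hf hf0 zero_le_one (g := g)
    (fun I hI => by rw [one_mul]; exact hfg I hI) I hI
  rwa [one_mul] at this

theorem aeval_mem_boundedSeries {ι : Type*} {G : ι → MvPowerSeries σ F}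
    (hG : ∀ l, G l ∈ boundedSeries hna w n) (p : MvPolynomial ι F)
    (hp : ∀ m, abv (p.coeff m) ≤ 1) : MvPolynomial.aeval G p ∈ boundedSeries hna w n := by
  rw [MvPolynomial.aeval_def, MvPolynomial.eval₂_eq]
  refine Subring.sum_mem _ fun m _ => Subring.mul_mem _ ?_ ?_
  · exact C_mem_boundedSeries (hp m)
  · exact Subring.prod_mem _ fun i _ => Subring.pow_mem _ (hG i) _

/-- Elements generated, up to units and by integral polynomial relations, by bounded power series
without constant term are bounded. -/
theorem mem_boundedSeries_of_relations {ι κ : Type*} [Fintype κ] (G : ι → MvPowerSeries σ F)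
    (Z : κ → MvPowerSeries σ F) (hZ : ∀ n k, Z k ∈ boundedSeries hna w n)
    (hZ0 : ∀ k, MvPowerSeries.coeff 0 (Z k) = 0)
    (hc : ∀ l, abv (MvPowerSeries.coeff 0 (G l)) ≤ 1)
    (h : MvPolynomial ι F) (p : ι → κ → MvPolynomial ι F) (hh : ∀ m, abv (h.coeff m) ≤ 1)
    (hp : ∀ l k m, abv ((p l k).coeff m) ≤ 1)
    (hunit : abv (MvPowerSeries.coeff 0 (MvPolynomial.aeval G h)) = 1)
    (hrel : ∀ l, MvPolynomial.aeval G h *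
      (G l - MvPowerSeries.C (MvPowerSeries.coeff 0 (G l))) =
        ∑ k, Z k * MvPolynomial.aeval G (p l k)) (n : ℕ) (l : ι) :
    G l ∈ boundedSeries hna w n := by
  induction n generalizing l with
  | zero =>
    intro I hI
    have : I = 0 := by rwa [Nat.le_zero, Finsupp.degree_eq_zero_iff] at hI
    subst this
    rw [w.zero]; exact hc l
  | succ n ih =>
    -- The inverse `g` of `h(G)` is bounded up to degree `n`; solving the relation for `G l`
    -- multiplies it by some `Z k`, which reaches degree `n + 1`.
    obtain ⟨g, hg⟩ : ∃ g, g * MvPolynomial.aeval G h = 1 := by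
      refine ⟨(MvPolynomial.aeval G h)⁻¹, MvPowerSeries.inv_mul_cancel _ ?_⟩
      intro h0
      rw [MvPowerSeries.coeff_zero_eq_constantCoeff_apply, h0, map_zero] at hunit
      exact zero_ne_one hunit
    have hgn : g ∈ boundedSeries hna w n := by
      refine mem_boundedSeries_of_mul (aeval_mem_boundedSeries ih h hh) hunit ?_
      rw [mul_comm, hg]; exact Subring.one_mem _
    have h1 : G l = MvPowerSeries.C (MvPowerSeries.coeff 0 (G l)) +
        ∑ k, Z k * (g * MvPolynomial.aeval G (p l k)) := by
      have : ∑ k, Z k * (g * MvPolynomial.aeval G (p l k)) =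
          g * ∑ k, Z k * MvPolynomial.aeval G (p l k) := by
        rw [Finset.mul_sum]; exact Finset.sum_congr rfl fun _ _ => by ring
      rw [this, ← hrel l, ← mul_assoc, hg]; ring
    rw [h1]
    refine Subring.add_mem _ (C_mem_boundedSeries (hc l)) (Subring.sum_mem _ fun k _ => ?_)
    exact mul_mem_boundedSeries_succ (hZ _ k) (hZ0 k)
      (Subring.mul_mem _ hgn (aeval_mem_boundedSeries ih _ (hp l k)))

end Weights

/-! ### Ring endomorphisms close to the identity -/

section Adic

/-- A ring endomorphism of an adically complete ring inducing the identity on the associated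
graded ring is bijective. -/
theorem bijective_of_sub_mem_pow_succ {A : Type*} [CommRing A] (I : Ideal A) [IsAdicComplete I A]
    (θ : A →+* A) (h : ∀ n, ∀ a ∈ I ^ n, θ a - a ∈ I ^ (n + 1)) : Function.Bijective θ := by
  have hle : ∀ n, ∀ a ∈ I ^ n, θ a ∈ I ^ n := fun n a ha => by
    have := Ideal.add_mem _ (Ideal.pow_le_pow_right (Nat.le_succ n) (h n a ha)) ha
    simpa using this
  constructor
  · rw [injective_iff_map_eq_zero]
    intro a ha
    refine IsHausdorff.haus (I := I) inferInstance a fun n => ?_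
    rw [SModEq.zero, smul_eq_mul, Ideal.mul_top]
    induction n with
    | zero => simp
    | succ n ih =>
      have := h n a ih
      rwa [ha, zero_sub, neg_mem_iff] at this
  · intro b
    -- Successive approximation: adding the error `b - θ (s n)` to `s n` improves the error by one
    -- power of `I`.
    let s : ℕ → A := fun n => Nat.rec b (fun _ a => a + (b - θ a)) n
    have hs : ∀ n, s (n + 1) = s n + (b - θ (s n)) := fun n => rfl
    have he : ∀ n, b - θ (s n) ∈ I ^ n := by
      intro n
      induction n with
      | zero => simp
      | succ n ih =>
        have := h n _ ih
        rw [hs, map_add]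
        have h2 : b - (θ (s n) + θ (b - θ (s n))) = -(θ (b - θ (s n)) - (b - θ (s n))) := by ring
        rw [h2, neg_mem_iff]
        exact this
    have hc : ∀ {m n}, m ≤ n → s m ≡ s n [SMOD (I ^ m • ⊤ : Submodule A A)] := by
      intro m n hmn
      induction n, hmn using Nat.le_induction with
      | base => rfl
      | succ n hmn ih =>
        refine ih.trans ?_
        rw [SModEq.sub_mem, smul_eq_mul, Ideal.mul_top, hs]
        have : s n - (s n + (b - θ (s n))) = -(b - θ (s n)) := by ring
        rw [this, neg_mem_iff]
        exact Ideal.pow_le_pow_right hmn (he n)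
    obtain ⟨a, ha⟩ := IsPrecomplete.prec (I := I) (M := A) inferInstance hc
    refine ⟨a, ?_⟩
    rw [← sub_eq_zero]
    refine IsHausdorff.haus (I := I) inferInstance _ fun n => ?_
    rw [SModEq.zero, smul_eq_mul, Ideal.mul_top]
    have h1 := ha n
    rw [SModEq.sub_mem, smul_eq_mul, Ideal.mul_top] at h1
    have h2 : θ a - b = -(θ (s n - a)) - (b - θ (s n)) := by rw [map_sub]; ring
    rw [h2]
    exact Ideal.sub_mem _ (neg_mem (hle n _ h1)) (he n)

/-- Induction on `n` by the twisted Leibniz rule `θ (b * c) - b * c = (θ b - b) * θ c + b * (θ c -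
c)`. -/
theorem sub_mem_pow_succ_of_sub_mem {A : Type*} [CommRing A] (I : Ideal A) (θ : A →+* A)
    (h0 : ∀ a, θ a - a ∈ I) (h1 : ∀ a ∈ I, θ a - a ∈ I ^ 2) (n : ℕ) :
    ∀ a ∈ I ^ n, θ a - a ∈ I ^ (n + 1) := by
  induction n with
  | zero => intro a _; simpa using h0 a
  | succ n ih =>
    intro a ha
    rw [pow_succ'] at ha
    induction ha using Submodule.mul_induction_on' with
    | mem_mul_mem b hb c hc =>
      have : θ (b * c) - b * c = (θ b - b) * θ c + b * (θ c - c) := by rw [map_mul]; ring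
      rw [this]
      have hc' : θ c ∈ I ^ n := by
        have := Ideal.add_mem _ (Ideal.pow_le_pow_right (Nat.le_succ n) (ih c hc)) hc
        simpa using this
      refine Ideal.add_mem _ ?_ ?_
      · have := Ideal.mul_mem_mul (h1 b hb) hc'
        rwa [← pow_add, show 2 + n = n + 1 + 1 by ring] at this
      · have := Ideal.mul_mem_mul hb (ih c hc)
        rwa [← pow_succ'] at this
    | add x hx y hy h1 h2 =>
      have : θ (x + y) - (x + y) = (θ x - x) + (θ y - y) := by rw [map_add]; ring
      rw [this]
      exact Ideal.add_mem _ h1 h2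

end Adic

/-! ### The maximal ideal of a power series ring and the formal inverse function theorem -/

section PowerSeries

variable {F σ : Type*} [Field F]

theorem mem_maximalIdeal_mvPowerSeries {f : MvPowerSeries σ F} :
    f ∈ maximalIdeal (MvPowerSeries σ F) ↔ MvPowerSeries.constantCoeff f = 0 := by
  rw [mem_maximalIdeal, mem_nonunits_iff, MvPowerSeries.isUnit_iff_constantCoeff,
    isUnit_iff_ne_zero, not_not]

theorem exists_eq_sum_X_mul [Fintype σ] (n : ℕ) (f : MvPowerSeries σ F)
    (hf : ∀ I : σ →₀ ℕ, I.degree < n + 1 → MvPowerSeries.coeff I f = 0) :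
    ∃ g : σ → MvPowerSeries σ F, f = ∑ j, MvPowerSeries.X j * g j ∧
      ∀ j, ∀ I : σ →₀ ℕ, I.degree < n → MvPowerSeries.coeff I (g j) = 0 := by
  classical
  -- Each non-constant monomial is assigned to one variable dividing it, so that `f` is split
  -- without overlap and every quotient loses exactly one degree.
  have hex : ∀ I : σ →₀ ℕ, ∃ j : Option σ, (∀ k, j = some k → I k ≠ 0) ∧ (j = none → I = 0) := by
    intro I
    by_cases h : I = 0
    · exact ⟨none, by simp, fun _ => h⟩
    · obtain ⟨j, hj⟩ := Finsupp.ne_iff.1 h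
      exact ⟨some j, fun k hk => by cases hk; simpa using hj, by simp⟩
  choose c hc hc0 using hex
  let g : σ → MvPowerSeries σ F := fun j I => if c (I + Finsupp.single j 1) = some j then
    MvPowerSeries.coeff (I + Finsupp.single j 1) f else 0
  have hg : ∀ j I, MvPowerSeries.coeff I (g j) = if c (I + Finsupp.single j 1) = some j then
    MvPowerSeries.coeff (I + Finsupp.single j 1) f else 0 := fun _ _ => rfl
  refine ⟨g, ?_, ?_⟩
  · ext I
    rw [map_sum]
    have key : ∀ j, MvPowerSeries.coeff I (MvPowerSeries.X j * g j) =
        if c I = some j then MvPowerSeries.coeff I f else 0 := by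
      intro j
      change MvPowerSeries.coeff I (MvPowerSeries.monomial (Finsupp.single j 1) 1 * g j) = _
      by_cases hj : I j = 0
      · rw [MvPowerSeries.coeff_monomial_mul, if_neg, if_neg]
        · intro h; exact hc I j h hj
        · intro h
          have := h j
          simp [hj] at this
      · have hI : Finsupp.single j 1 ≤ I := by
          rwa [Finsupp.single_le_iff, Nat.one_le_iff_ne_zero]
        rw [MvPowerSeries.coeff_monomial_mul, if_pos hI, one_mul, hg, tsub_add_cancel_of_le hI]
    rw [Finset.sum_congr rfl fun j _ => key j]
    by_cases hI : I = 0
    · rw [hf I (by simp [hI])]; simp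
    · rcases h : c I with _ | k
      · exact absurd (hc0 I h) hI
      · simp
  · intro j I hI
    rw [hg, hf, ite_self]
    rw [map_add, Finsupp.degree_single]
    omega

theorem maximalIdeal_mvPowerSeries_eq_span [Finite σ] :
    maximalIdeal (MvPowerSeries σ F) = Ideal.span (Set.range MvPowerSeries.X) := by
  cases nonempty_fintype σ
  apply le_antisymm
  · intro f hf
    rw [mem_maximalIdeal_mvPowerSeries] at hf
    obtain ⟨g, hg, -⟩ := exists_eq_sum_X_mul 0 f (by
      intro I hI
      have : I = 0 := by rw [← Finsupp.degree_eq_zero_iff]; omega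
      subst this
      exact hf)
    rw [hg]
    exact Ideal.sum_mem _ fun j _ => Ideal.mul_mem_right _ _ (Ideal.subset_span ⟨j, rfl⟩)
  · rw [Ideal.span_le]
    rintro _ ⟨j, rfl⟩
    exact mem_maximalIdeal_mvPowerSeries.2 (MvPowerSeries.constantCoeff_X j)

instance [Finite σ] :
    IsAdicComplete (maximalIdeal (MvPowerSeries σ F)) (MvPowerSeries σ F) := by
  rw [maximalIdeal_mvPowerSeries_eq_span]; infer_instance

theorem mem_pow_maximalIdeal_iff [Finite σ] {n : ℕ} {f : MvPowerSeries σ F} :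
    f ∈ maximalIdeal (MvPowerSeries σ F) ^ n ↔
      ∀ I : σ →₀ ℕ, I.degree < n → MvPowerSeries.coeff I f = 0 := by
  classical
  cases nonempty_fintype σ
  constructor
  · induction n generalizing f with
    | zero => intro _ I hI; omega
    | succ n ih =>
      intro hf
      rw [pow_succ'] at hf
      induction hf using Submodule.mul_induction_on' with
      | mem_mul_mem b hb c hc =>
        intro I hI
        rw [MvPowerSeries.coeff_mul]
        refine Finset.sum_eq_zero fun p hp => ?_
        rw [Finset.HasAntidiagonal.mem_antidiagonal] at hp
        have hdeg : p.1.degree + p.2.degree = I.degree := by rw [← hp, map_add]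
        by_cases h0 : p.1 = 0
        · have := mem_maximalIdeal_mvPowerSeries.1 hb
          rw [h0, MvPowerSeries.coeff_zero_eq_constantCoeff_apply, this, zero_mul]
        · have h1 : p.1.degree ≠ 0 := by rwa [Ne, Finsupp.degree_eq_zero_iff]
          rw [ih hc p.2 (by omega), mul_zero]
      | add x hx y hy h1 h2 =>
        intro I hI
        rw [map_add, h1 I hI, h2 I hI, add_zero]
  · induction n generalizing f with
    | zero => intro _; simp
    | succ n ih =>
      intro hf
      obtain ⟨g, hg, hg'⟩ := exists_eq_sum_X_mul n f hf
      rw [hg, pow_succ']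
      exact Ideal.sum_mem _ fun j _ => Ideal.mul_mem_mul
        (mem_maximalIdeal_mvPowerSeries.2 (MvPowerSeries.constantCoeff_X j)) (ih (hg' j))

theorem hasSubst_of_mem_maximalIdeal {τ : Type*} [Finite σ] {y : σ → MvPowerSeries τ F}
    (hy : ∀ j, y j ∈ maximalIdeal (MvPowerSeries τ F)) : MvPowerSeries.HasSubst y :=
  MvPowerSeries.hasSubst_of_constantCoeff_zero fun j => mem_maximalIdeal_mvPowerSeries.1 (hy j)

/-- The formal inverse function theorem, for a map whose differential is the identity. -/
theorem exists_algEquiv_of_sub_X_mem [Finite σ] (y : σ → MvPowerSeries σ F)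
    (hy : ∀ j, y j - MvPowerSeries.X j ∈ maximalIdeal (MvPowerSeries σ F) ^ 2) :
    ∃ ψ : MvPowerSeries σ F ≃ₐ[F] MvPowerSeries σ F, ∀ j, ψ (y j) = MvPowerSeries.X j := by
  cases nonempty_fintype σ
  set m := maximalIdeal (MvPowerSeries σ F)
  have hym : ∀ j, y j ∈ m := fun j => by
    have h1 := Ideal.pow_le_self two_ne_zero (hy j)
    have := Ideal.add_mem _ h1 (mem_maximalIdeal_mvPowerSeries.2 (MvPowerSeries.constantCoeff_X j))
    simpa using this
  have hs := hasSubst_of_mem_maximalIdeal hym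
  let θ : MvPowerSeries σ F →ₐ[F] MvPowerSeries σ F := MvPowerSeries.substAlgHom hs
  have hθX : ∀ j, θ (MvPowerSeries.X j) = y j := MvPowerSeries.substAlgHom_X hs
  have h0 : ∀ a, θ a - a ∈ m := by
    have hm : ∀ a ∈ m, θ a ∈ m := fun a ha => by
      rw [mem_maximalIdeal_mvPowerSeries] at ha ⊢
      change MvPowerSeries.constantCoeff (MvPowerSeries.substAlgHom hs a) = 0
      rw [MvPowerSeries.substAlgHom_apply]
      exact MvPowerSeries.constantCoeff_subst_eq_zero hs
        (fun j => mem_maximalIdeal_mvPowerSeries.1 (hym j)) ha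
    intro a
    have ha : a - algebraMap F _ (MvPowerSeries.constantCoeff a) ∈ m := by
      rw [mem_maximalIdeal_mvPowerSeries]
      simp [MvPowerSeries.algebraMap_apply]
    have h2 := hm _ ha
    rw [map_sub, AlgHom.commutes] at h2
    have := Ideal.sub_mem _ h2 ha
    simpa using this
  have h1 : ∀ a ∈ m, θ a - a ∈ m ^ 2 := by
    intro a ha
    rw [mem_maximalIdeal_mvPowerSeries] at ha
    obtain ⟨g, hg, -⟩ := exists_eq_sum_X_mul 0 a (by
      intro I hI
      have : I = 0 := by rw [← Finsupp.degree_eq_zero_iff]; omega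
      subst this
      exact ha)
    rw [hg, map_sum, ← Finset.sum_sub_distrib]
    refine Ideal.sum_mem _ fun j _ => ?_
    rw [map_mul, hθX]
    have : y j * θ (g j) - MvPowerSeries.X j * g j =
      (y j - MvPowerSeries.X j) * θ (g j) + MvPowerSeries.X j * (θ (g j) - g j) := by ring
    rw [this]
    refine Ideal.add_mem _ (Ideal.mul_mem_right _ _ (hy j)) ?_
    rw [pow_two]
    exact Ideal.mul_mem_mul (mem_maximalIdeal_mvPowerSeries.2 (MvPowerSeries.constantCoeff_X j))
      (h0 _)
  -- The substitution `X j ↦ y j` is the identity on the associated graded ring, hence invertible;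
  -- its inverse is the required change of parameters.
  have hb := bijective_of_sub_mem_pow_succ m (θ : MvPowerSeries σ F →+* MvPowerSeries σ F)
    (sub_mem_pow_succ_of_sub_mem m _ h0 h1)
  refine ⟨(AlgEquiv.ofBijective θ hb).symm, fun j => ?_⟩
  rw [AlgEquiv.symm_apply_eq]
  exact (hθX j).symm

end PowerSeries

/-! ### An implicit function theorem with ultrametric estimates -/

section Implicit

variable {F σ ι : Type*} [Field F]

/-- A power series with coefficients of at most geometric growth. -/
def HasGeometricGrowth (abv : AbsoluteValue F ℝ) (f : MvPowerSeries σ F) : Prop :=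
  ∃ D : ℝ, 1 ≤ D ∧ ∀ I : σ →₀ ℕ, abv (MvPowerSeries.coeff I f) ≤ D ^ (I.degree + 1)

/-- All factors lack a constant term, so when the other `|J| - 1` factors use at least one degree
each, a single factor contributes in degree at most `|I| - |J| + 1`. Hence the range `|I| + 1 ≤ n +
|J|`, in which the bounds up to degree `n` are enough. -/
theorem abv_coeff_prod_le {abv : AbsoluteValue F ℝ} (hna : IsNonarchimedean abv)
    {τ : ι → MvPowerSeries σ F} {D E : ℝ} (hD : 1 ≤ D) (hE : 1 ≤ E) (n : ℕ)
    (h0 : ∀ k, MvPowerSeries.coeff 0 (τ k) = 0)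
    (h : ∀ k, ∀ I : σ →₀ ℕ, I.degree ≤ n → abv (MvPowerSeries.coeff I (τ k)) ≤ D ^ I.degree / E)
    (J : ι →₀ ℕ) :
    (∀ I : σ →₀ ℕ, I.degree < J.degree →
      MvPowerSeries.coeff I (J.prod fun k e => τ k ^ e) = 0) ∧
    ∀ I : σ →₀ ℕ, I.degree + 1 ≤ n + J.degree →
      abv (MvPowerSeries.coeff I (J.prod fun k e => τ k ^ e)) ≤ D ^ I.degree / E ^ J.degree := by
  classical
  have hmul : ∀ (f g : MvPowerSeries σ F) (r s : ℕ),
      ((∀ I : σ →₀ ℕ, I.degree < r → MvPowerSeries.coeff I f = 0) ∧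
        ∀ I : σ →₀ ℕ, I.degree + 1 ≤ n + r →
          abv (MvPowerSeries.coeff I f) ≤ D ^ I.degree / E ^ r) →
      ((∀ I : σ →₀ ℕ, I.degree < s → MvPowerSeries.coeff I g = 0) ∧
        ∀ I : σ →₀ ℕ, I.degree + 1 ≤ n + s →
          abv (MvPowerSeries.coeff I g) ≤ D ^ I.degree / E ^ s) →
      ((∀ I : σ →₀ ℕ, I.degree < r + s → MvPowerSeries.coeff I (f * g) = 0) ∧
        ∀ I : σ →₀ ℕ, I.degree + 1 ≤ n + (r + s) →
          abv (MvPowerSeries.coeff I (f * g)) ≤ D ^ I.degree / E ^ (r + s)) := by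
    rintro f g r s ⟨hf0, hf⟩ ⟨hg0, hg⟩
    constructor
    · intro I hI
      rw [MvPowerSeries.coeff_mul]
      refine Finset.sum_eq_zero fun p hp => ?_
      rw [Finset.HasAntidiagonal.mem_antidiagonal] at hp
      have hdeg : p.1.degree + p.2.degree = I.degree := by rw [← hp, map_add]
      rcases lt_or_ge p.1.degree r with h1 | h1
      · rw [hf0 _ h1, zero_mul]
      · rw [hg0 _ (by omega), mul_zero]
    · intro I hI
      rw [MvPowerSeries.coeff_mul]
      refine abv_sum_le hna _ _ (by positivity) fun p hp => ?_
      rw [Finset.HasAntidiagonal.mem_antidiagonal] at hp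
      have hdeg : p.1.degree + p.2.degree = I.degree := by rw [← hp, map_add]
      rcases lt_or_ge p.1.degree r with h1 | h1
      · rw [hf0 _ h1, zero_mul, map_zero]; positivity
      rcases lt_or_ge p.2.degree s with h2 | h2
      · rw [hg0 _ h2, mul_zero, map_zero]; positivity
      rw [map_mul, ← hdeg, pow_add, pow_add, mul_div_mul_comm]
      exact mul_le_mul (hf _ (by omega)) (hg _ (by omega)) (abv.nonneg _) (by positivity)
  induction J using Finsupp.induction_linear with
  | zero =>
    refine ⟨fun I hI => by simp at hI, fun I _ => ?_⟩
    rw [Finsupp.prod_zero_index, map_zero, pow_zero, div_one, MvPowerSeries.coeff_one]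
    split_ifs
    · rw [map_one]; exact one_le_pow₀ hD
    · rw [map_zero]; positivity
  | add J₁ J₂ h1 h2 =>
    rw [Finsupp.prod_add_index' (by simp) (by intros; rw [pow_add]), map_add]
    exact hmul _ _ _ _ h1 h2
  | single k m =>
    rw [Finsupp.prod_single_index (by simp), Finsupp.degree_single]
    induction m with
    | zero =>
      refine ⟨fun I hI => by simp at hI, fun I _ => ?_⟩
      rw [pow_zero, pow_zero, div_one, MvPowerSeries.coeff_one]
      split_ifs
      · rw [map_one]; exact one_le_pow₀ hD
      · rw [map_zero]; positivity
    | succ m ih =>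
      rw [pow_succ (τ k)]
      refine hmul _ _ _ _ ih ⟨fun I hI => ?_, fun I hI => ?_⟩
      · have : I = 0 := by rw [← Finsupp.degree_eq_zero_iff]; omega
        rw [this, h0]
      · rw [pow_one]; exact h k I (by omega)

/-- The implicit function theorem for power series over a nonarchimedean field:
the formal solution of a convergent system is convergent. -/
theorem implicit_growth [Finite ι] {abv : AbsoluteValue F ℝ} (hna : IsNonarchimedean abv)
    (τ l : ι → MvPowerSeries σ F) (Q : ι → MvPowerSeries ι F)
    (h0 : ∀ k, MvPowerSeries.coeff 0 (τ k) = 0)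
    (hl : ∀ k, HasGeometricGrowth abv (l k)) (hQ : ∀ k, HasGeometricGrowth abv (Q k))
    (hQ2 : ∀ k, ∀ J : ι →₀ ℕ, J.degree < 2 → MvPowerSeries.coeff J (Q k) = 0)
    (heq : ∀ k, τ k = l k + MvPowerSeries.subst τ (Q k)) (k : ι) :
    HasGeometricGrowth abv (τ k) := by
  cases nonempty_fintype ι
  have hs : MvPowerSeries.HasSubst τ := MvPowerSeries.hasSubst_of_constantCoeff_zero h0
  choose Dl hDl1 hDl using hl
  choose Bq hBq1 hBq using hQ
  obtain ⟨D₀, hD₀1, hD₀⟩ : ∃ D₀ : ℝ, 1 ≤ D₀ ∧ ∀ k, Dl k ≤ D₀ := by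
    refine ⟨1 + ∑ k, Dl k, ?_, fun k => ?_⟩
    · have : 0 ≤ ∑ k, Dl k := Finset.sum_nonneg fun k _ => zero_le_one.trans (hDl1 k)
      linarith
    · have := Finset.single_le_sum (f := Dl) (fun k _ => zero_le_one.trans (hDl1 k))
        (Finset.mem_univ k)
      linarith
  obtain ⟨B₀, hB₀1, hB₀⟩ : ∃ B₀ : ℝ, 1 ≤ B₀ ∧ ∀ k, Bq k ≤ B₀ := by
    refine ⟨1 + ∑ k, Bq k, ?_, fun k => ?_⟩
    · have : 0 ≤ ∑ k, Bq k := Finset.sum_nonneg fun k _ => zero_le_one.trans (hBq1 k)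
      linarith
    · have := Finset.single_le_sum (f := Bq) (fun k _ => zero_le_one.trans (hBq1 k))
        (Finset.mem_univ k)
      linarith
  -- The squares absorb the `+ 1` in the exponents. With `E = B ^ 2`, a term of order `|J| ≥ 2`
  -- contributes `B ^ |J| / E ^ |J| = 1 / B ^ |J| ≤ 1 / E`, so the bound `D ^ |I| / E` reproduces
  -- itself; the factor `E * D₀ ^ 2` in `D` makes room for the term `l k`.
  set B := B₀ ^ 2 with hB
  have hB1 : 1 ≤ B := one_le_pow₀ hB₀1
  set E := B ^ 2 with hE
  have hE1 : 1 ≤ E := one_le_pow₀ hB1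
  set D := E * D₀ ^ 2 with hD
  have hD1 : 1 ≤ D := one_le_mul_of_one_le_of_one_le hE1 (one_le_pow₀ hD₀1)
  have hD0pos : 0 < D₀ := by linarith
  have hEpos : 0 < E := by linarith
  have hBpos : 0 < B := by linarith
  have main : ∀ n : ℕ, ∀ k, ∀ I : σ →₀ ℕ, I.degree ≤ n →
      abv (MvPowerSeries.coeff I (τ k)) ≤ D ^ I.degree / E := by
    intro n
    induction n with
    | zero =>
      intro k I hI
      have : I = 0 := by rw [← Finsupp.degree_eq_zero_iff]; omega
      rw [this, h0, map_zero]; positivity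
    | succ n ih =>
      intro k I hI
      rcases Nat.lt_or_ge I.degree (n + 1) with hlt | hge
      · exact ih k I (by omega)
      have hIn : I.degree = n + 1 := le_antisymm hI hge
      rw [heq k, map_add]
      refine (hna _ _).trans (max_le ?_ ?_)
      · refine (hDl k I).trans ?_
        calc Dl k ^ (I.degree + 1) ≤ D₀ ^ (I.degree + 1) :=
              pow_le_pow_left₀ (zero_le_one.trans (hDl1 k)) (hD₀ k) _
          _ ≤ D₀ ^ (2 * I.degree) := pow_le_pow_right₀ hD₀1 (by omega)
          _ = (D₀ ^ 2) ^ I.degree := by rw [pow_mul]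
          _ ≤ D ^ I.degree / E := by
              rw [le_div_iff₀ hEpos, hD, mul_pow, mul_comm]
              exact mul_le_mul_of_nonneg_right (le_self_pow₀ hE1 (by omega)) (by positivity)
      · rw [MvPowerSeries.coeff_subst hs,
          finsum_eq_sum _ (MvPowerSeries.coeff_subst_finite hs (Q k) I)]
        refine abv_sum_le hna _ _ (by positivity) fun J _ => ?_
        rcases Nat.lt_or_ge J.degree 2 with hJ | hJ
        · rw [hQ2 k J hJ, zero_smul, map_zero]; positivity
        rw [smul_eq_mul, map_mul]
        -- Here `|I| = n + 1` and `|J| ≥ 2`, so the induction hypothesis in degrees at most `n`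
        -- covers all the factors.
        have h1 := (abv_coeff_prod_le hna hD1 hE1 n h0 ih J).2 I (by omega)
        have h2 : abv (MvPowerSeries.coeff J (Q k)) ≤ B ^ J.degree := by
          refine (hBq k J).trans ?_
          calc Bq k ^ (J.degree + 1) ≤ B₀ ^ (J.degree + 1) :=
              pow_le_pow_left₀ (zero_le_one.trans (hBq1 k)) (hB₀ k) _
          _ ≤ B₀ ^ (2 * J.degree) := pow_le_pow_right₀ hB₀1 (by omega)
          _ = B ^ J.degree := by rw [pow_mul]
        refine (mul_le_mul h2 h1 (abv.nonneg _) (by positivity)).trans ?_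
        have h3 : E ^ J.degree = B ^ J.degree * B ^ J.degree := by
          rw [hE, ← pow_mul, ← pow_add]; congr 1; ring
        rw [h3]
        have h4 : B ^ J.degree * (D ^ I.degree / (B ^ J.degree * B ^ J.degree)) =
            D ^ I.degree / B ^ J.degree := by field_simp
        rw [h4]
        exact div_le_div_of_nonneg_left (by positivity) hEpos (pow_le_pow_right₀ hB1 hJ)
  refine ⟨D, hD1, fun I => (main _ k I le_rfl).trans ?_⟩
  calc D ^ I.degree / E ≤ D ^ I.degree := div_le_self (by positivity) hE1
    _ ≤ D ^ (I.degree + 1) := pow_le_pow_right₀ hD1 (by omega)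

end Implicit

/-! ### Series of geometric growth -/

section Growth

variable {F σ : Type*} [Field F] {abv : AbsoluteValue F ℝ}

/-- The weight `D ^ |I|`. -/
def geometricWeight (σ : Type*) {D : ℝ} (hD : 0 ≤ D) : Weight σ where
  toFun I := D ^ I.degree
  zero := by simp
  nonneg I := pow_nonneg hD _
  mul_le I J := by rw [map_add, pow_add]

/-- The ring of power series with coefficients of at most geometric growth. -/
def geometricSeries (hna : IsNonarchimedean abv) (σ : Type*) : Subring (MvPowerSeries σ F) where
  carrier := {f | HasGeometricGrowth abv f}
  zero_mem' := ⟨1, le_rfl, fun I => by simp⟩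
  one_mem' := ⟨1, le_rfl, fun I => by
    classical
    rw [MvPowerSeries.coeff_one]; split_ifs <;> simp⟩
  add_mem' := by
    rintro f g ⟨D, hD1, hD⟩ ⟨E, hE1, hE⟩
    refine ⟨max D E, le_max_of_le_left hD1, fun I => ?_⟩
    rw [map_add]
    refine (hna _ _).trans (max_le ((hD I).trans ?_) ((hE I).trans ?_))
    · exact pow_le_pow_left₀ (by linarith) (le_max_left _ _) _
    · exact pow_le_pow_left₀ (by linarith) (le_max_right _ _) _
  neg_mem' := by
    rintro f ⟨D, hD1, hD⟩
    refine ⟨D, hD1, fun I => ?_⟩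
    rw [map_neg, AbsoluteValue.map_neg]; exact hD I
  mul_mem' := by
    rintro f g ⟨D, hD1, hD⟩ ⟨E, hE1, hE⟩
    have hM1 : 1 ≤ max D E := le_max_of_le_left hD1
    refine ⟨max D E ^ 2, one_le_pow₀ hM1, fun I => ?_⟩
    classical
    rw [MvPowerSeries.coeff_mul]
    refine abv_sum_le hna _ _ (by positivity) fun p hp => ?_
    rw [Finset.HasAntidiagonal.mem_antidiagonal] at hp
    have hdeg : p.1.degree + p.2.degree = I.degree := by rw [← hp, map_add]
    rw [map_mul, ← pow_mul]
    calc _ ≤ D ^ (p.1.degree + 1) * E ^ (p.2.degree + 1) :=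
          mul_le_mul (hD _) (hE _) (abv.nonneg _) (by positivity)
      _ ≤ max D E ^ (p.1.degree + 1) * max D E ^ (p.2.degree + 1) :=
          mul_le_mul (pow_le_pow_left₀ (by linarith) (le_max_left _ _) _)
            (pow_le_pow_left₀ (by linarith) (le_max_right _ _) _) (by positivity) (by positivity)
      _ ≤ _ := by rw [← pow_add]; exact pow_le_pow_right₀ hM1 (by omega)

theorem C_mem_geometricSeries (hna : IsNonarchimedean abv) (c : F) :
    MvPowerSeries.C c ∈ geometricSeries hna σ := by
  classical
  refine ⟨max 1 (abv c), le_max_left _ _, fun I => ?_⟩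
  rw [MvPowerSeries.coeff_C]
  split_ifs with h
  · simp [h]
  · rw [map_zero]; positivity

theorem X_mem_geometricSeries (hna : IsNonarchimedean abv) (j : σ) :
    MvPowerSeries.X j ∈ geometricSeries hna σ := by
  classical
  refine ⟨1, le_rfl, fun I => ?_⟩
  rw [MvPowerSeries.coeff_X]
  split_ifs <;> simp

theorem aeval_mem_geometricSeries (hna : IsNonarchimedean abv) {ι : Type*}
    {G : ι → MvPowerSeries σ F} (hG : ∀ l, G l ∈ geometricSeries hna σ) (p : MvPolynomial ι F) :
    MvPolynomial.aeval G p ∈ geometricSeries hna σ := by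
  rw [MvPolynomial.aeval_def, MvPolynomial.eval₂_eq]
  refine Subring.sum_mem _ fun m _ => Subring.mul_mem _ (C_mem_geometricSeries hna _) ?_
  exact Subring.prod_mem _ fun i _ => Subring.pow_mem _ (hG i) _

theorem coe_mem_geometricSeries (hna : IsNonarchimedean abv) (p : MvPolynomial σ F) :
    (p : MvPowerSeries σ F) ∈ geometricSeries hna σ := by
  have : (p : MvPowerSeries σ F) = MvPolynomial.aeval MvPowerSeries.X p := by
    rw [← MvPowerSeries.subst_coe (R := F), MvPowerSeries.subst_self]; rfl
  rw [this]
  exact aeval_mem_geometricSeries hna (X_mem_geometricSeries hna) p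

/-- After scaling, the constant term of `f` is 1. The exponent `|J| + 1` is at most `2 |J|` for `J ≠
0`, so `f` obeys the genuinely multiplicative weight given by `max D E ^ 2`, while `f * g` obeys it
up to the factor `max D E`. -/
theorem mem_geometricSeries_of_mul (hna : IsNonarchimedean abv) {f g : MvPowerSeries σ F}
    (hf : f ∈ geometricSeries hna σ) (hf0 : MvPowerSeries.coeff 0 f ≠ 0)
    (hfg : f * g ∈ geometricSeries hna σ) : g ∈ geometricSeries hna σ := by
  wlog h1 : MvPowerSeries.coeff 0 f = 1 generalizing f
  · refine this (f := MvPowerSeries.C (MvPowerSeries.coeff 0 f)⁻¹ * f)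
      (Subring.mul_mem _ (C_mem_geometricSeries hna _) hf) ?_ ?_ ?_
    · simpa using hf0
    · rw [mul_assoc]; exact Subring.mul_mem _ (C_mem_geometricSeries hna _) hfg
    · rw [MvPowerSeries.coeff_C_mul, inv_mul_cancel₀ hf0]
  obtain ⟨D, hD1, hD⟩ := hf
  obtain ⟨E, hE1, hE⟩ := hfg
  have hM1 : 1 ≤ max D E := le_max_of_le_left hD1
  refine ⟨max D E ^ 2, one_le_pow₀ hM1, fun I => ?_⟩
  have h2 : f ∈ boundedSeries hna (geometricWeight σ (D := max D E ^ 2) (by positivity))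
      I.degree := by
    intro J _
    change _ ≤ (max D E ^ 2) ^ J.degree
    rcases eq_or_ne J 0 with rfl | hJ
    · rw [h1]; simp
    have hJ' : J.degree ≠ 0 := by rwa [Ne, Finsupp.degree_eq_zero_iff]
    refine (hD J).trans ?_
    rw [← pow_mul]
    exact (pow_le_pow_left₀ (by linarith) (le_max_left _ _) _).trans
      (pow_le_pow_right₀ hM1 (by omega))
  refine (abv_coeff_le_of_mul h2 (by rw [h1, map_one]) (c := max D E) (by positivity)
    (fun J _ => (hE J).trans ?_) I le_rfl).trans ?_
  · change _ ≤ max D E * (max D E ^ 2) ^ J.degree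
    rw [← pow_mul, ← pow_succ']
    exact (pow_le_pow_left₀ (by linarith) (le_max_right _ _) _).trans
      (pow_le_pow_right₀ hM1 (by omega))
  · change max D E * (max D E ^ 2) ^ I.degree ≤ _
    rw [← pow_mul, ← pow_succ', ← pow_mul]
    exact pow_le_pow_right₀ hM1 (by omega)

end Growth

/-! ### Convergent parametrizations of analytic germs -/

section Reparametrization

variable {K : Type*} [Field K]

/-- If `r f` had a non-zero constant term `c`, then `f - c` would be a unit, whereas `r (f - c)` has
no constant term. Thus locality of `r` needs no continuity assumption. -/
theorem algHom_mem_maximalIdeal {O σ : Type*} [CommRing O] [IsLocalRing O] [Algebra K O]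
    (r : O →ₐ[K] MvPowerSeries σ K) {f : O} (hf : f ∈ maximalIdeal O) :
    r f ∈ maximalIdeal (MvPowerSeries σ K) := by
  rw [mem_maximalIdeal_mvPowerSeries]
  by_contra h
  have h1 : IsUnit (f - algebraMap K O (MvPowerSeries.constantCoeff (r f))) := by
    rw [← neg_sub]
    refine IsUnit.neg ?_
    have h2 : IsUnit (algebraMap K O (MvPowerSeries.constantCoeff (r f))) :=
      (isUnit_iff_ne_zero.2 h).map _
    by_contra h3
    have := Ideal.add_mem _ ((mem_maximalIdeal _).2 h3) hf
    rw [sub_add_cancel] at this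
    exact (mem_maximalIdeal _).1 this h2
  have h2 := h1.map r
  rw [map_sub, AlgHom.commutes] at h2
  have h3 : r f - algebraMap K _ (MvPowerSeries.constantCoeff (r f)) ∈
      maximalIdeal (MvPowerSeries σ K) := by
    rw [mem_maximalIdeal_mvPowerSeries]; simp [MvPowerSeries.algebraMap_apply]
  exact (mem_maximalIdeal _).1 h3 h2

theorem algHom_mem_pow_maximalIdeal {O σ : Type*} [CommRing O] [IsLocalRing O] [Algebra K O]
    (r : O →ₐ[K] MvPowerSeries σ K) {n : ℕ} {f : O} (hf : f ∈ maximalIdeal O ^ n) :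
    r f ∈ maximalIdeal (MvPowerSeries σ K) ^ n := by
  have h1 : Ideal.map (r : O →+* MvPowerSeries σ K) (maximalIdeal O) ≤
      maximalIdeal (MvPowerSeries σ K) :=
    Ideal.map_le_iff_le_comap.2 fun x hx => algHom_mem_maximalIdeal r hx
  have h2 := Ideal.mem_map_of_mem (r : O →+* MvPowerSeries σ K) hf
  rw [Ideal.map_pow] at h2
  exact Ideal.pow_right_mono h1 n h2

theorem exists_eq_sum_X_mul_of_mem {σ : Type*} [Fintype σ] {f : MvPowerSeries σ K}
    (hf : f ∈ maximalIdeal (MvPowerSeries σ K)) :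
    ∃ g : σ → MvPowerSeries σ K, f = ∑ j, MvPowerSeries.X j * g j := by
  obtain ⟨g, hg, -⟩ := exists_eq_sum_X_mul 0 f (by
    intro I hI
    have : I = 0 := by rw [← Finsupp.degree_eq_zero_iff]; omega
    subst this
    exact mem_maximalIdeal_mvPowerSeries.1 hf)
  exact ⟨g, hg⟩

theorem sub_C_mem_maximalIdeal {σ : Type*} (f : MvPowerSeries σ K) :
    f - algebraMap K _ (MvPowerSeries.constantCoeff f) ∈ maximalIdeal (MvPowerSeries σ K) := by
  rw [mem_maximalIdeal_mvPowerSeries]; simp [MvPowerSeries.algebraMap_apply]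

/-- Every morphism of algebras between power series rings is a substitution. -/
theorem algHom_eq_subst {κ σ : Type*} [Finite κ] [Finite σ]
    (θ : MvPowerSeries κ K →ₐ[K] MvPowerSeries σ K) (f : MvPowerSeries κ K) :
    θ f = MvPowerSeries.subst (fun k => θ (MvPowerSeries.X k)) f := by
  cases nonempty_fintype κ
  have hX : ∀ k, θ (MvPowerSeries.X k) ∈ maximalIdeal (MvPowerSeries σ K) := fun k =>
    algHom_mem_maximalIdeal θ (mem_maximalIdeal_mvPowerSeries.2 (MvPowerSeries.constantCoeff_X k))
  have hs := hasSubst_of_mem_maximalIdeal hX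
  rw [← MvPowerSeries.substAlgHom_apply hs]
  rw [← sub_eq_zero]
  -- Both sides agree modulo every power of the maximal ideal: peeling off one variable, on which
  -- they agree, gains one power.
  refine IsHausdorff.haus (I := maximalIdeal (MvPowerSeries σ K)) inferInstance _ fun n => ?_
  rw [SModEq.zero, smul_eq_mul, Ideal.mul_top]
  induction n generalizing f with
  | zero => simp
  | succ n ih =>
    obtain ⟨g, hg⟩ := exists_eq_sum_X_mul_of_mem (sub_C_mem_maximalIdeal f)
    rw [sub_eq_iff_eq_add] at hg
    rw [hg]
    simp only [map_add, map_sum, map_mul, AlgHom.commutes, MvPowerSeries.substAlgHom_X]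
    rw [add_sub_add_right_eq_sub, ← Finset.sum_sub_distrib]
    refine Ideal.sum_mem _ fun j _ => ?_
    rw [← mul_sub, pow_succ']
    exact Ideal.mul_mem_mul (hX j) (ih _)

theorem sub_linear_mem_pow_two {σ : Type*} [Fintype σ] {f : MvPowerSeries σ K}
    (hf : MvPowerSeries.constantCoeff f = 0) :
    f - ∑ j, MvPowerSeries.coeff (Finsupp.single j 1) f • MvPowerSeries.X j ∈
      maximalIdeal (MvPowerSeries σ K) ^ 2 := by
  classical
  rw [mem_pow_maximalIdeal_iff]
  intro I hI
  rw [map_sub, map_sum]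
  rcases eq_or_ne I 0 with rfl | h0
  · simp [hf]
  have h0' : I.degree ≠ 0 := by rwa [Ne, Finsupp.degree_eq_zero_iff]
  obtain ⟨j, hj⟩ := Finsupp.ne_iff.1 h0
  obtain rfl : I = Finsupp.single j 1 := by
    have hle : Finsupp.single j 1 ≤ I := by
      rwa [Finsupp.single_le_iff, Nat.one_le_iff_ne_zero]
    have h1 : (I - Finsupp.single j 1).degree + 1 = I.degree := by
      conv_rhs => rw [← tsub_add_cancel_of_le hle, map_add, Finsupp.degree_single]
    have h2 : I - Finsupp.single j 1 = 0 := by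
      rw [← Finsupp.degree_eq_zero_iff]; omega
    rw [← tsub_add_cancel_of_le hle, h2, zero_add]
  rw [Finset.sum_eq_single j]
  · simp
  · intro k _ hk
    rw [MvPowerSeries.coeff_smul, MvPowerSeries.coeff_X, if_neg, mul_zero]
    intro h
    exact hk (Finsupp.single_left_injective one_ne_zero h).symm
  · simp

theorem exists_mem_pow_of_surjective {κ σ : Type*} [Finite σ]
    (θ : MvPowerSeries κ K →ₐ[K] MvPowerSeries σ K) (hθ : Function.Surjective θ) (n : ℕ)
    {f : MvPowerSeries σ K} (hf : f ∈ maximalIdeal (MvPowerSeries σ K) ^ n) :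
    ∃ g ∈ maximalIdeal (MvPowerSeries κ K) ^ n, θ g = f := by
  have h1 : maximalIdeal (MvPowerSeries σ K) ≤
      Ideal.map (θ : MvPowerSeries κ K →+* MvPowerSeries σ K) (maximalIdeal _) := by
    intro a ha
    obtain ⟨b, rfl⟩ := hθ a
    refine Ideal.mem_map_of_mem (θ : MvPowerSeries κ K →+* MvPowerSeries σ K) ?_
    by_contra hb
    rw [mem_maximalIdeal, mem_nonunits_iff, not_not] at hb
    exact (mem_maximalIdeal _).1 ha (hb.map θ)
  have h2 := Ideal.pow_right_mono h1 n hf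
  rw [← Ideal.map_pow] at h2
  exact (Ideal.mem_map_iff_of_surjective (θ : MvPowerSeries κ K →+* MvPowerSeries σ K) hθ).1 h2

variable {L : Type*} [Field L] [Algebra K L] {abv : AbsoluteValue L ℝ}

theorem constantCoeff_map_eq {σ : Type*} (f : MvPowerSeries σ K) :
    MvPowerSeries.constantCoeff (MvPowerSeries.map (algebraMap K L) f) =
      algebraMap K L (MvPowerSeries.constantCoeff f) := by
  rw [← MvPowerSeries.coeff_zero_eq_constantCoeff_apply, MvPowerSeries.coeff_map,
    MvPowerSeries.coeff_zero_eq_constantCoeff_apply]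

/-- A formal germ in affine space whose ideal is generated by convergent power series has a formal
parametrization by convergent power series. -/
theorem exists_convergent_parametrization (hna : IsNonarchimedean abv) {κ σ : Type*} [Finite κ]
    [Finite σ] (θ : MvPowerSeries κ K →ₐ[K] MvPowerSeries σ K) (hθ : Function.Surjective θ)
    (E : Set (MvPowerSeries κ L)) (hE : ∀ f ∈ E, HasGeometricGrowth abv f)
    (hspan : Ideal.map (MvPowerSeries.map (algebraMap K L)) (RingHom.ker θ) = Ideal.span E) :
    ∃ ψ : MvPowerSeries σ K ≃ₐ[K] MvPowerSeries σ K, ∀ k,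
      HasGeometricGrowth abv (MvPowerSeries.map (algebraMap K L) (ψ (θ (MvPowerSeries.X k)))) := by
  classical
  cases nonempty_fintype κ
  cases nonempty_fintype σ
  -- Some linear forms in the ambient coordinates restrict to parameters of the germ; `ψ` makes
  -- these restrictions equal to the variables.
  have hb : ∀ j : σ, ∃ b : κ → K, (∑ l, b l • θ (MvPowerSeries.X l)) - MvPowerSeries.X j ∈
      maximalIdeal (MvPowerSeries σ K) ^ 2 := by
    intro j
    obtain ⟨f, hf, hfj⟩ := exists_mem_pow_of_surjective θ hθ 1 (f := MvPowerSeries.X j) (by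
      rw [pow_one]; exact mem_maximalIdeal_mvPowerSeries.2 (MvPowerSeries.constantCoeff_X j))
    rw [pow_one, mem_maximalIdeal_mvPowerSeries] at hf
    refine ⟨fun l => MvPowerSeries.coeff (Finsupp.single l 1) f, ?_⟩
    have := algHom_mem_pow_maximalIdeal θ (sub_linear_mem_pow_two hf)
    rw [map_sub, hfj, map_sum, ← neg_mem_iff, neg_sub] at this
    simpa only [map_smul] using this
  choose b hb using hb
  obtain ⟨ψ, hψ⟩ := exists_algEquiv_of_sub_X_mem _ hb
  refine ⟨ψ, ?_⟩
  let θ' : MvPowerSeries κ K →ₐ[K] MvPowerSeries σ K := ψ.toAlgHom.comp θ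
  have hθ' : Function.Surjective θ' := ψ.surjective.comp hθ
  set ζ : κ → MvPowerSeries σ K := fun k => θ' (MvPowerSeries.X k) with hζ
  have hζb : ∀ j, ∑ l, b j l • ζ l = MvPowerSeries.X j := fun j => by
    rw [← hψ j, map_sum]
    exact Finset.sum_congr rfl fun l _ => (map_smul ψ _ _).symm
  have hζ0 : ∀ k, MvPowerSeries.constantCoeff (ζ k) = 0 := fun k =>
    mem_maximalIdeal_mvPowerSeries.1 (algHom_mem_maximalIdeal θ'
      (mem_maximalIdeal_mvPowerSeries.2 (MvPowerSeries.constantCoeff_X k)))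
  have hs : MvPowerSeries.HasSubst ζ := MvPowerSeries.hasSubst_of_constantCoeff_zero hζ0
  set ζL : κ → MvPowerSeries σ L := fun k => MvPowerSeries.map (algebraMap K L) (ζ k) with hζL
  have hζL0 : ∀ k, MvPowerSeries.constantCoeff (ζL k) = 0 := fun k => by
    rw [hζL, constantCoeff_map_eq, hζ0, map_zero]
  have hsL : MvPowerSeries.HasSubst ζL := MvPowerSeries.hasSubst_of_constantCoeff_zero hζL0
  have hker : RingHom.ker θ = RingHom.ker θ' := by
    ext f
    rw [RingHom.mem_ker, RingHom.mem_ker]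
    exact (map_eq_zero_iff ψ ψ.injective).symm
  -- The ideal over `L` is generated by the kernel over `K`, so its elements vanish on the base
  -- change of the parametrization.
  have hE0 : ∀ f ∈ Ideal.span E, MvPowerSeries.constantCoeff f = 0 ∧
      MvPowerSeries.subst ζL f = 0 := by
    have h1 : Ideal.span E ≤ RingHom.ker (MvPowerSeries.constantCoeff (σ := κ) (R := L)) ⊓
        RingHom.ker (MvPowerSeries.substAlgHom (R := L) hsL) := by
      rw [← hspan, hker, Ideal.map_le_iff_le_comap]
      intro g hg
      rw [RingHom.mem_ker] at hg
      rw [Ideal.mem_comap, Ideal.mem_inf, RingHom.mem_ker, RingHom.mem_ker]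
      constructor
      · rw [constantCoeff_map_eq]
        have : g ∈ maximalIdeal (MvPowerSeries κ K) := by
          by_contra h
          rw [mem_maximalIdeal, mem_nonunits_iff, not_not] at h
          have := h.map θ'
          rw [hg] at this
          exact not_isUnit_zero this
        rw [mem_maximalIdeal_mvPowerSeries.1 this, map_zero]
      · rw [MvPowerSeries.substAlgHom_apply, ← MvPowerSeries.map_subst hs,
          ← algHom_eq_subst θ' g, hg, map_zero]
    intro f hf
    have h2 := h1 hf
    rw [Ideal.mem_inf, RingHom.mem_ker, RingHom.mem_ker, MvPowerSeries.substAlgHom_apply] at h2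
    exact h2
  -- The multipliers in a combination of the generators may diverge. Replacing them by their
  -- constant terms keeps the element in the ideal, makes it convergent, and changes it only by
  -- elements of the square of the maximal ideal.
  have hΨ : ∀ f ∈ Ideal.span E, ∃ Ψ ∈ Ideal.span E, Ψ ∈ geometricSeries hna κ ∧
      Ψ - f ∈ maximalIdeal (MvPowerSeries κ L) ^ 2 := by
    intro f hf
    induction hf using Submodule.span_induction with
    | mem f hf => exact ⟨f, Ideal.subset_span hf, hE f hf, by simp⟩
    | zero => exact ⟨0, zero_mem _, zero_mem _, by simp⟩
    | add x y _ _ hx hy =>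
      obtain ⟨u, hu1, hu2, hu3⟩ := hx
      obtain ⟨v, hv1, hv2, hv3⟩ := hy
      refine ⟨u + v, add_mem hu1 hv1, add_mem hu2 hv2, ?_⟩
      rw [add_sub_add_comm]
      exact Ideal.add_mem _ hu3 hv3
    | smul a x hx ih =>
      obtain ⟨u, hu1, hu2, hu3⟩ := ih
      refine ⟨MvPowerSeries.C (MvPowerSeries.constantCoeff a) * u, Ideal.mul_mem_left _ _ hu1,
        Subring.mul_mem _ (C_mem_geometricSeries hna _) hu2, ?_⟩
      have : MvPowerSeries.C (MvPowerSeries.constantCoeff a) * u - a • x =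
          MvPowerSeries.C (MvPowerSeries.constantCoeff a) * (u - x) -
          (a - MvPowerSeries.C (MvPowerSeries.constantCoeff a)) * x := by
        rw [smul_eq_mul]; ring
      rw [this]
      refine Ideal.sub_mem _ (Ideal.mul_mem_left _ _ hu3) ?_
      rw [pow_two]
      exact Ideal.mul_mem_mul (sub_C_mem_maximalIdeal a)
        (mem_maximalIdeal_mvPowerSeries.2 (hE0 x hx).1)
  let c : κ → κ → K := fun k l =>
    ∑ j, MvPowerSeries.coeff (Finsupp.single j 1) (ζ k) * b j l
  have hc : ∀ k, ∑ l, c k l • ζ l =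
      ∑ j, MvPowerSeries.coeff (Finsupp.single j 1) (ζ k) • MvPowerSeries.X j := by
    intro k
    simp only [c, Finset.sum_smul, mul_smul]
    rw [Finset.sum_comm]
    refine Finset.sum_congr rfl fun j _ => ?_
    rw [← Finset.smul_sum, hζb]
  -- The linear part of `ζ k` is `∑ l, c k l • ζ l`, and the remainder of order two lifts along
  -- `θ'`. This gives an element of the ideal with linear part `X k - ∑ l, c k l • X l`, hence a
  -- convergent one.
  have hrel : ∀ k, ∃ Ψ ∈ Ideal.span E, Ψ ∈ geometricSeries hna κ ∧
      Ψ - (MvPowerSeries.X k - ∑ l, algebraMap K L (c k l) • MvPowerSeries.X l) ∈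
        maximalIdeal (MvPowerSeries κ L) ^ 2 := by
    intro k
    have h1 := sub_linear_mem_pow_two (hζ0 k)
    rw [← hc k] at h1
    obtain ⟨g, hg, hgk⟩ := exists_mem_pow_of_surjective θ' hθ' 2 h1
    have h2 : MvPowerSeries.X k - ∑ l, c k l • MvPowerSeries.X l - g ∈ RingHom.ker θ := by
      rw [hker, RingHom.mem_ker, map_sub, map_sub, hgk, map_sum]
      simp only [map_smul]
      exact sub_self _
    have h3 := Ideal.mem_map_of_mem (MvPowerSeries.map (σ := κ) (algebraMap K L)) h2
    rw [hspan] at h3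
    obtain ⟨Ψ, h4, h5, h6⟩ := hΨ _ h3
    refine ⟨Ψ, h4, h5, ?_⟩
    have h7 : MvPowerSeries.map (algebraMap K L) g ∈ maximalIdeal (MvPowerSeries κ L) ^ 2 := by
      rw [mem_pow_maximalIdeal_iff] at hg ⊢
      intro I hI
      rw [MvPowerSeries.coeff_map, hg I hI, map_zero]
    have h8 := Ideal.sub_mem _ h6 h7
    rw [map_sub, map_sub, map_sum] at h8
    have h9 : ∀ l, MvPowerSeries.map (algebraMap K L) (c k l • MvPowerSeries.X l) =
        algebraMap K L (c k l) • (MvPowerSeries.X l : MvPowerSeries κ L) := fun l => by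
      rw [MvPowerSeries.smul_eq_C_mul, map_mul, MvPowerSeries.map_C, MvPowerSeries.map_X,
        MvPowerSeries.smul_eq_C_mul]
    simp only [h9, MvPowerSeries.map_X] at h8
    convert h8 using 1
    ring
  choose Ψ hΨE hΨg hΨ2 using hrel
  have hlin : ∀ k, (MvPowerSeries.X k - ∑ l, algebraMap K L (c k l) • MvPowerSeries.X l :
      MvPowerSeries κ L) ∈ geometricSeries hna κ := fun k =>
    sub_mem (X_mem_geometricSeries hna k) (sum_mem fun l _ => by
      rw [MvPowerSeries.smul_eq_C_mul]
      exact Subring.mul_mem _ (C_mem_geometricSeries hna _) (X_mem_geometricSeries hna l))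
  have hsubst : ∀ k, MvPowerSeries.subst ζL
      (MvPowerSeries.X k - ∑ l, algebraMap K L (c k l) • MvPowerSeries.X l - Ψ k :
        MvPowerSeries κ L) = ζL k - ∑ l, algebraMap K L (c k l) • ζL l := fun k => by
    rw [← MvPowerSeries.substAlgHom_apply hsL, map_sub, map_sub, map_sum,
      MvPowerSeries.substAlgHom_X, MvPowerSeries.substAlgHom_apply hsL (Ψ k),
      (hE0 _ (hΨE k)).2, sub_zero]
    simp only [map_smul, MvPowerSeries.substAlgHom_X]
  intro k
  -- Since `Ψ k` vanishes along the germ, `ζL` solves an implicit system: its linear part is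
  -- polynomial in the parameters, and the linear form of `hrel` minus `Ψ k` is convergent of order
  -- two.
  refine implicit_growth hna ζL (fun k => ∑ l, algebraMap K L (c k l) • ζL l)
    (fun k => MvPowerSeries.X k - ∑ l, algebraMap K L (c k l) • MvPowerSeries.X l - Ψ k)
    hζL0 ?_ (fun k => sub_mem (hlin k) (hΨg k)) ?_ ?_ k
  · intro k
    have h1 : ∑ l, algebraMap K L (c k l) • ζL l = MvPowerSeries.map (algebraMap K L)
        (∑ l, c k l • ζ l) := by
      rw [map_sum]
      refine Finset.sum_congr rfl fun l _ => ?_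
      rw [MvPowerSeries.smul_eq_C_mul, MvPowerSeries.smul_eq_C_mul, map_mul, MvPowerSeries.map_C]
    change HasGeometricGrowth abv (∑ l, algebraMap K L (c k l) • ζL l)
    rw [h1, hc k, map_sum]
    refine sum_mem (S := geometricSeries hna σ) fun j _ => ?_
    rw [MvPowerSeries.smul_eq_C_mul, map_mul, MvPowerSeries.map_C, MvPowerSeries.map_X]
    exact Subring.mul_mem _ (C_mem_geometricSeries hna _) (X_mem_geometricSeries hna j)
  · intro k
    rw [← mem_pow_maximalIdeal_iff, ← neg_mem_iff, neg_sub]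
    exact hΨ2 k
  · intro k
    rw [hsubst, add_sub_cancel]

/-- If a system of parameters has convergent expansions along a formal germ, so have all algebraic
functions. -/
theorem geometricGrowth_of_generators {abv : AbsoluteValue K ℝ} (hna : IsNonarchimedean abv)
    {O σ κ ι : Type*} [CommRing O] [IsLocalRing O] [Algebra K O] [Fintype κ] [Finite ι]
    [Finite σ] (r : O →ₐ[K] MvPowerSeries σ K) (z : κ → O)
    (hz : ∀ k, HasGeometricGrowth abv (r (z k)))
    (hm : ∀ f ∈ maximalIdeal O, ∃ b : κ → K, f - ∑ k, b k • z k ∈ maximalIdeal O ^ 2)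
    (u : ι → O) (hu : ∀ k, u k ∈ maximalIdeal O)
    (hgen : ∀ f : O, ∃ p q : MvPolynomial ι K, MvPolynomial.constantCoeff q ≠ 0 ∧
      MvPolynomial.aeval u q * f = MvPolynomial.aeval u p) (f : O) :
    HasGeometricGrowth abv (r f) := by
  classical
  set τ : ι → MvPowerSeries σ K := fun k => r (u k) with hτ
  have hτm : ∀ k, τ k ∈ maximalIdeal (MvPowerSeries σ K) := fun k =>
    algHom_mem_maximalIdeal r (hu k)
  have hs := hasSubst_of_mem_maximalIdeal hτm
  have hτa : ∀ p : MvPolynomial ι K, r (MvPolynomial.aeval u p) = MvPolynomial.aeval τ p :=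
    fun p => MvPolynomial.comp_aeval_apply u r p
  have hval : ∀ p : MvPolynomial ι K,
      MvPolynomial.aeval u p - algebraMap K O (MvPolynomial.constantCoeff p) ∈ maximalIdeal O := by
    intro p
    induction p using MvPolynomial.induction_on with
    | C a => simp
    | add p q hp hq =>
      have := Ideal.add_mem _ hp hq
      rw [map_add, map_add, map_add]
      convert this using 1; ring
    | mul_X p i hp =>
      simp only [map_mul, MvPolynomial.aeval_X, MvPolynomial.constantCoeff_X, mul_zero, map_zero,
        sub_zero]
      exact Ideal.mul_mem_left _ _ (hu i)
  have hdeg1 : ∀ f ∈ maximalIdeal O, ∃ p q : MvPolynomial ι K,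
      MvPolynomial.constantCoeff q ≠ 0 ∧ MvPolynomial.constantCoeff p = 0 ∧
      MvPolynomial.aeval u q * f = MvPolynomial.aeval u p := by
    intro f hf
    obtain ⟨p, q, hq, hpq⟩ := hgen f
    refine ⟨p, q, hq, ?_, hpq⟩
    by_contra h0
    have h1 := hval p
    rw [← hpq] at h1
    have h2 := Ideal.sub_mem _ (Ideal.mul_mem_left _ (MvPolynomial.aeval u q) hf) h1
    rw [sub_sub_cancel] at h2
    exact (mem_maximalIdeal _).1 h2 ((isUnit_iff_ne_zero.2 h0).map _)
  -- Elements of the square of the maximal ideal are fractions in the generators whose numerator has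
  -- order at least two as a polynomial.
  have hdeg2 : ∀ f ∈ maximalIdeal O ^ 2, ∃ p q : MvPolynomial ι K,
      MvPolynomial.constantCoeff q ≠ 0 ∧
      (p : MvPowerSeries ι K) ∈ maximalIdeal (MvPowerSeries ι K) ^ 2 ∧
      MvPolynomial.aeval u q * f = MvPolynomial.aeval u p := by
    have hcoe : ∀ p : MvPolynomial ι K, MvPolynomial.constantCoeff p = 0 →
        (p : MvPowerSeries ι K) ∈ maximalIdeal (MvPowerSeries ι K) := by
      intro p hp
      rw [mem_maximalIdeal_mvPowerSeries, ← MvPowerSeries.coeff_zero_eq_constantCoeff_apply,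
        MvPolynomial.coeff_coe]
      exact hp
    intro f hf
    rw [pow_two] at hf
    induction hf using Submodule.mul_induction_on' with
    | mem_mul_mem b hb c hc =>
      obtain ⟨p₁, q₁, h1, h2, h3⟩ := hdeg1 b hb
      obtain ⟨p₂, q₂, h4, h5, h6⟩ := hdeg1 c hc
      refine ⟨p₁ * p₂, q₁ * q₂, ?_, ?_, ?_⟩
      · rw [map_mul]; exact mul_ne_zero h1 h4
      · rw [MvPolynomial.coe_mul, pow_two]
        exact Ideal.mul_mem_mul (hcoe _ h2) (hcoe _ h5)
      · rw [map_mul, map_mul, ← h3, ← h6]; ring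
    | add x hx y hy hx' hy' =>
      obtain ⟨p₁, q₁, h1, h2, h3⟩ := hx'
      obtain ⟨p₂, q₂, h4, h5, h6⟩ := hy'
      refine ⟨q₂ * p₁ + q₁ * p₂, q₁ * q₂, ?_, ?_, ?_⟩
      · rw [map_mul]; exact mul_ne_zero h1 h4
      · rw [MvPolynomial.coe_add, MvPolynomial.coe_mul, MvPolynomial.coe_mul]
        exact Ideal.add_mem _ (Ideal.mul_mem_left _ _ h2) (Ideal.mul_mem_left _ _ h5)
      · simp only [map_mul, map_add]
        rw [← h3, ← h6]; ring
  -- Each generator is a linear form in the `z l`, convergent by hypothesis, plus the expansion of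
  -- `p / q` in the generators: again a system for `implicit_growth`.
  have hrel : ∀ k, ∃ (b : κ → K) (g : MvPowerSeries ι K), g ∈ geometricSeries hna ι ∧
      g ∈ maximalIdeal (MvPowerSeries ι K) ^ 2 ∧
      r (u k) = ∑ l, b l • r (z l) + MvPowerSeries.subst τ g := by
    intro k
    obtain ⟨b, hb⟩ := hm (u k) (hu k)
    obtain ⟨p, q, hq, hp, hpq⟩ := hdeg2 _ hb
    have hq0 : MvPowerSeries.constantCoeff (q : MvPowerSeries ι K) ≠ 0 := by
      rw [← MvPowerSeries.coeff_zero_eq_constantCoeff_apply, MvPolynomial.coeff_coe]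
      exact hq
    have hqg : (q : MvPowerSeries ι K) * ((q : MvPowerSeries ι K)⁻¹ * (p : MvPowerSeries ι K)) = p := by
      rw [← mul_assoc, MvPowerSeries.mul_inv_cancel _ hq0, one_mul]
    refine ⟨b, (q : MvPowerSeries ι K)⁻¹ * (p : MvPowerSeries ι K), ?_, Ideal.mul_mem_left _ _ hp, ?_⟩
    · refine mem_geometricSeries_of_mul hna (coe_mem_geometricSeries hna q) hq0 ?_
      rw [hqg]
      exact coe_mem_geometricSeries hna p
    · have h1 : r (u k) - ∑ l, b l • r (z l) =
          MvPowerSeries.subst τ ((q : MvPowerSeries ι K)⁻¹ * (p : MvPowerSeries ι K)) := by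
        have h2 : IsUnit (MvPolynomial.aeval τ q) := by
          rw [← hτa]
          refine IsUnit.map r ?_
          by_contra h
          have := Ideal.sub_mem _ ((mem_maximalIdeal _).2 h) (hval q)
          rw [sub_sub_cancel] at this
          exact (mem_maximalIdeal _).1 this ((isUnit_iff_ne_zero.2 hq).map _)
        refine h2.mul_left_cancel ?_
        have h3 := congrArg r hpq
        rw [map_mul, hτa, hτa, map_sub, map_sum] at h3
        simp only [map_smul] at h3
        rw [h3]
        conv_lhs => rw [← MvPowerSeries.subst_coe (R := K), ← hqg, MvPowerSeries.subst_mul hs,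
          MvPowerSeries.subst_coe]
      rw [← h1, add_sub_cancel]
  choose b g hg hg2 hgr using hrel
  have hτg : ∀ k, HasGeometricGrowth abv (τ k) := by
    intro k
    refine implicit_growth hna τ (fun k => ∑ l, b k l • r (z l)) g
      (fun k => mem_maximalIdeal_mvPowerSeries.1 (hτm k)) (fun k => ?_) hg
      (fun k => mem_pow_maximalIdeal_iff.1 (hg2 k)) hgr k
    refine sum_mem (S := geometricSeries hna σ) fun l _ => ?_
    rw [MvPowerSeries.smul_eq_C_mul]
    exact Subring.mul_mem _ (C_mem_geometricSeries hna _) (hz l)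
  obtain ⟨p, q, hq, hpq⟩ := hgen f
  have h1 := congrArg r hpq
  rw [map_mul, hτa, hτa] at h1
  refine mem_geometricSeries_of_mul hna (aeval_mem_geometricSeries hna hτg q) ?_
    (h1 ▸ aeval_mem_geometricSeries hna hτg p)
  have h2 := algHom_mem_maximalIdeal r (hval q)
  rw [mem_maximalIdeal_mvPowerSeries, map_sub, hτa, map_sub, AlgHom.commutes, sub_eq_zero] at h2
  rw [MvPowerSeries.coeff_zero_eq_constantCoeff_apply, h2]
  simpa [MvPowerSeries.algebraMap_apply] using hq

end Reparametrization

/-! ### Absolute values at the finite places -/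

section Places

variable {K : Type u} [Field K] [NumberField K]

theorem abv_algebraMap_le_one (v : HeightOneSpectrum (𝓞 K)) (x : 𝓞 K) :
    HeightOneSpectrum.adicAbv K v (algebraMap (𝓞 K) K x) ≤ 1 :=
  v.adicAbv_coe_le_one (HeightOneSpectrum.one_lt_absNorm_nnreal v) x

theorem abv_algebraMap_eq_one_iff (v : HeightOneSpectrum (𝓞 K)) (x : 𝓞 K) :
    HeightOneSpectrum.adicAbv K v (algebraMap (𝓞 K) K x) = 1 ↔ x ∉ v.asIdeal :=
  v.adicAbv_coe_eq_one_iff (HeightOneSpectrum.one_lt_absNorm_nnreal v) x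

theorem abv_le_one_iff_valuation_le_one (v : HeightOneSpectrum (𝓞 K)) (x : K) :
    HeightOneSpectrum.adicAbv K v x ≤ 1 ↔ v.valuation K x ≤ 1 := by
  rw [HeightOneSpectrum.adicAbv_def]
  have := WithZeroMulInt.toNNReal_strictMono (HeightOneSpectrum.one_lt_absNorm_nnreal v)
  rw [← this.le_iff_le, map_one]
  norm_cast

theorem eventually_abv_eq_one {x : K} (hx : x ≠ 0) :
    ∀ᶠ v : HeightOneSpectrum (𝓞 K) in Filter.cofinite, HeightOneSpectrum.adicAbv K v x = 1 := by
  rw [Filter.eventually_cofinite]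
  have h := (FinitePlace.hasFiniteMulSupport hx).image (FinitePlace.equivHeightOneSpectrum (K := K))
  refine h.subset fun v hv => ⟨FinitePlace.mk v, ?_, FinitePlace.maximalIdeal_mk v⟩
  rw [Function.mem_mulSupport, FinitePlace.mk_apply, FinitePlace.norm_embedding]
  exact hv

theorem eventually_abv_le_one (x : K) :
    ∀ᶠ v : HeightOneSpectrum (𝓞 K) in Filter.cofinite, HeightOneSpectrum.adicAbv K v x ≤ 1 := by
  rcases eq_or_ne x 0 with rfl | hx
  · simp
  · exact (eventually_abv_eq_one hx).mono fun v hv => hv.le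

theorem eventually_notMem_asIdeal {b : 𝓞 K} (hb : b ≠ 0) :
    ∀ᶠ v : HeightOneSpectrum (𝓞 K) in Filter.cofinite, b ∉ v.asIdeal := by
  have : algebraMap (𝓞 K) K b ≠ 0 := by simpa using hb
  exact (eventually_abv_eq_one this).mono fun v hv => (abv_algebraMap_eq_one_iff v b).1 hv

theorem eventually_coeff_abv_le_one {ι : Type*} (p : MvPolynomial ι K) :
    ∀ᶠ v : HeightOneSpectrum (𝓞 K) in Filter.cofinite,
      ∀ m, HeightOneSpectrum.adicAbv K v (p.coeff m) ≤ 1 := by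
  have := (Filter.eventually_all_finset (l := Filter.cofinite) p.support
    (p := fun m v => HeightOneSpectrum.adicAbv K v (p.coeff m) ≤ 1)).2
    fun m _ => eventually_abv_le_one _
  filter_upwards [this] with v hv m
  by_cases hm : m ∈ p.support
  · exact hv m hm
  · rw [MvPolynomial.notMem_support_iff.1 hm]; simp

/-- Non-zero values are integral powers of the absolute norm of `v`, which is at least 2. This turns
a bound tending to 1 into integrality. -/
theorem abv_le_one_of_lt_two (v : HeightOneSpectrum (𝓞 K)) {x : K}
    (hx : HeightOneSpectrum.adicAbv K v x < 2) : HeightOneSpectrum.adicAbv K v x ≤ 1 := by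
  rcases eq_or_ne x 0 with rfl | h0
  · simp
  rw [HeightOneSpectrum.adicAbv_def,
    WithZeroMulInt.toNNReal_neg_apply _ ((v.valuation K).ne_zero_iff.mpr h0)] at hx ⊢
  have h2 : (2 : ℝ) ≤ (Ideal.absNorm v.asIdeal : ℝ) := by
    exact_mod_cast HeightOneSpectrum.one_lt_absNorm v
  push_cast at hx ⊢
  refine zpow_le_one_of_nonpos₀ (by linarith) ?_
  by_contra! hn
  have := (h2.trans (by simpa using zpow_le_zpow_right₀ (by linarith : (1 : ℝ) ≤ Ideal.absNorm v.asIdeal) (Int.add_one_le_of_lt hn))).trans_lt hx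
  exact lt_irrefl _ this

theorem hasFiniteSupport_log_abv {n : ℕ} (hn : n ≠ 0) :
    (Function.support fun v : HeightOneSpectrum (𝓞 K) =>
      Real.log (HeightOneSpectrum.adicAbv K v (n : K))).Finite := by
  have h := eventually_abv_eq_one (K := K) (x := n) (by exact_mod_cast hn)
  rw [Filter.eventually_cofinite] at h
  refine h.subset fun v hv h1 => hv ?_
  change Real.log _ = 0
  rw [h1, Real.log_one]

/-- The product formula for a rational integer, whose norm is `n ^ [K : ℚ]`. Applied to `i !`, it
produces the main term `α i log i`. -/
theorem finsum_log_abv_natCast {n : ℕ} (hn : n ≠ 0) :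
    ∑ᶠ v : HeightOneSpectrum (𝓞 K), Real.log (HeightOneSpectrum.adicAbv K v (n : K)) =
      -(Module.finrank ℚ K * Real.log n) := by
  have hn' : (n : K) ≠ 0 := by exact_mod_cast hn
  have h1 := FinitePlace.prod_eq_inv_abs_norm hn'
  have h2 : ∏ᶠ v : HeightOneSpectrum (𝓞 K), HeightOneSpectrum.adicAbv K v (n : K) =
      ∏ᶠ w : FinitePlace K, w (n : K) := by
    rw [← finprod_comp_equiv (FinitePlace.equivHeightOneSpectrum (K := K)).symm]
    refine finprod_congr fun v => ?_
    rw [FinitePlace.equivHeightOneSpectrum_symm_apply, FinitePlace.norm_embedding]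
  have h3 := eventually_abv_eq_one hn'
  rw [Filter.eventually_cofinite] at h3
  have h4 : (Function.mulSupport fun v : HeightOneSpectrum (𝓞 K) =>
      HeightOneSpectrum.adicAbv K v (n : K)) ⊆ h3.toFinset := by
    intro v hv; simpa using hv
  rw [h1, finprod_eq_prod_of_mulSupport_subset _ h4] at h2
  rw [finsum_eq_sum_of_support_subset (s := h3.toFinset), ← Real.log_prod, h2]
  · have : Algebra.norm ℚ (n : K) = (n : ℚ) ^ Module.finrank ℚ K := by
      have := Algebra.norm_algebraMap (S := K) (n : ℚ)
      simpa using this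
    rw [this]
    push_cast
    rw [Real.log_inv, abs_of_nonneg (by positivity), Real.log_pow]
  · intro v _
    exact (AbsoluteValue.ne_zero_iff _).2 hn'
  · intro v hv
    by_contra h
    apply hv
    have : HeightOneSpectrum.adicAbv K v (n : K) = 1 := by simpa using h
    change Real.log _ = 0
    rw [this, Real.log_one]

theorem IsConvergent.hasGeometricGrowth {v : HeightOneSpectrum (𝓞 K)} {n : ℕ}
    {f : MvPowerSeries (Fin n) (v.adicCompletion K)} (hf : IsConvergent f) :
    HasGeometricGrowth (NormedField.toAbsoluteValue (v.adicCompletion K)) f := by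
  obtain ⟨r, hr, c, hc⟩ := hf
  have hM : 1 ≤ max (max 1 c) r⁻¹ := le_max_of_le_left (le_max_left _ _)
  refine ⟨_, hM, fun I => ?_⟩
  have h1 := hc I
  rw [← le_div_iff₀ (by positivity)] at h1
  refine (show _ ≤ _ from h1).trans ?_
  rw [div_eq_mul_inv, ← inv_pow, pow_succ']
  exact mul_le_mul ((le_max_right _ _).trans (le_max_left _ _))
    (pow_le_pow_left₀ (by positivity) (le_max_right _ _) _) (by positivity) (by positivity)

theorem isNonarchimedean_adicCompletion (v : HeightOneSpectrum (𝓞 K)) :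
    IsNonarchimedean (NormedField.toAbsoluteValue (v.adicCompletion K)) := by
  intro x y
  change ‖x + y‖ ≤ max ‖x‖ ‖y‖
  rw [FinitePlace.norm_def, FinitePlace.norm_def, FinitePlace.norm_def]
  have hm := (WithZeroMulInt.toNNReal_strictMono
    (HeightOneSpectrum.one_lt_absNorm_nnreal v)).monotone
  have := hm (Valued.v.map_add x y)
  rw [hm.map_max] at this
  exact_mod_cast this

theorem norm_algebraMap_adicCompletion (v : HeightOneSpectrum (𝓞 K)) (x : K) :
    ‖algebraMap K (v.adicCompletion K) x‖ = HeightOneSpectrum.adicAbv K v x :=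
  FinitePlace.norm_embedding v x

theorem hasGeometricGrowth_map_iff {σ : Type*} (v : HeightOneSpectrum (𝓞 K))
    (f : MvPowerSeries σ K) :
    HasGeometricGrowth (NormedField.toAbsoluteValue (v.adicCompletion K))
      (MvPowerSeries.map (algebraMap K (v.adicCompletion K)) f) ↔
      HasGeometricGrowth (HeightOneSpectrum.adicAbv K v) f := by
  have : ∀ I : σ →₀ ℕ, NormedField.toAbsoluteValue (v.adicCompletion K)
      (MvPowerSeries.coeff I (MvPowerSeries.map (algebraMap K (v.adicCompletion K)) f)) =
      HeightOneSpectrum.adicAbv K v (MvPowerSeries.coeff I f) := fun I => by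
    rw [MvPowerSeries.coeff_map, ← norm_algebraMap_adicCompletion]; rfl
  simp only [HasGeometricGrowth, this]

end Places

/-! ### Spreading out bounds to almost all places -/

section Generic

variable {K : Type u} [Field K] [NumberField K]

/-- Outside finitely many places, a given algebraic function satisfies along a formal germ the
bounds that a system of parameters satisfies. -/
theorem eventually_mem_boundedSeries {O σ κ ι : Type*} [CommRing O] [IsLocalRing O]
    [Algebra K O] [Fintype κ] [Fintype ι] (r : O →ₐ[K] MvPowerSeries σ K) (z : κ → O)
    (hz : maximalIdeal O = Ideal.span (Set.range z)) (g : ι → O)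
    (hgen : ∀ f : O, ∃ p q : MvPolynomial ι K, IsUnit (MvPolynomial.aeval g q) ∧
      MvPolynomial.aeval g q * f = MvPolynomial.aeval g p)
    (hres : ∀ f : O, f - algebraMap K O (MvPowerSeries.constantCoeff (r f)) ∈ maximalIdeal O)
    (f : O) :
    ∀ᶠ v : HeightOneSpectrum (𝓞 K) in Filter.cofinite, ∀ w : Weight σ,
      (∀ n k, r (z k) ∈ boundedSeries (HeightOneSpectrum.isNonarchimedean_adicAbv K v) w n) →
      ∀ n, r f ∈ boundedSeries (HeightOneSpectrum.isNonarchimedean_adicAbv K v) w n := by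
  classical
  have hra : ∀ p : MvPolynomial ι K, r (MvPolynomial.aeval g p) =
      MvPolynomial.aeval (fun l => r (g l)) p := fun p => MvPolynomial.comp_aeval_apply g r p
  have hunit : ∀ q : MvPolynomial ι K, IsUnit (MvPolynomial.aeval g q) →
      MvPowerSeries.coeff 0 (MvPolynomial.aeval (fun l => r (g l)) q) ≠ 0 := by
    intro q hq
    rw [← hra]
    exact ((MvPowerSeries.isUnit_iff_constantCoeff).1 (hq.map r)).ne_zero
  have h1 : ∀ l, ∃ e : κ → O, g l - algebraMap K O (MvPowerSeries.constantCoeff (r (g l))) =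
      ∑ k, z k * e k := by
    intro l
    have := hres (g l)
    rw [hz, Ideal.mem_span_range_iff_exists_fun] at this
    obtain ⟨c, hc⟩ := this
    exact ⟨c, by rw [← hc]; exact Finset.sum_congr rfl fun _ _ => mul_comm _ _⟩
  choose e he using h1
  choose p q hq hpq using fun (x : ι × κ) => hgen (e x.1 x.2)
  -- A common denominator for all the multipliers `e l k`, so that the relations become polynomial.
  set h : MvPolynomial ι K := ∏ x, q x with hh
  set p' : ι → κ → MvPolynomial ι K := fun l k => p (l, k) * ∏ x ∈ Finset.univ.erase (l, k), q x
  have hp' : ∀ l k, MvPolynomial.aeval g h * e l k = MvPolynomial.aeval g (p' l k) := by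
    intro l k
    rw [hh, ← Finset.mul_prod_erase _ _ (Finset.mem_univ (l, k)), map_mul, map_mul,
      ← hpq (l, k)]
    ring
  have hhu : IsUnit (MvPolynomial.aeval g h) := by
    rw [hh, map_prod]
    exact IsUnit.prod_univ_iff.2 hq
  have hrel : ∀ l, MvPolynomial.aeval (fun l => r (g l)) h *
      (r (g l) - MvPowerSeries.C (MvPowerSeries.coeff 0 (r (g l)))) =
        ∑ k, r (z k) * MvPolynomial.aeval (fun l => r (g l)) (p' l k) := by
    intro l
    have h2 : MvPolynomial.aeval g h *
        (g l - algebraMap K O (MvPowerSeries.constantCoeff (r (g l)))) =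
        ∑ k, z k * MvPolynomial.aeval g (p' l k) := by
      rw [he l, Finset.mul_sum]
      exact Finset.sum_congr rfl fun k _ => by rw [← hp' l k]; ring
    have h3 := congrArg r h2
    rw [map_mul, map_sub, AlgHom.commutes, map_sum, hra] at h3
    simp only [map_mul, hra] at h3
    exact h3
  obtain ⟨P, Q, hQ, hPQ⟩ := hgen f
  have hfrel : MvPolynomial.aeval (fun l => r (g l)) Q * r f =
      MvPolynomial.aeval (fun l => r (g l)) P := by
    rw [← hra, ← hra, ← map_mul, hPQ]
  -- Finitely many polynomials and values are involved, all fixed before the weight: the excluded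
  -- places depend neither on `w`, which may vary with `v`, nor on the degree.
  have E1 := eventually_abv_eq_one (hunit h hhu)
  have E2 := eventually_coeff_abv_le_one h
  have E3 : ∀ᶠ v : HeightOneSpectrum (𝓞 K) in Filter.cofinite, ∀ l k m,
      HeightOneSpectrum.adicAbv K v ((p' l k).coeff m) ≤ 1 := by
    rw [Filter.eventually_all]; intro l
    rw [Filter.eventually_all]; intro k
    exact eventually_coeff_abv_le_one _
  have E4 : ∀ᶠ v : HeightOneSpectrum (𝓞 K) in Filter.cofinite, ∀ l,
      HeightOneSpectrum.adicAbv K v (MvPowerSeries.coeff 0 (r (g l))) ≤ 1 := by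
    rw [Filter.eventually_all]; intro l
    exact eventually_abv_le_one _
  have E5 := eventually_abv_eq_one (hunit Q hQ)
  have E6 := eventually_coeff_abv_le_one Q
  have E7 := eventually_coeff_abv_le_one P
  filter_upwards [E1, E2, E3, E4, E5, E6, E7] with v e1 e2 e3 e4 e5 e6 e7 w hw n
  have hG := mem_boundedSeries_of_relations (hna := HeightOneSpectrum.isNonarchimedean_adicAbv K v)
    (w := w) (fun l => r (g l)) (fun k => r (z k)) hw (fun k => ?_) e4 h p' e2 e3 e1 hrel n
  · refine mem_boundedSeries_of_mul (aeval_mem_boundedSeries hG Q e6) e5 ?_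
    rw [hfrel]
    exact aeval_mem_boundedSeries hG P e7
  · refine mem_maximalIdeal_mvPowerSeries.1 (algHom_mem_maximalIdeal r ?_)
    rw [hz]
    exact Ideal.subset_span ⟨k, rfl⟩

end Generic

/-! ### Germs of functions as fractions -/

section Schemes

/-- The ring homomorphism from the base ring to a local ring of a scheme over it. -/
def stalkConstants {Y : Scheme.{u}} {R : Type u} [CommRing R] (f : Y ⟶ Spec (.of R)) (y : Y) :
    R →+* Y.presheaf.stalk y :=
  ((Scheme.ΓSpecIso (.of R)).inv ≫ f.appTop ≫ Y.presheaf.germ ⊤ y trivial).hom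

theorem exists_eq_div_germ {Y : Scheme.{u}} {W : Y.Opens} (hW : IsAffineOpen W) (y : Y)
    (hy : y ∈ W) (x : Y.presheaf.stalk y) :
    ∃ s h : Γ(Y, W), IsUnit (Y.presheaf.germ W y hy h) ∧
      Y.presheaf.germ W y hy h * x = Y.presheaf.germ W y hy s := by
  have h1 := hW.isLocalization_stalk ⟨y, hy⟩
  let _ : Algebra Γ(Y, W) (Y.presheaf.stalk y) := (Y.presheaf.germ W y hy).hom.toAlgebra
  obtain ⟨⟨s, h⟩, hx⟩ := IsLocalization.surj (M := (hW.primeIdealOf ⟨y, hy⟩).asIdeal.primeCompl)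
    (S := Y.presheaf.stalk y) x
  refine ⟨s, h, IsLocalization.map_units (Y.presheaf.stalk y) h, ?_⟩
  rw [mul_comm]
  exact hx

/-- Algebra generators of the functions on one affine neighbourhood serve simultaneously for the
local rings at all its points, with coefficients in the base ring; this is the source of uniformity
in the place. -/
theorem exists_generators_stalk {Y : Scheme.{u}} {R : Type u} [CommRing R] (f : Y ⟶ Spec (.of R))
    [LocallyOfFiniteType f] (y₀ : Y) :
    ∃ W : Y.Opens, y₀ ∈ W ∧ ∃ (m : ℕ) (t : Fin m → Γ(Y, W)),
      ∀ (y : Y) (hy : y ∈ W) (x : Y.presheaf.stalk y), ∃ p q : MvPolynomial (Fin m) R,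
        IsUnit (q.eval₂ (stalkConstants f y) fun k => Y.presheaf.germ W y hy (t k)) ∧
        q.eval₂ (stalkConstants f y) (fun k => Y.presheaf.germ W y hy (t k)) * x =
          p.eval₂ (stalkConstants f y) fun k => Y.presheaf.germ W y hy (t k) := by
  obtain ⟨W, hW, hyW, -⟩ := exists_isAffineOpen_mem_and_subset (TopologicalSpace.Opens.mem_top y₀)
  have h1 : (f.appLE ⊤ W le_top).hom.FiniteType :=
    Scheme.Hom.finiteType_appLE f (isAffineOpen_top _) hW le_top
  have h2 : (((Scheme.ΓSpecIso (.of R)).inv ≫ f.appLE ⊤ W le_top).hom).FiniteType := by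
    rw [CommRingCat.hom_comp]
    refine h1.comp (RingHom.FiniteType.of_surjective _ ?_)
    exact (ConcreteCategory.bijective_of_isIso (Scheme.ΓSpecIso (.of R)).inv).2
  let _ := (((Scheme.ΓSpecIso (.of R)).inv ≫ f.appLE ⊤ W le_top).hom).toAlgebra
  obtain ⟨m, r, hr⟩ := Algebra.FiniteType.iff_quotient_mvPolynomial''.1 h2
  have h3 : ∀ s : Γ(Y, W), ∃ p : MvPolynomial (Fin m) R, ∀ (y : Y) (hy : y ∈ W),
      Y.presheaf.germ W y hy s = p.eval₂ (stalkConstants f y)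
        fun k => Y.presheaf.germ W y hy (r (.X k)) := by
    intro s
    obtain ⟨p, rfl⟩ := hr s
    refine ⟨p, fun y hy => ?_⟩
    have h4 : (stalkConstants f y) = (Y.presheaf.germ W y hy).hom.comp
        ((Scheme.ΓSpecIso (.of R)).inv ≫ f.appLE ⊤ W le_top).hom := by
      rw [stalkConstants, ← CommRingCat.hom_comp]
      congr 1
      simp only [Scheme.Hom.appLE, Category.assoc]
      congr 2
      exact (TopCat.Presheaf.germ_res Y.presheaf (homOfLE le_top) y hy).symm
    have h5 : ((Y.presheaf.germ W y hy).hom.comp r.toRingHom) =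
        MvPolynomial.eval₂Hom (stalkConstants f y)
          fun k => Y.presheaf.germ W y hy (r (.X k)) := by
      refine MvPolynomial.ringHom_ext ?_ ?_
      · intro c
        rw [h4]
        simp only [MvPolynomial.coe_eval₂Hom, MvPolynomial.eval₂_C, RingHom.comp_apply]
        congr 1
        exact r.commutes c
      · intro k
        simp
    exact congr($h5 p)
  refine ⟨W, hyW, m, fun k => r (.X k), fun y hy x => ?_⟩
  obtain ⟨s, h, hh, hx⟩ := exists_eq_div_germ hW y hy x
  obtain ⟨p, hp⟩ := h3 s
  obtain ⟨q, hq⟩ := h3 h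
  rw [hq y hy] at hh hx
  exact ⟨p, q, hh, hx.trans (hp y hy)⟩

theorem isUnit_stalkConstants_Spec_iff {R : Type u} [CommRing R] (p : Spec (.of R)) (b : R) :
    IsUnit (stalkConstants (𝟙 (Spec (.of R))) p b) ↔ b ∉ p.asIdeal := by
  have h1 : stalkConstants (𝟙 (Spec (.of R))) p b =
      (Spec (.of R)).presheaf.germ ⊤ p trivial ((Scheme.ΓSpecIso (.of R)).inv b) := by
    simp [stalkConstants]
  rw [h1]
  refine (Scheme.mem_basicOpen (U := ⊤) (Spec (.of R)) _ p trivial).symm.trans ?_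
  rw [basicOpen_eq_of_affine]
  exact PrimeSpectrum.mem_basicOpen b p

/-- A germ of functions on `Spec R` is a fraction. -/
theorem exists_eq_div_Spec {R : Type u} [CommRing R] (p : Spec (.of R))
    (x : (Spec (.of R)).presheaf.stalk p) : ∃ a b : R, b ∉ p.asIdeal ∧
      stalkConstants (𝟙 (Spec (.of R))) p b * x = stalkConstants (𝟙 (Spec (.of R))) p a := by
  obtain ⟨s, h, hh, hx⟩ := exists_eq_div_germ (isAffineOpen_top (Spec (.of R))) p trivial x
  have h1 : ∀ s : Γ(Spec (.of R), ⊤), (Spec (.of R)).presheaf.germ ⊤ p trivial s =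
      stalkConstants (𝟙 (Spec (.of R))) p ((Scheme.ΓSpecIso (.of R)).hom s) := by
    intro s
    simp [stalkConstants]
  rw [h1] at hh hx
  rw [h1] at hx
  exact ⟨_, _, (isUnit_stalkConstants_Spec_iff p _).1 hh, hx⟩

variable {R : Type u} [CommRing R] {K : Type u} [Field K] [Algebra R K]

variable (R K) in
/-- The point of `Spec R` given by a field `K` containing `R`. -/
def fieldPt : Spec (.of R) := Spec.map (CommRingCat.ofHom (algebraMap R K)) (closedPoint K)

theorem fieldPt_specializes [FaithfulSMul R K] (p : Spec (.of R)) : fieldPt R K ⤳ p := by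
  refine (PrimeSpectrum.le_iff_specializes (fieldPt R K) p).1 ?_
  intro a ha
  have h1 : algebraMap R K a ∈ maximalIdeal K := ha
  rw [IsLocalRing.maximalIdeal_eq_bot, Ideal.mem_bot] at h1
  rw [(FaithfulSMul.algebraMap_injective R K) (h1.trans (map_zero _).symm)]
  exact zero_mem _

variable (R K) in
/-- The value in `K` of a germ of functions on `Spec R`, for `R ⊆ K`. -/
def specValue : (Spec (.of R)).presheaf.stalk (fieldPt R K) →+* K :=
  (Scheme.stalkClosedPointTo (Spec.map (CommRingCat.ofHom (algebraMap R K)))).hom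

theorem specValue_stalkConstants (b : R) :
    specValue R K (stalkConstants (𝟙 _) (fieldPt R K) b) = algebraMap R K b := by
  have h := Scheme.germ_stalkClosedPointTo_Spec (CommRingCat.ofHom (algebraMap R K))
  have h1 := congr($h ((Scheme.ΓSpecIso (.of R)).inv b))
  have h2 : (Scheme.ΓSpecIso (.of R)).hom ((Scheme.ΓSpecIso (.of R)).inv b) = b :=
    congr($((Scheme.ΓSpecIso (.of R)).inv_hom_id) b)
  have h3 : stalkConstants (𝟙 (Spec (.of R))) (fieldPt R K) b =
      (Spec (.of R)).presheaf.germ ⊤ (fieldPt R K) trivial ((Scheme.ΓSpecIso (.of R)).inv b) := by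
    simp [stalkConstants]
  rw [h3]
  exact h1.trans (congrArg (algebraMap R K) h2)

theorem specializes_stalkConstants {Y : Scheme.{u}} (f : Y ⟶ Spec (.of R)) {x y : Y} (h : x ⤳ y)
    (b : R) : Y.presheaf.stalkSpecializes h (stalkConstants f y b) = stalkConstants f x b := by
  have := TopCat.Presheaf.germ_stalkSpecializes Y.presheaf (U := ⊤) (y := y) trivial h
  exact congr($this (f.appTop ((Scheme.ΓSpecIso (.of R)).inv b)))

theorem exists_specValue_mul_eq [FaithfulSMul R K] (p : Spec (.of R))
    (x : (Spec (.of R)).presheaf.stalk p) : ∃ a b : R, b ∉ p.asIdeal ∧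
      stalkConstants (𝟙 (Spec (.of R))) p b * x = stalkConstants (𝟙 (Spec (.of R))) p a ∧
      algebraMap R K b * specValue R K ((Spec (.of R)).presheaf.stalkSpecializes
        (fieldPt_specializes p) x) = algebraMap R K a := by
  obtain ⟨a, b, hb, h⟩ := exists_eq_div_Spec p x
  refine ⟨a, b, hb, h, ?_⟩
  have h1 := congrArg (fun x => specValue R K ((Spec (.of R)).presheaf.stalkSpecializes
        (fieldPt_specializes p) x)) h
  simpa only [map_mul, specializes_stalkConstants, specValue_stalkConstants] using h1

/-- At each point the germ is a fraction of elements of `R` with invertible denominator; the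
vanishing of its value in `K` kills the numerator. -/
theorem eq_zero_of_specValue_eq_zero [FaithfulSMul R K] (W : (Spec (.of R)).Opens)
    (hW : fieldPt R K ∈ W) (s : Γ(Spec (.of R), W))
    (hs : specValue R K ((Spec (.of R)).presheaf.germ W _ hW s) = 0) : s = 0 := by
  refine TopCat.Presheaf.section_ext (Spec (.of R)).sheaf W s 0 fun p hp => ?_
  obtain ⟨a, b, hb, h1, h2⟩ := exists_specValue_mul_eq (K := K) p
    ((Spec (.of R)).presheaf.germ W p hp s)
  have h3 := congr($(TopCat.Presheaf.germ_stalkSpecializes (Spec (.of R)).presheaf hp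
    (fieldPt_specializes (K := K) p)) s)
  have h4 : algebraMap R K a = 0 := by
    rw [← h2]
    erw [h3]
    rw [hs, mul_zero]
  rw [FaithfulSMul.algebraMap_injective R K (h4.trans (map_zero _).symm), map_zero] at h1
  have h5 := ((isUnit_stalkConstants_Spec_iff p b).2 hb).mul_right_eq_zero.1 h1
  exact h5.trans (map_zero _).symm

end Schemes

/-! ### Values at the rational point and along the section of a model -/

section Value

variable {K : Type u} [Field K] {X : Scheme.{u}} {π : X ⟶ Spec (.of K)} {P : Spec (.of K) ⟶ X}

/-- The value at a rational point of a germ of functions. -/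
def value (P : Spec (.of K) ⟶ X) : LocalRing P →+* K := (Scheme.stalkClosedPointTo P).hom

theorem germ_stalkClosedPointTo_congr {Y : Scheme.{u}} {f g : Spec (.of K) ⟶ Y} (h : f = g)
    (U : Y.Opens) (hf : f (closedPoint K) ∈ U) (hg : g (closedPoint K) ∈ U) :
    Y.presheaf.germ U _ hf ≫ Scheme.stalkClosedPointTo f =
      Y.presheaf.germ U _ hg ≫ Scheme.stalkClosedPointTo g := by
  subst h; rfl

theorem value_germ_app {Y : Scheme.{u}} {R : Type u} [CommRing R] [Algebra R K] (j : X ⟶ Y) (σ : Spec (.of R) ⟶ Y)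
    (h : Spec.map (CommRingCat.ofHom (algebraMap R K)) ≫ σ = P ≫ j) (U : Y.Opens)
    (hU : j (pt P) ∈ U) (hU' : σ (fieldPt R K) ∈ U) (s : Γ(Y, U)) :
    value P (j.stalkMap (pt P) (Y.presheaf.germ U _ hU s)) =
      specValue R K ((Spec (.of R)).presheaf.germ (σ ⁻¹ᵁ U) _ hU' (σ.app U s)) := by
  have h1 := germ_stalkClosedPointTo_congr h U hU' hU
  rw [Scheme.stalkClosedPointTo_comp, Scheme.stalkClosedPointTo_comp] at h1
  have h2 := σ.germ_stalkMap U (fieldPt R K) hU'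
  have h3 := congr($h2 s)
  have h4 := congr($h1 s)
  exact h4.symm.trans (congrArg (specValue R K) h3)

theorem value_constants (hP : P ≫ π = 𝟙 _) (c : K) : value P (constants π P c) = c := by
  have h1 : Spec.map (CommRingCat.ofHom (algebraMap K K)) ≫ 𝟙 _ = P ≫ π := by
    rw [hP, Category.comp_id]
    exact Spec.map_id _
  have h2 := value_germ_app π (𝟙 (Spec (.of K))) h1 ⊤ trivial trivial
    ((Scheme.ΓSpecIso (.of K)).inv c)
  have h3 := congr($(π.germ_stalkMap ⊤ (pt P) trivial) ((Scheme.ΓSpecIso (.of K)).inv c))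
  exact (congrArg (value P) h3.symm).trans (h2.trans (specValue_stalkConstants (R := K) c))

theorem ker_value : RingHom.ker (value P) = maximalIdeal (LocalRing P) := by
  have : IsLocalHom (value P) := Scheme.isLocalHom_stalkClosedPointTo' P
  ext x
  rw [RingHom.mem_ker, mem_maximalIdeal, mem_nonunits_iff, ← isUnit_map_iff (value P),
    isUnit_iff_ne_zero, not_not]

end Value

section Model

variable {K : Type u} [Field K] {X : Scheme.{u}} {π : X ⟶ Spec (.of K)} {P : Spec (.of K) ⟶ X}
  {B : Type u} [CommRing B] [Algebra B K] (M : PointedModel B π P)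

theorem PointedModel.pt_eq : M.pt = M.sec (fieldPt B K) :=
  congr($(M.sec_gen) (closedPoint K)).symm

theorem PointedModel.fieldPt_mem {U : M.space.Opens} (hU : M.pt ∈ U) :
    M.sec (fieldPt B K) ∈ U := M.pt_eq ▸ hU

theorem PointedModel.value_stalkMap_germ (U : M.space.Opens) (hU : M.pt ∈ U) (s : Γ(M.space, U)) :
    value P (M.gen.stalkMap (LGGerm.pt P) (M.space.presheaf.germ U M.pt hU s)) =
      specValue B K ((Spec (.of B)).presheaf.germ (M.sec ⁻¹ᵁ U) _ (M.fieldPt_mem hU)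
        (M.sec.app U s)) :=
  value_germ_app M.gen M.sec M.sec_gen U hU (M.fieldPt_mem hU) s

theorem PointedModel.stalkMap_stalkConstants (b : B) :
    M.gen.stalkMap (LGGerm.pt P) (LGGerm.stalkConstants M.str M.pt b) =
      LGGerm.constants π P (algebraMap B K b) := by
  have h2 : M.space.presheaf.germ ⊤ M.pt trivial ≫ M.gen.stalkMap (LGGerm.pt P) =
      M.gen.appTop ≫ X.presheaf.germ ⊤ (LGGerm.pt P) trivial :=
    Scheme.Hom.germ_stalkMap M.gen ⊤ (LGGerm.pt P) trivial
  have h3 : M.str.appTop ≫ M.gen.appTop =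
      (Spec.map (CommRingCat.ofHom (algebraMap B K))).appTop ≫ π.appTop := by
    rw [← Scheme.Hom.comp_appTop, ← Scheme.Hom.comp_appTop, M.isPullback.w]
  have h4 : (Scheme.ΓSpecIso (.of B)).inv ≫ M.str.appTop ≫
      M.space.presheaf.germ ⊤ M.pt trivial ≫ M.gen.stalkMap (LGGerm.pt P) =
      CommRingCat.ofHom (algebraMap B K) ≫ (Scheme.ΓSpecIso (.of K)).inv ≫ π.appTop ≫
        X.presheaf.germ ⊤ (LGGerm.pt P) trivial := by
    rw [h2, reassoc_of% h3, Scheme.ΓSpecIso_inv_naturality_assoc]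
  exact congr($h4 b)

/-- The generic fibre is the base change of a localization, hence a preimmersion. So every germ at
`P` comes from the model. -/
theorem PointedModel.stalkMap_surjective [IsDomain B] [IsFractionRing B K] :
    Function.Surjective (M.gen.stalkMap (LGGerm.pt P)) := by
  have h1 : IsPreimmersion (Spec.map (CommRingCat.ofHom (algebraMap B K))) :=
    IsPreimmersion.of_isLocalization (nonZeroDivisors B)
  have h2 : IsPreimmersion M.gen := MorphismProperty.of_isPullback M.isPullback.flip h1
  exact Scheme.Hom.stalkMap_surjective M.gen _

variable [FaithfulSMul B K]

theorem PointedModel.pt_specializes (q : Spec (.of B)) : M.pt ⤳ M.sec q := by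
  rw [M.pt_eq]
  exact (fieldPt_specializes q).map M.sec.continuous

/-- The restriction to the generic fibre of functions on the model defined near a point of
the section. -/
def PointedModel.localize (q : Spec (.of B)) :
    M.space.presheaf.stalk (M.sec q) →+* LocalRing P :=
  (M.space.presheaf.stalkSpecializes (M.pt_specializes q) ≫ M.gen.stalkMap (LGGerm.pt P)).hom

theorem PointedModel.localize_germ (q : Spec (.of B)) (U : M.space.Opens) (hU : M.pt ∈ U)
    (hq : M.sec q ∈ U) (s : Γ(M.space, U)) :
    M.localize q (M.space.presheaf.germ U (M.sec q) hq s) =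
      M.gen.stalkMap (LGGerm.pt P) (M.space.presheaf.germ U M.pt hU s) := by
  have := TopCat.Presheaf.germ_stalkSpecializes M.space.presheaf hq (M.pt_specializes q)
  exact congrArg (M.gen.stalkMap (LGGerm.pt P)) congr($this s)

theorem PointedModel.localize_stalkConstants (q : Spec (.of B)) (b : B) :
    M.localize q (LGGerm.stalkConstants M.str (M.sec q) b) =
      LGGerm.constants π P (algebraMap B K b) :=
  (congrArg (M.gen.stalkMap (LGGerm.pt P))
    (specializes_stalkConstants M.str (M.pt_specializes q) b)).trans (M.stalkMap_stalkConstants b)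

theorem PointedModel.mem_of_sec_mem {q : Spec (.of B)} {U : M.space.Opens} (hq : M.sec q ∈ U) :
    M.pt ∈ U := (M.pt_specializes q).mem_open U.2 hq

theorem PointedModel.exists_value_mul_eq (q : Spec (.of B))
    (x : M.space.presheaf.stalk (M.sec q)) : ∃ a b : B, b ∉ q.asIdeal ∧
      algebraMap B K b * value P (M.localize q x) = algebraMap B K a := by
  obtain ⟨U, hq, s, rfl⟩ := TopCat.Presheaf.exists_germ_eq M.space.presheaf x
  obtain ⟨a, b, hb, -, h⟩ := exists_specValue_mul_eq (K := K) q
    ((Spec (.of B)).presheaf.germ (M.sec ⁻¹ᵁ U) q hq (M.sec.app U s))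
  refine ⟨a, b, hb, ?_⟩
  rw [M.localize_germ q U (M.mem_of_sec_mem hq), M.value_stalkMap_germ, ← h]
  have := TopCat.Presheaf.germ_stalkSpecializes (Spec (.of B)).presheaf
    (show q ∈ M.sec ⁻¹ᵁ U from hq) (fieldPt_specializes (K := K) q)
  exact congrArg (fun x => algebraMap B K b * specValue B K x) congr($this (M.sec.app U s)).symm

/-- Functions on an open subset of `Spec B` containing the generic point are determined by their
value in `K`, so vanishing along the section can be tested at `P`. -/
theorem PointedModel.app_sec_eq_zero_iff (U : M.space.Opens) (hU : M.pt ∈ U) (s : Γ(M.space, U)) :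
    M.sec.app U s = 0 ↔
      value P (M.gen.stalkMap (LGGerm.pt P) (M.space.presheaf.germ U M.pt hU s)) = 0 := by
  rw [M.value_stalkMap_germ]
  refine ⟨fun h => ?_, fun h => eq_zero_of_specValue_eq_zero _ (M.fieldPt_mem hU) _ h⟩
  rw [h, map_zero, map_zero]

/-- The denominators are kept as images of units at the point of the section: this is what makes
their values at `P` have absolute value 1 at the corresponding place. -/
theorem PointedModel.exists_generators_localize (q₀ : Spec (.of B)) :
    ∃ W : M.space.Opens, M.sec q₀ ∈ W ∧ ∃ (m : ℕ) (t : Fin m → LocalRing P),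
      (∀ q, M.sec q ∈ W → ∀ k, ∃ x, M.localize q x = t k) ∧
      ∀ q, M.sec q ∈ W → ∀ x : M.space.presheaf.stalk (M.sec q),
        ∃ p r : MvPolynomial (Fin m) B,
        (∃ y, IsUnit y ∧ M.localize q y =
          r.eval₂ ((LGGerm.constants π P).comp (algebraMap B K)) t) ∧
        r.eval₂ ((LGGerm.constants π P).comp (algebraMap B K)) t * M.localize q x =
          p.eval₂ ((LGGerm.constants π P).comp (algebraMap B K)) t := by
  have := M.locallyOfFiniteType
  obtain ⟨W, hW, m, t, ht⟩ := exists_generators_stalk M.str (M.sec q₀)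
  refine ⟨W, hW, m, fun k => M.gen.stalkMap (LGGerm.pt P)
    (M.space.presheaf.germ W M.pt (M.mem_of_sec_mem hW) (t k)), fun q hq k =>
    ⟨_, M.localize_germ q W (M.mem_of_sec_mem hW) hq (t k)⟩, fun q hq x => ?_⟩
  obtain ⟨p, r, hr, h⟩ := ht (M.sec q) hq x
  have h1 : ∀ p : MvPolynomial (Fin m) B, M.localize q (p.eval₂ (stalkConstants M.str (M.sec q))
      fun k => M.space.presheaf.germ W (M.sec q) hq (t k)) =
      p.eval₂ ((LGGerm.constants π P).comp (algebraMap B K)) fun k => M.gen.stalkMap (LGGerm.pt P)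
        (M.space.presheaf.germ W M.pt (M.mem_of_sec_mem hW) (t k)) := by
    intro p
    rw [MvPolynomial.hom_eval₂]
    congr 1
    · ext b
      exact M.localize_stalkConstants q b
    · ext k
      exact M.localize_germ q W (M.mem_of_sec_mem hW) hq (t k)
  refine ⟨p, r, ⟨_, hr, h1 r⟩, ?_⟩
  rw [← h1, ← h1, ← map_mul, h]

end Model

/-! ### Models over the ring of integers -/

section NumberField

variable {K : Type u} [Field K] [NumberField K] {X : Scheme.{u}} {π : X ⟶ Spec (.of K)}
  {P : Spec (.of K) ⟶ X} (M : PointedModel (𝓞 K) π P)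

theorem eventually_placePt_mem {U : (Spec (.of (𝓞 K))).Opens} (hU : fieldPt (𝓞 K) K ∈ U) :
    ∀ᶠ v : HeightOneSpectrum (𝓞 K) in Filter.cofinite, placePt v ∈ U := by
  obtain ⟨_, ⟨_, ⟨b, rfl⟩, rfl⟩, hb, hbU⟩ :=
    PrimeSpectrum.isBasis_basic_opens.exists_subset_of_mem_open hU U.2
  have hb0 : b ≠ 0 := by
    rintro rfl
    exact hb (zero_mem (fieldPt (𝓞 K) K).asIdeal)
  exact (eventually_notMem_asIdeal hb0).mono fun v hv => hbU hv

theorem PointedModel.eventually_sec_mem {U : M.space.Opens} (hU : M.pt ∈ U) :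
    ∀ᶠ v : HeightOneSpectrum (𝓞 K) in Filter.cofinite, M.sec (placePt v) ∈ U :=
  eventually_placePt_mem (U := M.sec ⁻¹ᵁ U) (M.fieldPt_mem hU)

theorem PointedModel.abv_value_localize_le_one (v : HeightOneSpectrum (𝓞 K))
    (x : M.space.presheaf.stalk (M.sec (placePt v))) :
    HeightOneSpectrum.adicAbv K v (value P (M.localize (placePt v) x)) ≤ 1 := by
  obtain ⟨a, b, hb, h⟩ := M.exists_value_mul_eq (placePt v) x
  have h1 := congrArg (HeightOneSpectrum.adicAbv K v) h
  rw [map_mul, (abv_algebraMap_eq_one_iff v b).2 hb, one_mul] at h1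
  rw [h1]
  exact abv_algebraMap_le_one v a

theorem PointedModel.abv_value_localize_eq_one (v : HeightOneSpectrum (𝓞 K))
    {x : M.space.presheaf.stalk (M.sec (placePt v))} (hx : IsUnit x) :
    HeightOneSpectrum.adicAbv K v (value P (M.localize (placePt v) x)) = 1 := by
  obtain ⟨y, hy⟩ := hx.exists_right_inv
  refine le_antisymm (M.abv_value_localize_le_one v x) ?_
  have h1 := congrArg (fun x => HeightOneSpectrum.adicAbv K v (value P (M.localize (placePt v) x))) hy
  simp only [map_mul, map_one] at h1
  rw [← h1]
  exact mul_le_of_le_one_right (apply_nonneg _ _) (M.abv_value_localize_le_one v y)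

end NumberField

/-! ### Étale coordinates generate the maximal ideal -/

section Unramified

theorem map_maximalIdeal_stalkMap {Y Z : Scheme.{u}} (f : Y ⟶ Z) [FormallyUnramified f]
    [LocallyOfFiniteType f] (y : Y) :
    Ideal.map (f.stalkMap y).hom (maximalIdeal (Z.presheaf.stalk (f y))) =
      maximalIdeal (Y.presheaf.stalk y) := by
  algebraize [(f.stalkMap y).hom]
  have : IsLocalHom (algebraMap (Z.presheaf.stalk (f y)) (Y.presheaf.stalk y)) :=
    inferInstanceAs <| IsLocalHom (f.stalkMap y).hom
  have : Algebra.EssFiniteType (Z.presheaf.stalk (f y)) (Y.presheaf.stalk y) := by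
    rw [← RingHom.essFiniteType_algebraMap, RingHom.algebraMap_toAlgebra]
    exact LocallyOfFiniteType.stalkMap f y
  have : Algebra.FormallyUnramified (Z.presheaf.stalk (f y)) (Y.presheaf.stalk y) := by
    rw [← RingHom.formallyUnramified_algebraMap, RingHom.algebraMap_toAlgebra]
    exact FormallyUnramified.stalkMap f y
  exact Algebra.FormallyUnramified.map_maximalIdeal

theorem exists_eval_coord {n R : Type u} [CommRing R] (s : Γ(𝔸(n; Spec (.of R)), ⊤)) :
    ∃ p : MvPolynomial n R, s = p.eval₂ ((Scheme.ΓSpecIso (.of R)).inv ≫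
      (𝔸(n; Spec (.of R)) ↘ Spec (.of R)).appTop).hom (AffineSpace.coord (Spec (.of R))) := by
  have h1 := AffineSpace.SpecIso_hom_appTop (n := n) (.of R)
  have : IsIso (AffineSpace.SpecIso n (.of R)).hom.appTop :=
    inferInstanceAs (IsIso ((AffineSpace.SpecIso n (.of R)).hom.app ⊤))
  obtain ⟨t, ht⟩ := (ConcreteCategory.bijective_of_isIso
    (AffineSpace.SpecIso n (.of R)).hom.appTop).2 s
  rw [h1] at ht
  exact ⟨_, ht.symm⟩

theorem stalkMap_stalkConstants {Y Z : Scheme.{u}} {R : Type u} [CommRing R] (g : Y ⟶ Z)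
    (f : Z ⟶ Spec (.of R)) (y : Y) (c : R) :
    g.stalkMap y (stalkConstants f (g y) c) = stalkConstants (g ≫ f) y c := by
  have h1 := congr($(g.germ_stalkMap ⊤ y trivial) (f.appTop ((Scheme.ΓSpecIso (.of R)).inv c)))
  refine h1.trans ?_
  have h2 := congr($(Scheme.Hom.comp_appTop g f) ((Scheme.ΓSpecIso (.of R)).inv c))
  exact congrArg (Y.presheaf.germ ⊤ y trivial) h2.symm

theorem sub_C_constantCoeff_mem {n R : Type*} [CommRing R] (p : MvPolynomial n R) :
    p - MvPolynomial.C (MvPolynomial.constantCoeff p) ∈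
      Ideal.span (Set.range (MvPolynomial.X : n → MvPolynomial n R)) := by
  induction p using MvPolynomial.induction_on with
  | C a => simp
  | add p q hp hq =>
    rw [map_add, map_add, add_sub_add_comm]
    exact add_mem hp hq
  | mul_X p i _ =>
    rw [map_mul, MvPolynomial.constantCoeff_X, mul_zero, map_zero, sub_zero]
    exact Ideal.mul_mem_left _ _ (Ideal.subset_span ⟨i, rfl⟩)

/-- Since the map is unramified, the maximal ideal is generated by that of the image point in affine
space. A polynomial vanishing there has its constant coefficient in the maximal ideal, so by `hR`
this coefficient is zero and the polynomial lies in the ideal of the coordinates. -/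
theorem maximalIdeal_stalk_eq_span {Y : Scheme.{u}} {n R : Type u} [CommRing R]
    (f : Y ⟶ Spec (.of R)) (v : n → Γ(Y, ⊤)) [Etale (AffineSpace.homOfVector f v)] (y : Y)
    (hv : ∀ k, Y.presheaf.germ ⊤ y trivial (v k) ∈ maximalIdeal (Y.presheaf.stalk y))
    (hR : ∀ c : R, stalkConstants f y c ∈ maximalIdeal (Y.presheaf.stalk y) → c = 0) :
    maximalIdeal (Y.presheaf.stalk y) =
      Ideal.span (Set.range fun k => Y.presheaf.germ ⊤ y trivial (v k)) := by
  set g := AffineSpace.homOfVector f v with hg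
  have hcoord : ∀ k, g.stalkMap y (𝔸(n; Spec (.of R)).presheaf.germ ⊤ (g y) trivial
      (AffineSpace.coord (Spec (.of R)) k)) = Y.presheaf.germ ⊤ y trivial (v k) := by
    intro k
    have h1 := congr($(g.germ_stalkMap ⊤ y trivial) (AffineSpace.coord (Spec (.of R)) k))
    refine h1.trans ?_
    exact congrArg (Y.presheaf.germ ⊤ y trivial) (AffineSpace.homOfVector_appTop_coord f v k)
  have hconst : ∀ c, g.stalkMap y (stalkConstants (𝔸(n; Spec (.of R)) ↘ Spec (.of R)) (g y) c) =
      stalkConstants f y c := by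
    intro c
    have h1 := stalkMap_stalkConstants g (𝔸(n; Spec (.of R)) ↘ Spec (.of R)) y c
    rwa [AffineSpace.homOfVector_over] at h1
  apply le_antisymm
  · rw [← map_maximalIdeal_stalkMap g y, Ideal.map_le_iff_le_comap]
    intro x hx
    obtain ⟨s, h, hh, hxs⟩ := exists_eq_div_germ (isAffineOpen_top 𝔸(n; Spec (.of R))) (g y)
      trivial x
    obtain ⟨p, hp⟩ := exists_eval_coord s
    rw [Ideal.mem_comap]
    have h1 : g.stalkMap y (𝔸(n; Spec (.of R)).presheaf.germ ⊤ (g y) trivial s) =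
        p.eval₂ (stalkConstants f y) (fun k => Y.presheaf.germ ⊤ y trivial (v k)) := by
      rw [hp]
      have := MvPolynomial.hom_eval₂ p ((Scheme.ΓSpecIso (.of R)).inv ≫
        (𝔸(n; Spec (.of R)) ↘ Spec (.of R)).appTop).hom
        (𝔸(n; Spec (.of R)).presheaf.germ ⊤ (g y) trivial ≫ g.stalkMap y).hom
        (AffineSpace.coord (Spec (.of R)))
      refine Eq.trans this ?_
      congr 1
      · ext c; exact hconst c
      · ext k; exact hcoord k
    have h2 := sub_C_constantCoeff_mem p
    have h3 : p.eval₂ (stalkConstants f y) (fun k => Y.presheaf.germ ⊤ y trivial (v k)) -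
        stalkConstants f y (MvPolynomial.constantCoeff p) ∈
        Ideal.span (Set.range fun k => Y.presheaf.germ ⊤ y trivial (v k)) := by
      have := Ideal.mem_map_of_mem (MvPolynomial.eval₂Hom (stalkConstants f y)
        (fun k => Y.presheaf.germ ⊤ y trivial (v k))) h2
      rw [Ideal.map_span, ← Set.range_comp] at this
      simpa [Function.comp_def] using this
    have h4 : Ideal.span (Set.range fun k => Y.presheaf.germ ⊤ y trivial (v k)) ≤
        maximalIdeal (Y.presheaf.stalk y) := by
      rw [Ideal.span_le]; rintro _ ⟨k, rfl⟩; exact hv k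
    have h5 : p.eval₂ (stalkConstants f y) (fun k => Y.presheaf.germ ⊤ y trivial (v k)) ∈
        maximalIdeal (Y.presheaf.stalk y) := by
      rw [← h1, ← hxs, map_mul]
      refine Ideal.mul_mem_left _ _ ?_
      rw [← map_maximalIdeal_stalkMap g y]
      exact Ideal.mem_map_of_mem _ hx
    have h6 : MvPolynomial.constantCoeff p = 0 := by
      refine hR _ ?_
      have := sub_mem h5 (h4 h3)
      rwa [sub_sub_cancel] at this
    rw [h6, map_zero, sub_zero, ← h1, ← hxs, map_mul] at h3
    exact (Ideal.unit_mul_mem_iff_mem _ (hh.map (g.stalkMap y).hom)).1 h3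
  · rw [Ideal.span_le]; rintro _ ⟨k, rfl⟩; exact hv k

variable {K : Type u} [Field K] {X : Scheme.{u}} {π : X ⟶ Spec (.of K)} {P : Spec (.of K) ⟶ X}
  {B : Type u} [CommRing B] [Algebra B K] [IsDomain B] [IsFractionRing B K]

/-- The point `P` lies over the generic point of `Spec B`, where non-zero constants are invertible;
the previous lemma applies there and the result descends along the surjective stalk map. -/
theorem PointedModel.maximalIdeal_eq_span (M : PointedModel B π P)
    (U : M.space.Opens) (hU : M.pt ∈ U) {n : Type u} [Finite n] (z : n → Γ(M.space, U))
    [Etale (AffineSpace.homOfVector (U.ι ≫ M.str) (fun k => U.topIso.inv (z k)))]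
    (hz : ∀ k, M.sec.app U (z k) = 0) :
    maximalIdeal (LocalRing P) = Ideal.span (Set.range fun k =>
      M.gen.stalkMap (LGGerm.pt P) (M.space.presheaf.germ U M.pt hU (z k))) := by
  cases nonempty_fintype n
  set y : U.toScheme := ⟨M.pt, hU⟩ with hy
  set j : M.space.presheaf.stalk M.pt →+* U.toScheme.presheaf.stalk y := (U.ι.stalkMap y).hom
    with hj
  have hjb : Function.Bijective j := ConcreteCategory.bijective_of_isIso (U.ι.stalkMap y)
  have hjl : IsLocalHom j := inferInstanceAs (IsLocalHom (U.ι.stalkMap y).hom)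
  have hgl : IsLocalHom (M.gen.stalkMap (LGGerm.pt P)).hom := inferInstance
  have hjz : ∀ k, j (M.space.presheaf.germ U M.pt hU (z k)) =
      U.toScheme.presheaf.germ ⊤ y trivial (U.topIso.inv (z k)) := by
    intro k
    have h1 := congr($(U.germ_stalkIso_inv ⊤ y trivial) (U.topIso.inv (z k)))
    have h2 := congr($(TopCat.Presheaf.germ_res M.space.presheaf
      (eqToHom U.ι_image_top) M.pt ⟨y, trivial, rfl⟩) (z k))
    rw [Scheme.Opens.stalkIso_inv] at h1
    exact (congrArg j h2.symm).trans h1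
  have hval : ∀ k, M.gen.stalkMap (LGGerm.pt P) (M.space.presheaf.germ U M.pt hU (z k)) ∈
      maximalIdeal (LocalRing P) := by
    intro k
    rw [← ker_value, RingHom.mem_ker]
    exact (M.app_sec_eq_zero_iff U hU (z k)).1 (hz k)
  have hv : ∀ k, M.space.presheaf.germ U M.pt hU (z k) ∈
      maximalIdeal (M.space.presheaf.stalk M.pt) := fun k h =>
    hval k (h.map (M.gen.stalkMap (LGGerm.pt P)).hom)
  apply le_antisymm
  · intro f hf
    obtain ⟨f, rfl⟩ := M.stalkMap_surjective f
    have h1 : j f ∈ maximalIdeal (U.toScheme.presheaf.stalk y) := fun h =>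
      hf ((hjl.map_nonunit f h).map (M.gen.stalkMap (LGGerm.pt P)).hom)
    rw [maximalIdeal_stalk_eq_span (U.ι ≫ M.str) (fun k => U.topIso.inv (z k)) y ?_ ?_] at h1
    · rw [Ideal.mem_span_range_iff_exists_fun] at h1 ⊢
      obtain ⟨c, hc⟩ := h1
      choose c' hc' using fun k => hjb.2 (c k)
      refine ⟨fun k => M.gen.stalkMap (LGGerm.pt P) (c' k), ?_⟩
      have h2 : ∑ k, c' k * M.space.presheaf.germ U M.pt hU (z k) = f := by
        apply hjb.1
        rw [map_sum, ← hc]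
        refine Finset.sum_congr rfl fun k _ => ?_
        rw [map_mul, hc', hjz]
      rw [← h2]
      exact ((map_sum (M.gen.stalkMap (LGGerm.pt P)).hom _ _).trans
        (Finset.sum_congr rfl fun k _ => map_mul _ _ _)).symm
    · intro k
      rw [← hjz]
      exact fun h => hv k (hjl.map_nonunit _ h)
    · intro c hc
      by_contra hc0
      have h2 : IsUnit (LGGerm.constants π P (algebraMap B K c)) :=
        (IsUnit.mk0 _ (by simpa using hc0)).map (LGGerm.constants π P)
      rw [← M.stalkMap_stalkConstants] at h2
      have h3 := (hgl.map_nonunit _ h2).map j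
      have h4 : j (stalkConstants M.str M.pt c) = stalkConstants (U.ι ≫ M.str) y c :=
        LGGerm.stalkMap_stalkConstants U.ι M.str y c
      exact hc (h4.subst (motive := fun x => IsUnit x) h3)
  · rw [Ideal.span_le]; rintro _ ⟨k, rfl⟩; exact hval k

end Unramified

/-! ### Restriction of algebraic functions to the germ -/

section Restrict

variable {K : Type u} [Field K] {X : Scheme.{u}} {π : X ⟶ Spec (.of K)} {P : Spec (.of K) ⟶ X}
  {d : ℕ} (V : FormalGerm π P d)

/-- Restriction to `V` of germs of functions on the generic fibre. -/
def FormalGerm.restrict : LocalRing P →+* V.A :=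
  V.res.comp (algebraMap (LocalRing P) (CompletedLocalRing P))

theorem FormalGerm.restrict_constants (c : K) :
    V.restrict (constants π P c) = algebraMap K V.A c := V.res_constants c

variable {V}

/-- Restriction to `V` as a morphism of algebras, in a parametrization of `V`. -/
def FormalGerm.paramHom (δ : V.A ≃ₐ[K] MvPowerSeries (Fin d) K) :
    letI : Algebra K (LocalRing P) := (constants π P).toAlgebra
    LocalRing P →ₐ[K] MvPowerSeries (Fin d) K :=
  letI : Algebra K (LocalRing P) := (constants π P).toAlgebra
  { ((δ : V.A →+* _).comp V.restrict) with
    commutes' := fun c => by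
      change δ (V.restrict (constants π P c)) = _
      rw [V.restrict_constants, δ.commutes] }

theorem FormalGerm.constantCoeff_restrict (hP : P ≫ π = 𝟙 _)
    (δ : V.A ≃ₐ[K] MvPowerSeries (Fin d) K) (f : LocalRing P) :
    MvPowerSeries.constantCoeff (δ (V.restrict f)) = value P f := by
  let _ : Algebra K (LocalRing P) := (constants π P).toAlgebra
  let r := V.paramHom δ
  have h1 : f - constants π P (value P f) ∈ maximalIdeal (LocalRing P) := by
    rw [← ker_value, RingHom.mem_ker, map_sub, value_constants hP, sub_self]
  have h2 := mem_maximalIdeal_mvPowerSeries.1 (algHom_mem_maximalIdeal r h1)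
  have h3 : r (f - constants π P (value P f)) =
      δ (V.restrict f) - MvPowerSeries.C (value P f) := by
    rw [map_sub]
    congr 1
    exact r.commutes (value P f)
  rw [h3, map_sub, MvPowerSeries.constantCoeff_C, sub_eq_zero] at h2
  exact h2

/-- The constants `b k` are the linear coefficients of the expansion of `f` in the completion. The
congruence descends because the completion maps to the local ring modulo the square of its maximal
ideal. -/
theorem sub_sum_mem_of_completion {N : ℕ} (z : Fin N → LocalRing P)
    (Θ : MvPowerSeries (Fin N) K ≃+* CompletedLocalRing P)
    (hC : ∀ c : K, Θ (MvPowerSeries.C c) = algebraMap _ _ (constants π P c))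
    (hX : ∀ k, Θ (MvPowerSeries.X k) = algebraMap _ _ (z k)) :
    ∀ f ∈ maximalIdeal (LocalRing P), ∃ b : Fin N → K,
      f - ∑ k, constants π P (b k) * z k ∈ maximalIdeal (LocalRing P) ^ 2 := by
  intro f hf
  set m := maximalIdeal (LocalRing P) with hm
  have hev : ∀ (n : ℕ) (x : LocalRing P), AdicCompletion.evalₐ m n
      (algebraMap (LocalRing P) (CompletedLocalRing P) x) = Ideal.Quotient.mk (m ^ n) x := by
    intro n x
    exact AdicCompletion.evalₐ_of m n x
  have hz : ∀ x : LocalRing P, IsUnit (algebraMap (LocalRing P) (CompletedLocalRing P) x) →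
      x ∉ m := by
    intro x hx hxm
    have h1 := hx.map (AdicCompletion.evalₐ m 1)
    rw [hev, Ideal.Quotient.eq_zero_iff_mem.2 (by rwa [pow_one])] at h1
    have : Nontrivial (LocalRing P ⧸ m ^ 1) := Ideal.Quotient.nontrivial_iff.2 (by
      rw [pow_one]; exact Ideal.IsPrime.ne_top')
    exact not_isUnit_zero h1
  have hzm : ∀ k, z k ∈ m := by
    intro k h
    have h1 := (h.map (algebraMap (LocalRing P) (CompletedLocalRing P)))
    rw [← hX] at h1
    have h2 := h1.map Θ.symm
    rw [RingEquiv.symm_apply_apply] at h2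
    exact (mem_maximalIdeal_mvPowerSeries.2 (MvPowerSeries.constantCoeff_X k)) h2
  set F := Θ.symm (algebraMap _ _ f) with hF
  have hF0 : MvPowerSeries.constantCoeff F = 0 := by
    rw [← mem_maximalIdeal_mvPowerSeries]
    intro h
    have := h.map Θ
    rw [hF, RingEquiv.apply_symm_apply] at this
    exact hz f this hf
  refine ⟨fun k => MvPowerSeries.coeff (Finsupp.single k 1) F, ?_⟩
  have h1 := sub_linear_mem_pow_two hF0
  set e : MvPowerSeries (Fin N) K →+* LocalRing P ⧸ m ^ 2 :=
    (AdicCompletion.evalₐ m 2 : _ →+* _).comp Θ.toRingHom with he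
  have heX : ∀ k, e (MvPowerSeries.X k) = Ideal.Quotient.mk (m ^ 2) (z k) := by
    intro k
    change AdicCompletion.evalₐ m 2 (Θ (MvPowerSeries.X k)) = _
    rw [hX, hev]
  have heC : ∀ c, e (MvPowerSeries.C c) = Ideal.Quotient.mk (m ^ 2) (constants π P c) := by
    intro k
    change AdicCompletion.evalₐ m 2 (Θ (MvPowerSeries.C k)) = _
    rw [hC, hev]
  have heF : e F = Ideal.Quotient.mk (m ^ 2) f := by
    change AdicCompletion.evalₐ m 2 (Θ F) = _
    rw [hF, RingEquiv.apply_symm_apply, hev]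
  have h2 : Ideal.map e (maximalIdeal (MvPowerSeries (Fin N) K) ^ 2) = ⊥ := by
    rw [Ideal.map_pow, eq_bot_iff]
    have h3 : Ideal.map e (maximalIdeal (MvPowerSeries (Fin N) K)) ≤
        Ideal.map (Ideal.Quotient.mk (m ^ 2)) m := by
      rw [maximalIdeal_mvPowerSeries_eq_span, Ideal.map_span, Ideal.span_le]
      rintro _ ⟨_, ⟨k, rfl⟩, rfl⟩
      rw [heX]
      exact Ideal.mem_map_of_mem _ (hzm k)
    refine (Ideal.pow_right_mono h3 2).trans ?_
    rw [← Ideal.map_pow, Ideal.map_quotient_self]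
  have h4 := Ideal.mem_map_of_mem e h1
  rw [h2, Ideal.mem_bot] at h4
  rw [← Ideal.Quotient.eq_zero_iff_mem, ← h4]
  simp only [map_sub, map_sum, map_mul, MvPowerSeries.smul_eq_C_mul, heX, heC, heF]

end Restrict

/-! ### Growth of all algebraic functions along the germ -/

section Generators

variable {K : Type u} [Field K] {X : Scheme.{u}} {π : X ⟶ Spec (.of K)} {P : Spec (.of K) ⟶ X}

theorem eval₂_constants_eq_aeval {ι : Type*} (p : MvPolynomial ι K) (t : ι → LocalRing P) :
    letI : Algebra K (LocalRing P) := (constants π P).toAlgebra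
    p.eval₂ (constants π P) t = MvPolynomial.aeval t p := rfl

theorem exists_generators_localRing (π : X ⟶ Spec (.of K)) [LocallyOfFiniteType π]
    (P : Spec (.of K) ⟶ X) :
    ∃ (m : ℕ) (t : Fin m → LocalRing P), ∀ f : LocalRing P, ∃ p q : MvPolynomial (Fin m) K,
      IsUnit (q.eval₂ (constants π P) t) ∧
      q.eval₂ (constants π P) t * f = p.eval₂ (constants π P) t := by
  obtain ⟨W, hW, m, t, ht⟩ := exists_generators_stalk π (pt P)
  exact ⟨m, _, ht (pt P) hW⟩

end Generators

section Growth

variable {K : Type u} [Field K] [NumberField K] {X : Scheme.{u}} {π : X ⟶ Spec (.of K)}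
  {P : Spec (.of K) ⟶ X} {d : ℕ} {V : FormalGerm π P d}

theorem integer_isFractionRing (S : Set (HeightOneSpectrum (𝓞 K))) :
    IsFractionRing (S.integer K) K := by
  refine IsFractionRing.of_field _ _ fun x => ?_
  obtain ⟨a, b, h, rfl⟩ := IsFractionRing.div_surjective (A := 𝓞 K) x
  exact ⟨algebraMap (𝓞 K) _ a, algebraMap (𝓞 K) _ b, rfl⟩

/-- An analytic germ has a formal parametrization by convergent power series. -/
theorem FormalGerm.IsAnalyticAt.exists_hasGeometricGrowth [LocallyOfFiniteType π]
    (hP : P ≫ π = 𝟙 _) {N : ℕ} {v : HeightOneSpectrum (𝓞 K)} (hV : V.IsAnalyticAt N v) :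
    ∃ δ : V.A ≃ₐ[K] MvPowerSeries (Fin d) K, ∀ f : LocalRing P,
      HasGeometricGrowth (HeightOneSpectrum.adicAbv K v) (δ (V.restrict f)) := by
  let _ : Algebra K (LocalRing P) := (constants π P).toAlgebra
  obtain ⟨z, Θ, hC, hX, E, hE, hspan⟩ := hV
  obtain ⟨δ₀⟩ := V.smooth
  let θ : MvPowerSeries (Fin N) K →ₐ[K] MvPowerSeries (Fin d) K :=
    { (δ₀ : V.A →+* MvPowerSeries (Fin d) K).comp (V.res.comp Θ.toRingHom) with
      commutes' := fun c => by
        change δ₀ (V.res (Θ (MvPowerSeries.C c))) = _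
        rw [hC, V.res_constants, δ₀.commutes] }
  have hθ : Function.Surjective θ := fun y => by
    obtain ⟨a, rfl⟩ := δ₀.surjective y
    obtain ⟨b, rfl⟩ := V.res_surjective a
    obtain ⟨c, rfl⟩ := Θ.surjective b
    exact ⟨c, rfl⟩
  have hker : RingHom.ker θ = RingHom.ker (V.res.comp Θ.toRingHom) := by
    ext x
    rw [RingHom.mem_ker, RingHom.mem_ker]
    exact map_eq_zero_iff δ₀ δ₀.injective
  rw [← hker] at hspan
  obtain ⟨ψ, hψ⟩ := exists_convergent_parametrization (isNonarchimedean_adicCompletion v) θ hθ E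
    (fun f hf => (hE f hf).hasGeometricGrowth) hspan
  obtain ⟨m, t, ht⟩ := exists_generators_localRing π P
  refine ⟨δ₀.trans ψ, fun f => ?_⟩
  refine geometricGrowth_of_generators (HeightOneSpectrum.isNonarchimedean_adicAbv K v)
    (V.paramHom (δ₀.trans ψ)) z ?_ ?_ (fun k => t k - constants π P (value P (t k))) ?_ ?_ f
  · intro k
    rw [← hasGeometricGrowth_map_iff]
    have h1 := hψ k
    have h2 : θ (MvPowerSeries.X k) = δ₀ (V.restrict (z k)) := by
      change δ₀ (V.res (Θ (MvPowerSeries.X k))) = _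
      rw [hX]; rfl
    rw [h2] at h1
    exact h1
  · intro f hf
    obtain ⟨b, hb⟩ := sub_sum_mem_of_completion z Θ hC hX f hf
    exact ⟨b, by simp only [Algebra.smul_def]; exact hb⟩
  · intro k
    rw [← ker_value, RingHom.mem_ker, map_sub, value_constants hP, sub_self]
  · intro f
    obtain ⟨p, q, hq, hpq⟩ := ht f
    -- Polynomials in the generators `t k` are rewritten in the translates `t k - t k (P)`, which
    -- vanish at `P`; the denominator then has a non-zero constant coefficient.
    let s : MvPolynomial (Fin m) K →ₐ[K] MvPolynomial (Fin m) K :=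
      MvPolynomial.aeval fun k => MvPolynomial.X k + MvPolynomial.C (value P (t k))
    have hs : ∀ p, MvPolynomial.aeval (fun k => t k - constants π P (value P (t k))) (s p) =
        p.eval₂ (constants π P) t := by
      intro p
      have h1 := MvPolynomial.comp_aeval_apply (fun k => MvPolynomial.X k + MvPolynomial.C (value P (t k)))
        (MvPolynomial.aeval (R := K) (fun k => t k - constants π P (value P (t k)))) p
      refine h1.trans ?_
      rw [eval₂_constants_eq_aeval]
      congr 2
      ext k
      rw [map_add, MvPolynomial.aeval_X, MvPolynomial.aeval_C]
      exact sub_add_cancel _ _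
    refine ⟨s p, s q, ?_, by rw [hs, hs, hpq]⟩
    rw [← hs] at hq
    have h2 := (hq.map (value P)).ne_zero
    have h3 : value P (MvPolynomial.aeval (fun k => t k - constants π P (value P (t k))) (s q)) =
        MvPolynomial.constantCoeff (s q) := by
      have h4 := MvPolynomial.hom_eval₂ (s q) (constants π P) (value P)
        (fun k => t k - constants π P (value P (t k)))
      refine Eq.trans h4 ?_
      have h5 : (value P).comp (constants π P) = RingHom.id K := by
        ext c; exact value_constants hP c
      rw [h5]
      simp only [map_sub, value_constants hP, sub_self]
      exact MvPolynomial.eval₂_zero_apply _ _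
    rw [← h3]
    exact h2

/-- The product of the factorials of the exponents of a monomial. -/
def multiFactorial (I : Fin d →₀ ℕ) : ℕ := ∏ j, (I j)!

theorem multiFactorial_ne_zero (I : Fin d →₀ ℕ) : multiFactorial I ≠ 0 :=
  Finset.prod_ne_zero_iff.2 fun _ _ => Nat.factorial_ne_zero _

/-- This divisibility makes the factor `1 / |I!|_v ^ α` of the weight supermultiplicative for `α ≥
0`. -/
theorem multiFactorial_mul_dvd (I J : Fin d →₀ ℕ) :
    multiFactorial I * multiFactorial J ∣ multiFactorial (I + J) := by
  rw [multiFactorial, multiFactorial, multiFactorial, ← Finset.prod_mul_distrib]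
  exact Finset.prod_dvd_prod_of_dvd _ _ fun j _ => Nat.factorial_mul_factorial_dvd_factorial_add _ _

theorem multiFactorial_dvd (I : Fin d →₀ ℕ) : multiFactorial I ∣ (I.degree)! := by
  have := Nat.prod_factorial_dvd_factorial_sum Finset.univ I
  rwa [← Finsupp.degree_eq_sum] at this

theorem abv_natCast_pos (v : HeightOneSpectrum (𝓞 K)) {n : ℕ} (hn : n ≠ 0) :
    0 < HeightOneSpectrum.adicAbv K v (n : K) :=
  AbsoluteValue.pos _ (by exact_mod_cast hn)

theorem abv_natCast_le_one (v : HeightOneSpectrum (𝓞 K)) (n : ℕ) :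
    HeightOneSpectrum.adicAbv K v (n : K) ≤ 1 := by
  simpa using abv_algebraMap_le_one v (n : 𝓞 K)

theorem abv_natCast_le_of_dvd (v : HeightOneSpectrum (𝓞 K)) {m n : ℕ} (h : m ∣ n) :
    HeightOneSpectrum.adicAbv K v (n : K) ≤ HeightOneSpectrum.adicAbv K v (m : K) := by
  obtain ⟨k, rfl⟩ := h
  rw [Nat.cast_mul, map_mul]
  exact mul_le_of_le_one_right (apply_nonneg _ _) (abv_natCast_le_one v k)

/-- The bounds of the growth condition of type `α`. -/
def growthWeight (d : ℕ) (v : HeightOneSpectrum (𝓞 K)) {α : ℝ} (hα : 0 ≤ α) {D : ℝ} (hD : 0 ≤ D) :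
    Weight (Fin d) where
  toFun I := D ^ I.degree / HeightOneSpectrum.adicAbv K v (multiFactorial I : K) ^ α
  zero := by simp [multiFactorial]
  nonneg I := div_nonneg (pow_nonneg hD _) (Real.rpow_nonneg (apply_nonneg _ _) _)
  mul_le I J := by
    rw [div_mul_div_comm, ← pow_add, ← map_add, ← Real.mul_rpow (apply_nonneg _ _)
      (apply_nonneg _ _), ← map_mul]
    refine div_le_div_of_nonneg_left (pow_nonneg hD _)
      (Real.rpow_pos_of_pos (abv_natCast_pos v (multiFactorial_ne_zero _)) _)
      (Real.rpow_le_rpow (apply_nonneg _ _) ?_ hα)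
    rw [← Nat.cast_mul]
    exact abv_natCast_le_of_dvd v (multiFactorial_mul_dvd I J)

/-- The parametrization of an LG-germ satisfies the growth condition, for all algebraic
functions and for almost all places. -/
theorem FormalGerm.IsGood.eventually_mem_boundedSeries [LocallyOfFiniteType π]
    (hP : P ≫ π = 𝟙 _) {N : ℕ} {α : ℝ} (hα : 0 ≤ α) {S : Set (HeightOneSpectrum (𝓞 K))}
    (hS : S.Finite)
    {M : PointedModel (S.integer K) π P} {δ : V.A ≃ₐ[K] MvPowerSeries (Fin d) K}
    (hV : V.IsGood N α S M δ) :
    ∃ (C : HeightOneSpectrum (𝓞 K) → ℝ) (hC : ∀ v, 1 ≤ C v), Multipliable C ∧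
      ∀ f : LocalRing P, ∀ᶠ v : HeightOneSpectrum (𝓞 K) in Filter.cofinite, ∀ n,
        δ (V.restrict f) ∈ boundedSeries (HeightOneSpectrum.isNonarchimedean_adicAbv K v)
          (growthWeight d v hα (zero_le_one.trans (hC v))) n := by
  classical
  let _ : Algebra K (LocalRing P) := (constants π P).toAlgebra
  obtain ⟨U, hU, z, -, het, hz, ⟨C, hC1, hCZ, hCm⟩, -⟩ := hV
  have hfr : IsFractionRing (S.integer K) K := integer_isFractionRing S
  have hm := M.maximalIdeal_eq_span U hU (fun k : ULift.{u} (Fin N) => z k.down) (fun k => hz k.down)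
  -- The value 1 at the places of `S` extends the family to all places without affecting the
  -- product; the bounds are claimed only outside `S`.
  have hdef : ∀ v, 1 ≤ if v ∈ S then 1 else C v := fun v => by
    split_ifs with h
    exacts [le_rfl, hC1 v h]
  refine ⟨fun v => if v ∈ S then 1 else C v, hdef, ?_, fun f => ?_⟩
  · refine ((multipliable_subtype_iff_mulIndicator (s := {v | v ∉ S}) (f := C)).1 hCm).congr fun v => ?_
    by_cases h : v ∈ S <;> simp [Set.mulIndicator, h]
  · obtain ⟨m, t, ht⟩ := exists_generators_localRing π P
    have hm' : maximalIdeal (LocalRing P) = Ideal.span (Set.range fun k : Fin N =>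
        M.gen.stalkMap (LGGerm.pt P) (M.space.presheaf.germ U M.pt hU (z k))) := by
      rw [hm]
      congr 1
      ext x
      simp
    have h1 := LGGerm.eventually_mem_boundedSeries (V.paramHom δ) _ hm' t (fun f => by
      obtain ⟨p, q, h⟩ := ht f
      exact ⟨p, q, h⟩) (fun f => by
        have h2 : MvPowerSeries.constantCoeff (V.paramHom δ f) = value P f :=
          V.constantCoeff_restrict hP δ f
        rw [h2, ← ker_value, RingHom.mem_ker, map_sub, sub_eq_zero]
        exact (value_constants hP _).symm) f
    filter_upwards [h1, hS.eventually_cofinite_notMem] with v h2 hv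
    refine h2 _ fun n k => mem_boundedSeries.2 fun I _ => ?_
    have h3 := hCZ v hv k I
    change _ ≤ (if v ∈ S then 1 else C v) ^ I.degree / _
    rw [if_neg hv]
    exact h3

end Growth

/-! ### Uniform bounds for functions regular along the section -/

section Parametrization

variable {K : Type u} [Field K] {X : Scheme.{u}} {π : X ⟶ Spec (.of K)}
  {P : Spec (.of K) ⟶ X} {d : ℕ} {V : FormalGerm π P d}

theorem FormalGerm.param_eval₂ (δ : V.A ≃ₐ[K] MvPowerSeries (Fin d) K) {ι : Type*}
    (p : MvPolynomial ι (𝓞 K)) (t : ι → LocalRing P) :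
    δ (V.restrict (p.eval₂ ((constants π P).comp (algebraMap (𝓞 K) K)) t)) =
      MvPolynomial.aeval (fun k => δ (V.restrict (t k))) (p.map (algebraMap (𝓞 K) K)) := by
  rw [MvPolynomial.aeval_def, MvPolynomial.eval₂_map]
  have h := MvPolynomial.hom_eval₂ p ((constants π P).comp (algebraMap (𝓞 K) K))
    ((δ : V.A →+* MvPowerSeries (Fin d) K).comp V.restrict) t
  refine Eq.trans h ?_
  congr 1
  ext1 c
  change δ (V.restrict (constants π P (algebraMap (𝓞 K) K c))) = _
  rw [V.restrict_constants, δ.commutes]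
  rfl

end Parametrization

section LocalBounds

variable {K : Type u} [Field K] [NumberField K] {X : Scheme.{u}} {π : X ⟶ Spec (.of K)}
  {P : Spec (.of K) ⟶ X} {d : ℕ} {V : FormalGerm π P d}

/-- The numerator and denominator are polynomials in the `t k` over `𝓞 K`, hence bounded; the
denominator comes from a unit, so its constant term has absolute value 1 and division preserves the
bound. -/
theorem PointedModel.localize_mem_boundedSeries (hP : P ≫ π = 𝟙 _) (M : PointedModel (𝓞 K) π P)
    (δ : V.A ≃ₐ[K] MvPowerSeries (Fin d) K) (v : HeightOneSpectrum (𝓞 K)) (w : Weight (Fin d))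
    (n : ℕ) {m : ℕ} (t : Fin m → LocalRing P)
    (ht : ∀ k, δ (V.restrict (t k)) ∈
      boundedSeries (HeightOneSpectrum.isNonarchimedean_adicAbv K v) w n)
    (hgen : ∀ x : M.space.presheaf.stalk (M.sec (placePt v)), ∃ p r : MvPolynomial (Fin m) (𝓞 K),
        (∃ y, IsUnit y ∧ M.localize (placePt v) y =
          r.eval₂ ((LGGerm.constants π P).comp (algebraMap (𝓞 K) K)) t) ∧
        r.eval₂ ((LGGerm.constants π P).comp (algebraMap (𝓞 K) K)) t * M.localize (placePt v) x =
          p.eval₂ ((LGGerm.constants π P).comp (algebraMap (𝓞 K) K)) t)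
    (x : M.space.presheaf.stalk (M.sec (placePt v))) :
    δ (V.restrict (M.localize (placePt v) x)) ∈
      boundedSeries (HeightOneSpectrum.isNonarchimedean_adicAbv K v) w n := by
  obtain ⟨p, r, ⟨y, hy, hyr⟩, h⟩ := hgen x
  have hc : ∀ (p : MvPolynomial (Fin m) (𝓞 K)) l, HeightOneSpectrum.adicAbv K v
      ((p.map (algebraMap (𝓞 K) K)).coeff l) ≤ 1 := fun p l => by
    rw [MvPolynomial.coeff_map]
    exact abv_algebraMap_le_one v _
  have h1 : δ (V.restrict (M.localize (placePt v) y)) ∈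
      boundedSeries (HeightOneSpectrum.isNonarchimedean_adicAbv K v) w n := by
    rw [hyr, V.param_eval₂]
    exact aeval_mem_boundedSeries ht _ (hc r)
  refine mem_boundedSeries_of_mul h1 ?_ ?_
  · rw [MvPowerSeries.coeff_zero_eq_constantCoeff_apply, V.constantCoeff_restrict hP]
    exact M.abv_value_localize_eq_one v hy
  · have h2 := congrArg (fun f => δ (V.restrict f)) h
    simp only [map_mul] at h2
    rw [hyr, h2, V.param_eval₂]
    exact aeval_mem_boundedSeries ht _ (hc p)

/-- Only the finitely many generators `t k` have to be controlled, so one exceptional set of places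
serves for all germs `x`. -/
theorem FormalGerm.IsGood.eventually_localize_mem [LocallyOfFiniteType π]
    (hP : P ≫ π = 𝟙 _) {N : ℕ} {α : ℝ} (hα : 0 ≤ α) {S : Set (HeightOneSpectrum (𝓞 K))}
    (hS : S.Finite) {M' : PointedModel (S.integer K) π P} {δ : V.A ≃ₐ[K] MvPowerSeries (Fin d) K}
    (hV : V.IsGood N α S M' δ) (M : PointedModel (𝓞 K) π P) :
    ∃ (C : HeightOneSpectrum (𝓞 K) → ℝ) (_ : ∀ v, 1 ≤ C v), Multipliable C ∧
      ∀ᶠ v : HeightOneSpectrum (𝓞 K) in Filter.cofinite,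
        ∀ (x : M.space.presheaf.stalk (M.sec (placePt v))) (I : Fin d →₀ ℕ),
          HeightOneSpectrum.adicAbv K v
            (MvPowerSeries.coeff I (δ (V.restrict (M.localize (placePt v) x)))) ≤
          C v ^ I.degree / HeightOneSpectrum.adicAbv K v (multiFactorial I : K) ^ α := by
  obtain ⟨C, hC, hCm, h⟩ := hV.eventually_mem_boundedSeries hP hα hS
  refine ⟨C, hC, hCm, ?_⟩
  obtain ⟨W, hW, m, t, -, ht⟩ := M.exists_generators_localize (fieldPt (𝓞 K) K)
  rw [← M.pt_eq] at hW
  have h1 : ∀ᶠ v : HeightOneSpectrum (𝓞 K) in Filter.cofinite, ∀ k n,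
      δ (V.restrict (t k)) ∈ boundedSeries (HeightOneSpectrum.isNonarchimedean_adicAbv K v)
          (growthWeight d v hα (zero_le_one.trans (hC v))) n := by
    rw [Filter.eventually_all]
    exact fun k => h (t k)
  filter_upwards [h1, M.eventually_sec_mem hW] with v h2 h3 x I
  exact mem_boundedSeries.1 (M.localize_mem_boundedSeries hP δ v _ I.degree t (fun k => h2 k _)
    (ht _ h3) x) I le_rfl

theorem FormalGerm.IsAnalyticAt.exists_localize_bound [LocallyOfFiniteType π]
    (hP : P ≫ π = 𝟙 _) {N : ℕ} {v : HeightOneSpectrum (𝓞 K)} (hV : V.IsAnalyticAt N v)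
    (M : PointedModel (𝓞 K) π P) :
    ∃ (δ : V.A ≃ₐ[K] MvPowerSeries (Fin d) K) (D : ℝ), 1 ≤ D ∧
      ∀ (x : M.space.presheaf.stalk (M.sec (placePt v))) (I : Fin d →₀ ℕ),
          HeightOneSpectrum.adicAbv K v
            (MvPowerSeries.coeff I (δ (V.restrict (M.localize (placePt v) x)))) ≤
          D ^ I.degree := by
  obtain ⟨δ, hδ⟩ := hV.exists_hasGeometricGrowth hP
  obtain ⟨W, hW, m, t, htr, ht⟩ := M.exists_generators_localize (placePt v)
  choose D hD1 hD using fun k => hδ (t k)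
  set E : ℝ := 1 + ∑ k, D k with hE
  have hE1 : 1 ≤ E := by
    rw [hE, le_add_iff_nonneg_right]
    exact Finset.sum_nonneg fun k _ => zero_le_one.trans (hD1 k)
  have hDE : ∀ k, D k ≤ E := fun k => by
    have := Finset.single_le_sum (fun k _ => zero_le_one.trans (hD1 k)) (Finset.mem_univ k)
    linarith
  refine ⟨δ, E ^ 2, one_le_pow₀ hE1, fun x I => ?_⟩
  refine mem_boundedSeries.1 (M.localize_mem_boundedSeries hP δ v
    (geometricWeight (Fin d) (show (0 : ℝ) ≤ E ^ 2 by positivity)) I.degree t (fun k => ?_)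
    (ht _ hW) x) I le_rfl
  refine mem_boundedSeries.2 fun I _ => ?_
  change _ ≤ (E ^ 2) ^ I.degree
  -- The bound `D ^ (|I| + 1)` is useless in degree zero, where integrality of the value at `P`
  -- replaces it; in positive degree squaring the constant absorbs the `+ 1`.
  rcases Nat.eq_zero_or_pos I.degree with h0 | h0
  · rw [h0, pow_zero]
    rw [Finsupp.degree_eq_zero_iff] at h0
    rw [h0, MvPowerSeries.coeff_zero_eq_constantCoeff_apply, V.constantCoeff_restrict hP]
    obtain ⟨y, hy⟩ := htr _ hW k
    rw [← hy]
    exact M.abv_value_localize_le_one v y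
  · refine (hD k I).trans ((pow_le_pow_left₀ (zero_le_one.trans (hD1 k)) (hDE k) _).trans ?_)
    rw [← pow_mul]
    exact pow_le_pow_right₀ hE1 (by lia)

end LocalBounds

theorem one_notMem_asIdeal {R : Type*} [CommRing R] (v : HeightOneSpectrum R) :
    (1 : R) ∉ v.asIdeal :=
  (Ideal.ne_top_iff_one _).1 v.isPrime.ne_top

/-! ### Norms attached to lattices -/

section LatticeNorm

variable {K : Type u} [Field K] [NumberField K] {W : Type u} [AddCommGroup W] [Module K W]
  [Module (𝓞 K) W] {v : HeightOneSpectrum (𝓞 K)} {Λ : Submodule (𝓞 K) W}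

theorem latticeNorm_nonneg (w : W) : 0 ≤ latticeNorm v Λ w := by
  refine Real.sInf_nonneg ?_
  rintro _ ⟨a, b, -, -, rfl⟩
  exact apply_nonneg _ _

theorem latticeNorm_le {a : K} {b : 𝓞 K} (hb : b ∉ v.asIdeal) {w x : W} (hx : x ∈ Λ)
    (h : b • w = a • x) : latticeNorm v Λ w ≤ HeightOneSpectrum.adicAbv K v a :=
  csInf_le ⟨0, by rintro _ ⟨a, b, -, -, rfl⟩; exact apply_nonneg _ _⟩ ⟨a, b, hb, ⟨x, hx, h⟩, rfl⟩

theorem latticeNorm_zero : latticeNorm v Λ (0 : W) = 0 := by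
  refine le_antisymm ?_ (latticeNorm_nonneg _)
  simpa using latticeNorm_le (a := (0 : K)) (one_notMem_asIdeal v) (zero_mem Λ) (w := (0 : W)) (by simp)

/-- The infimum of the empty set of reals is 0, so a lower bound needs some admissible scalar to
exist. -/
theorem le_latticeNorm {c : ℝ} {w : W}
    (hne : ∃ (a : K) (b : 𝓞 K), b ∉ v.asIdeal ∧ ∃ x ∈ Λ, b • w = a • x)
    (h : ∀ (a : K) (b : 𝓞 K) (x : W), b ∉ v.asIdeal → x ∈ Λ → b • w = a • x →
      c ≤ HeightOneSpectrum.adicAbv K v a) : c ≤ latticeNorm v Λ w := by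
  obtain ⟨a, b, hb, hx⟩ := hne
  refine le_csInf ⟨_, a, b, hb, hx, rfl⟩ ?_
  rintro _ ⟨a, b, hb, ⟨x, hx, h1⟩, rfl⟩
  exact h a b x hb hx h1

theorem exists_smul_integral (v : HeightOneSpectrum (𝓞 K)) {x : K}
    (hx : HeightOneSpectrum.adicAbv K v x ≤ 1) :
    ∃ s : 𝓞 K, s ∉ v.asIdeal ∧ ∃ y : 𝓞 K, algebraMap (𝓞 K) K s * x = algebraMap (𝓞 K) K y := by
  obtain ⟨y, s, h⟩ := v.exists_primeCompl_mul_eq_of_integer x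
    ((abv_le_one_iff_valuation_le_one v x).1 hx)
  exact ⟨s, s.2, y, by rw [mul_comm]; exact h⟩

theorem exists_smul_integral_finset (v : HeightOneSpectrum (𝓞 K)) {ι : Type*} (t : Finset ι)
    (q : ι → K) (hq : ∀ i ∈ t, HeightOneSpectrum.adicAbv K v (q i) ≤ 1) :
    ∃ s : 𝓞 K, s ∉ v.asIdeal ∧ ∀ i ∈ t, ∃ y : 𝓞 K,
      algebraMap (𝓞 K) K s * q i = algebraMap (𝓞 K) K y := by
  classical
  induction t using Finset.induction_on with
  | empty => exact ⟨1, one_notMem_asIdeal v, by simp⟩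
  | insert a t ha ih =>
    obtain ⟨s, hs, h⟩ := ih fun i hi => hq i (Finset.mem_insert_of_mem hi)
    obtain ⟨s', hs', y, hy⟩ := exists_smul_integral v (hq a (Finset.mem_insert_self _ _))
    refine ⟨s * s', fun h => (v.isPrime.mem_or_mem h).elim hs hs', fun i hi => ?_⟩
    rcases Finset.mem_insert.1 hi with rfl | hi
    · exact ⟨s * y, by rw [map_mul, map_mul, ← hy]; ring⟩
    · obtain ⟨z, hz⟩ := h i hi
      exact ⟨s' * z, by rw [map_mul, map_mul, ← hz]; ring⟩

end LatticeNorm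

/-- Lists a monomial with multiplicity, to match the generators of `jetLattice`, which are products
indexed by `Fin i`. -/
theorem exists_prod_eq_monomial {M : Type*} [CommMonoid M] {d : ℕ} (I : Fin d →₀ ℕ)
    (f : Fin d → M) : ∃ k : Fin I.degree → Fin d, ∏ l, f (k l) = ∏ j, f j ^ I j := by
  classical
  set L := (Finsupp.toMultiset I).toList with hL
  have h1 : L.length = I.degree := by
    rw [hL, Multiset.length_toList, Finsupp.card_toMultiset]
    rfl
  have h2 : (L.map f).prod = ∏ j, f j ^ I j := by
    rw [← Multiset.prod_coe, ← Multiset.map_coe, hL, Multiset.coe_toList,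
      Finset.prod_multiset_map_count]
    simp only [Finsupp.count_toMultiset]
    refine Finset.prod_subset (Finset.subset_univ _) fun j _ hj => ?_
    have : I j = 0 := by simpa using hj
    rw [this, pow_zero]
  refine ⟨fun l => L.get (l.cast h1.symm), ?_⟩
  rw [← h2, ← List.ofFn_get (L.map f), List.prod_ofFn]
  refine Fintype.prod_equiv (finCongr (by simp [h1])) _ _ fun l => ?_
  simp

/-! ### Jets as leading coefficients -/

section Coefficients

variable {K : Type u} [Field K] {R : Type u} [CommRing R] [Algebra K R] {d : ℕ}
  (δ : R ≃ₐ[K] MvPowerSeries (Fin d) K) {N : Type u} [AddCommGroup N] [Module R N]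

theorem coeff_algebraMap_smul (ε : R ≃ₗ[R] N) (c : K) (n : N) (I : Fin d →₀ ℕ) :
    MvPowerSeries.coeff I (δ (ε.symm (algebraMap K R c • n))) =
      c * MvPowerSeries.coeff I (δ (ε.symm n)) := by
  rw [map_smul, smul_eq_mul, map_mul, δ.commutes, MvPowerSeries.algebraMap_apply,
    MvPowerSeries.coeff_C_mul]
  rfl

end Coefficients

section JetCoefficients

variable {K : Type u} [Field K] {R : Type u} [CommRing R] [IsLocalRing R] [Algebra K R] {d : ℕ}
  (δ : R ≃ₐ[K] MvPowerSeries (Fin d) K)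

theorem mem_maximalIdeal_iff_of_equiv (x : R) :
    x ∈ maximalIdeal R ↔ δ x ∈ maximalIdeal (MvPowerSeries (Fin d) K) := by
  rw [mem_maximalIdeal, mem_maximalIdeal, mem_nonunits_iff, mem_nonunits_iff,
    MulEquiv.isUnit_map δ]

theorem mem_pow_maximalIdeal_iff_of_equiv (n : ℕ) (x : R) :
    x ∈ maximalIdeal R ^ n ↔ ∀ I : Fin d →₀ ℕ, I.degree < n → MvPowerSeries.coeff I (δ x) = 0 := by
  rw [← mem_pow_maximalIdeal_iff]
  refine ⟨fun h => algHom_mem_pow_maximalIdeal (δ : R →ₐ[K] MvPowerSeries (Fin d) K) h, fun h => ?_⟩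
  have h1 : Ideal.map (δ.symm : MvPowerSeries (Fin d) K →+* R) (maximalIdeal _) ≤
      maximalIdeal R := Ideal.map_le_iff_le_comap.2 fun y hy => by
    rw [Ideal.mem_comap, mem_maximalIdeal_iff_of_equiv δ]
    simpa using hy
  have h2 := Ideal.mem_map_of_mem (δ.symm : MvPowerSeries (Fin d) K →+* R) h
  rw [Ideal.map_pow] at h2
  have h3 := Ideal.pow_right_mono h1 n h2
  simpa using h3

variable {N : Type u} [AddCommGroup N] [Module R N]

theorem mem_vanishing_iff (ε : R ≃ₗ[R] N) (i : ℕ) (n : N) :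
    n ∈ vanishing R N i ↔ ε.symm n ∈ maximalIdeal R ^ i := by
  have h : vanishing R N i = Submodule.map (ε : R →ₗ[R] N) (maximalIdeal R ^ i) := by
    rw [vanishing, ← LinearEquiv.range ε, ← Submodule.map_top, ← Submodule.map_smul'',
      smul_eq_mul, Ideal.mul_top]
  rw [h]
  constructor
  · rintro ⟨x, hx, rfl⟩
    simpa using hx
  · exact fun h => ⟨_, h, by simp⟩

theorem jet_eq_iff (i : ℕ) (y z : vanishing R N i) :
    jet R N i y = jet R N i z ↔ (y : N) - z ∈ vanishing R N (i + 1) := by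
  rw [jet, Submodule.mkQ_apply, Submodule.mkQ_apply, Submodule.Quotient.eq]
  rfl

theorem jet_eq_zero_iff (ε : R ≃ₗ[R] N) (i : ℕ) (y : vanishing R N i) :
    jet R N i y = 0 ↔ ∀ I : Fin d →₀ ℕ, I.degree = i →
      MvPowerSeries.coeff I (δ (ε.symm (y : N))) = 0 := by
  have h0 := (mem_pow_maximalIdeal_iff_of_equiv δ i _).1 ((mem_vanishing_iff ε i _).1 y.2)
  rw [← map_zero (jet R N i), jet_eq_iff, ZeroMemClass.coe_zero, sub_zero, mem_vanishing_iff ε,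
    mem_pow_maximalIdeal_iff_of_equiv δ]
  refine ⟨fun h I hI => h I (by lia), fun h I hI => ?_⟩
  rcases lt_or_eq_of_le (Nat.lt_succ_iff.1 hI) with h1 | h1
  exacts [h0 I h1, h I h1]

end JetCoefficients

/-! ### The jet lattice in coordinates -/

section JetLattice

variable {K : Type u} [Field K] [NumberField K] {R : Type u} [CommRing R] [IsLocalRing R]
  [Algebra K R] {d : ℕ} (δ : R ≃ₐ[K] MvPowerSeries (Fin d) K)
  {N : Type u} [AddCommGroup N] [Module R N] [Module K N]
  [IsScalarTower K R N] [Module (𝓞 K) N] [IsScalarTower (𝓞 K) R N] (ε : R ≃ₗ[R] N)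
  {Λ : Submodule (𝓞 K) (CotangentSpace R)} {E : Set N} (v : HeightOneSpectrum (𝓞 K))

/-- A power series in the `a`-th power of the maximal ideal whose leading coefficients are
integral at `v`. -/
def LeadingIntegral (a : ℕ) (f : MvPowerSeries (Fin d) K) : Prop :=
  (∀ I : Fin d →₀ ℕ, I.degree < a → MvPowerSeries.coeff I f = 0) ∧
    ∀ I : Fin d →₀ ℕ, I.degree = a → HeightOneSpectrum.adicAbv K v (MvPowerSeries.coeff I f) ≤ 1

variable {v}

theorem LeadingIntegral.mul {a b : ℕ} {f g : MvPowerSeries (Fin d) K} (hf : LeadingIntegral v a f)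
    (hg : LeadingIntegral v b g) : LeadingIntegral v (a + b) (f * g) := by
  classical
  refine ⟨fun I hI => ?_, fun I hI => ?_⟩
  · rw [MvPowerSeries.coeff_mul]
    refine Finset.sum_eq_zero fun p hp => ?_
    have h1 := congrArg Finsupp.degree (Finset.HasAntidiagonal.mem_antidiagonal.1 hp)
    rw [map_add] at h1
    by_cases h : p.1.degree < a
    · rw [hf.1 _ h, zero_mul]
    · rw [hg.1 p.2 (by lia), mul_zero]
  · rw [MvPowerSeries.coeff_mul]
    refine abv_sum_le (HeightOneSpectrum.isNonarchimedean_adicAbv K v) _ _ zero_le_one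
      fun p hp => ?_
    have h1 := congrArg Finsupp.degree (Finset.HasAntidiagonal.mem_antidiagonal.1 hp)
    rw [map_add] at h1
    rcases lt_trichotomy p.1.degree a with h | h | h
    · simp [hf.1 _ h]
    · rw [map_mul]
      exact mul_le_one₀ (hf.2 _ h) (apply_nonneg _ _) (hg.2 _ (by lia))
    · rw [hg.1 p.2 (by lia), mul_zero, map_zero]
      exact zero_le_one

theorem LeadingIntegral.prod {i : ℕ} (f : Fin i → MvPowerSeries (Fin d) K)
    (hf : ∀ k, LeadingIntegral v 1 (f k)) : LeadingIntegral v i (∏ k, f k) := by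
  classical
  induction i with
  | zero =>
    refine ⟨fun I hI => by lia, fun I _ => ?_⟩
    rw [Finset.univ_eq_empty, Finset.prod_empty, MvPowerSeries.coeff_one]
    split_ifs <;> simp
  | succ i ih =>
    rw [Fin.prod_univ_castSucc]
    exact (ih _ fun k => hf _).mul (hf _)

omit [Module K N] [IsScalarTower K R N] in
-- Integral differentials and integral values give integral leading forms, since leading forms
-- multiply. This is the input for lower bounds of the norm.
theorem exists_jet_eq_of_mem_jetLattice
    (hΛ : ∀ x : maximalIdeal R, (maximalIdeal R).toCotangent x ∈ Λ → ∀ j,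
      HeightOneSpectrum.adicAbv K v (MvPowerSeries.coeff (Finsupp.single j 1) (δ (x : R))) ≤ 1)
    (hE : ∀ e ∈ E, HeightOneSpectrum.adicAbv K v
      (MvPowerSeries.constantCoeff (δ (ε.symm e))) ≤ 1) {i : ℕ} {x : JetSpace R N i}
    (hx : x ∈ jetLattice Λ E i) : ∃ y : vanishing R N i, jet R N i y = x ∧
      ∀ I : Fin d →₀ ℕ, I.degree = i →
        HeightOneSpectrum.adicAbv K v (MvPowerSeries.coeff I (δ (ε.symm (y : N)))) ≤ 1 := by
  induction hx using Submodule.span_induction with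
  | mem x h =>
    obtain ⟨x, e, y, hx, he, hy, rfl⟩ := h
    refine ⟨y, rfl, ?_⟩
    rw [hy, map_smul, smul_eq_mul, map_mul, map_prod]
    refine (((LeadingIntegral.prod (v := v) (fun k => δ (x k : R)) fun k => ?_).mul
      (b := 0) (g := δ (ε.symm e)) ?_).2)
    · refine ⟨fun I hI => ?_, fun I hI => ?_⟩
      · exact (mem_pow_maximalIdeal_iff_of_equiv δ 1 _).1 (by rw [pow_one]; exact (x k).2) I hI
      · obtain ⟨j, rfl⟩ : I ∈ Set.range fun j => Finsupp.single j 1 := by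
          rw [Finsupp.range_single_one]; exact hI
        exact hΛ _ (hx k) j
    · refine ⟨fun I hI => by lia, fun I hI => ?_⟩
      rw [(Finsupp.degree_eq_zero_iff I).1 hI, MvPowerSeries.coeff_zero_eq_constantCoeff_apply]
      exact hE e he
  | zero => exact ⟨0, map_zero _, fun I _ => by simp⟩
  | add x y _ _ hx hy =>
    obtain ⟨x, rfl, hx⟩ := hx
    obtain ⟨y, rfl, hy⟩ := hy
    refine ⟨x + y, map_add _ _ _, fun I hI => ?_⟩
    rw [Submodule.coe_add, map_add, map_add, map_add]
    exact (HeightOneSpectrum.isNonarchimedean_adicAbv K v _ _).trans (max_le (hx I hI) (hy I hI))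
  | smul c x _ hx =>
    obtain ⟨x, rfl, hx⟩ := hx
    refine ⟨algebraMap (𝓞 K) R c • x, ?_, fun I hI => ?_⟩
    · rw [map_smul, algebraMap_smul]
    · rw [Submodule.coe_smul, IsScalarTower.algebraMap_apply (𝓞 K) K R, coeff_algebraMap_smul,
        map_mul]
      exact mul_le_one₀ (abv_algebraMap_le_one v c) (apply_nonneg _ _) (hx I hI)

theorem abv_coeff_le_of_smul_jet_eq {i : ℕ} {y z : vanishing R N i} {a : K} {b : 𝓞 K}
    (hb : b ∉ v.asIdeal) (h : b • jet R N i y = a • jet R N i z) (I : Fin d →₀ ℕ) (hI : I.degree = i)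
    (hz : HeightOneSpectrum.adicAbv K v (MvPowerSeries.coeff I (δ (ε.symm (z : N)))) ≤ 1) :
    HeightOneSpectrum.adicAbv K v (MvPowerSeries.coeff I (δ (ε.symm (y : N)))) ≤
      HeightOneSpectrum.adicAbv K v a := by
  have h1 : jet R N i (algebraMap K R (algebraMap (𝓞 K) K b) • y - algebraMap K R a • z) = 0 := by
    rw [map_sub, map_smul, map_smul, algebraMap_smul R a, ← h,
      ← IsScalarTower.algebraMap_apply (𝓞 K) K R, algebraMap_smul, sub_self]
  have h2 := (jet_eq_zero_iff δ ε i _).1 h1 I hI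
  rw [Submodule.coe_sub, Submodule.coe_smul, Submodule.coe_smul, map_sub, map_sub, map_sub,
    coeff_algebraMap_smul, coeff_algebraMap_smul, sub_eq_zero] at h2
  have h3 := congrArg (HeightOneSpectrum.adicAbv K v) h2
  rw [map_mul, map_mul] at h3
  rw [(abv_algebraMap_eq_one_iff v b).2 hb, one_mul] at h3
  rw [h3]
  exact mul_le_of_le_one_right (apply_nonneg _ _) hz

/-- The multiples `b ^ i X ^ I e` of the monomials lie in the jet lattice, so a jet with
coefficients bounded by `B` lies in it locally after scaling by an element of size at most `B / |b|
^ i`. -/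
theorem exists_smul_jet_eq {b : 𝓞 K} (hb : b ≠ 0)
    (hΛ : ∀ j, ∃ x : maximalIdeal R, (x : R) = algebraMap (𝓞 K) R b * δ.symm (MvPowerSeries.X j) ∧
      (maximalIdeal R).toCotangent x ∈ Λ) (hE : ε 1 ∈ E) {i : ℕ} {B : ℝ} (hB : 0 ≤ B)
    (y : vanishing R N i) (h : ∀ I : Fin d →₀ ℕ, I.degree = i →
      HeightOneSpectrum.adicAbv K v (MvPowerSeries.coeff I (δ (ε.symm (y : N)))) ≤ B) :
    ∃ (a : K) (s : 𝓞 K) (x : JetSpace R N i), s ∉ v.asIdeal ∧ x ∈ jetLattice Λ E i ∧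
      s • jet R N i y = a • x ∧ HeightOneSpectrum.adicAbv K v a ≤
        B / HeightOneSpectrum.adicAbv K v (algebraMap (𝓞 K) K b) ^ i := by
  classical
  set c : (Fin d →₀ ℕ) → K := fun I => MvPowerSeries.coeff I (δ (ε.symm (y : N))) with hc
  set F : Finset (Fin d →₀ ℕ) := (Finsupp.finite_of_degree_eq (σ := Fin d) i).toFinset with hF
  have hFi : ∀ I, I ∈ F ↔ I.degree = i := fun I => by simp [hF]
  have hbK : algebraMap (𝓞 K) K b ≠ 0 := by simpa using hb
  by_cases h0 : ∀ I ∈ F, c I = 0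
  · refine ⟨0, 1, 0, one_notMem_asIdeal v, zero_mem _, ?_, ?_⟩
    · rw [zero_smul, (jet_eq_zero_iff δ ε i y).2 fun I hI => h0 I ((hFi I).2 hI), smul_zero]
    · rw [map_zero]
      positivity
  push Not at h0
  obtain ⟨I₁, hI₁, hcI₁⟩ := h0
  -- The scaling must be by an element of `K`, not a real number: the largest coefficient is taken,
  -- and its ratios to the others are integral at `v` with a common denominator `s`.
  obtain ⟨I₀, hI₀, hmax⟩ := F.exists_max_image (fun I => HeightOneSpectrum.adicAbv K v (c I))
    ⟨I₁, hI₁⟩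
  have hc0 : c I₀ ≠ 0 := by
    intro h2
    have := hmax I₁ hI₁
    rw [h2, map_zero] at this
    exact hcI₁ ((AbsoluteValue.eq_zero _).1 (le_antisymm this (apply_nonneg _ _)))
  obtain ⟨s, hs, hy⟩ := exists_smul_integral_finset v F (fun I => c I / c I₀) fun I hI => by
    rw [map_div₀]
    exact div_le_one_of_le₀ (hmax I hI) (apply_nonneg _ _)
  choose! q hq using hy
  choose x hx hxΛ using hΛ
  -- representatives of the generators of the lattice
  have hw : ∀ I ∈ F, ∃ w : vanishing R N i, (w : N) =
      (algebraMap K R (algebraMap (𝓞 K) K b ^ i) * δ.symm (MvPowerSeries.monomial I 1)) • ε 1 ∧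
      jet R N i w ∈ jetLattice Λ E i := by
    intro I hI
    obtain rfl := (hFi I).1 hI
    obtain ⟨k, hk⟩ := exists_prod_eq_monomial I fun j => (x j : R)
    have h1 : ∏ l, (x (k l) : R) =
        algebraMap K R (algebraMap (𝓞 K) K b ^ I.degree) * δ.symm (MvPowerSeries.monomial I 1) := by
      rw [hk]
      simp only [hx, mul_pow, Finset.prod_mul_distrib]
      rw [Finset.prod_pow_eq_pow_sum, ← Finsupp.degree_eq_sum, map_pow,
        ← IsScalarTower.algebraMap_apply (𝓞 K) K R]
      congr 1
      apply δ.injective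
      simp only [map_prod, map_pow, AlgEquiv.apply_symm_apply]
      rw [MvPowerSeries.monomial_one_eq]
      exact (Finsupp.prod_fintype _ _ fun _ => pow_zero _).symm
    have h2 : (∏ l, (x (k l) : R)) • ε 1 ∈ vanishing R N I.degree := by
      refine Submodule.smul_mem_smul ?_ trivial
      have := Ideal.prod_mem_prod (s := Finset.univ) (I := fun _ : Fin I.degree => maximalIdeal R)
        (x := fun l => (x (k l) : R)) fun l _ => (x (k l)).2
      simpa using this
    exact ⟨⟨_, h2⟩, by rw [← h1], Submodule.subset_span
      ⟨fun l => x (k l), ε 1, ⟨_, h2⟩, fun l => hxΛ _, hE, rfl, rfl⟩⟩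
  choose! w hwv hwΛ using hw
  refine ⟨c I₀ / algebraMap (𝓞 K) K b ^ i, s, ∑ I ∈ F, q I • jet R N i (w I), hs,
    Submodule.sum_mem _ fun I hI => Submodule.smul_mem _ _ (hwΛ I hI), ?_, ?_⟩
  · have h1 : jet R N i (algebraMap K R (algebraMap (𝓞 K) K s) • y -
        algebraMap K R (c I₀ / algebraMap (𝓞 K) K b ^ i) •
          ∑ I ∈ F, algebraMap K R (algebraMap (𝓞 K) K (q I)) • w I) = 0 := by
      rw [jet_eq_zero_iff δ ε]
      intro I hI
      rw [Submodule.coe_sub, Submodule.coe_smul, Submodule.coe_smul, map_sub, map_sub, map_sub,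
        coeff_algebraMap_smul, coeff_algebraMap_smul, Submodule.coe_sum, map_sum, map_sum, map_sum,
        Finset.sum_eq_single I, Submodule.coe_smul, coeff_algebraMap_smul, ← hq I ((hFi I).2 hI),
        hwv I ((hFi I).2 hI), map_smul, LinearEquiv.symm_apply_apply, smul_eq_mul, mul_one, map_mul,
        δ.commutes, AlgEquiv.apply_symm_apply, MvPowerSeries.algebraMap_apply,
        MvPowerSeries.coeff_C_mul, MvPowerSeries.coeff_monomial_same]
      · change _ * c I - _ = 0
        simp only [Algebra.algebraMap_self, RingHom.id_apply]
        field_simp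
        ring
      · intro J hJ hJI
        rw [Submodule.coe_smul, coeff_algebraMap_smul, hwv J hJ, map_smul,
          LinearEquiv.symm_apply_apply, smul_eq_mul, mul_one, map_mul, δ.commutes,
          AlgEquiv.apply_symm_apply, MvPowerSeries.algebraMap_apply,
          MvPowerSeries.coeff_C_mul, MvPowerSeries.coeff_monomial_ne hJI.symm, mul_zero, mul_zero]
      · exact fun h => absurd ((hFi I).2 hI) h
    rw [map_sub, map_smul, map_smul, algebraMap_smul R (c I₀ / _),
      ← IsScalarTower.algebraMap_apply (𝓞 K) K R, algebraMap_smul, sub_eq_zero, map_sum] at h1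
    rw [h1]
    congr 1
    refine Finset.sum_congr rfl fun I _ => ?_
    rw [map_smul, ← IsScalarTower.algebraMap_apply (𝓞 K) K R, algebraMap_smul]
  · rw [map_div₀, map_pow]
    exact div_le_div_of_nonneg_right (h I₀ ((hFi I₀).1 hI₀)) (by positivity)

end JetLattice

/-! ### Coordinates and lattices on the cotangent space -/

section CotangentCoordinates

variable {K : Type u} [Field K] {R : Type u} [CommRing R] [IsLocalRing R] [Algebra K R] {d : ℕ}
  (δ : R ≃ₐ[K] MvPowerSeries (Fin d) K)

theorem coeff_single_eq_of_toCotangent_eq {x y : maximalIdeal R}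
    (h : (maximalIdeal R).toCotangent x = (maximalIdeal R).toCotangent y) (j : Fin d) :
    MvPowerSeries.coeff (Finsupp.single j 1) (δ (x : R)) =
      MvPowerSeries.coeff (Finsupp.single j 1) (δ (y : R)) := by
  rw [Ideal.toCotangent_eq, mem_pow_maximalIdeal_iff_of_equiv δ] at h
  have := h (Finsupp.single j 1) (by rw [Finsupp.degree_single]; norm_num)
  rwa [map_sub, map_sub, sub_eq_zero] at this

theorem toCotangent_algebraMap_smul (c : K) (x : maximalIdeal R) :
    (maximalIdeal R).toCotangent (algebraMap K R c • x) = c • (maximalIdeal R).toCotangent x := by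
  rw [map_smul, algebraMap_smul]

/-- A function vanishing at the closed point with a given differential. -/
def cotangentLift (w : CotangentSpace R) : maximalIdeal R :=
  ((maximalIdeal R).toCotangent_surjective w).choose

theorem toCotangent_cotangentLift (w : CotangentSpace R) :
    (maximalIdeal R).toCotangent (cotangentLift w) = w :=
  ((maximalIdeal R).toCotangent_surjective w).choose_spec

/-- The coordinates on the cotangent space given by a parametrization. -/
def cotangentCoeff (j : Fin d) : CotangentSpace R →ₗ[K] K where
  toFun w := MvPowerSeries.coeff (Finsupp.single j 1) (δ (cotangentLift w : R))
  map_add' v w := by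
    rw [← map_add, ← map_add, ← Submodule.coe_add]
    refine coeff_single_eq_of_toCotangent_eq δ ?_ j
    simp only [map_add, toCotangent_cotangentLift]
  map_smul' c w := by
    refine Eq.trans ?_ (coeff_algebraMap_smul δ (LinearEquiv.refl R R) c (cotangentLift w : R) _)
    refine coeff_single_eq_of_toCotangent_eq δ (y := algebraMap K R c • cotangentLift w) ?_ j
    simp only [toCotangent_algebraMap_smul, toCotangent_cotangentLift]

theorem cotangentCoeff_toCotangent (j : Fin d) (x : maximalIdeal R) :
    cotangentCoeff δ j ((maximalIdeal R).toCotangent x) =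
      MvPowerSeries.coeff (Finsupp.single j 1) (δ (x : R)) :=
  coeff_single_eq_of_toCotangent_eq δ (toCotangent_cotangentLift _) j

/-- The coordinate functions of a parametrization. -/
def coordinate (j : Fin d) : maximalIdeal R :=
  ⟨δ.symm (MvPowerSeries.X j), by
    rw [mem_maximalIdeal_iff_of_equiv δ, AlgEquiv.apply_symm_apply, mem_maximalIdeal_mvPowerSeries]
    exact MvPowerSeries.constantCoeff_X j⟩

theorem eq_sum_cotangentCoeff_smul (w : CotangentSpace R) :
    w = ∑ j, cotangentCoeff δ j w • (maximalIdeal R).toCotangent (coordinate δ j) := by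
  obtain ⟨x, rfl⟩ := (maximalIdeal R).toCotangent_surjective w
  have h1 : δ (x : R) - ∑ j, MvPowerSeries.coeff (Finsupp.single j 1) (δ (x : R)) •
      MvPowerSeries.X j ∈ maximalIdeal (MvPowerSeries (Fin d) K) ^ 2 :=
    sub_linear_mem_pow_two (mem_maximalIdeal_mvPowerSeries.1
      ((mem_maximalIdeal_iff_of_equiv δ _).1 x.2))
  simp only [← toCotangent_algebraMap_smul, ← map_sum]
  rw [Ideal.toCotangent_eq, mem_pow_maximalIdeal_iff_of_equiv δ, ← mem_pow_maximalIdeal_iff]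
  convert h1 using 1
  rw [map_sub, Submodule.coe_sum, map_sum]
  congr 1
  refine Finset.sum_congr rfl fun j _ => ?_
  rw [Submodule.coe_smul, smul_eq_mul, map_mul, δ.commutes, cotangentCoeff_toCotangent,
    Algebra.smul_def]
  congr 1
  exact δ.apply_symm_apply _

end CotangentCoordinates

section Lattices

variable {K : Type u} [Field K] {R : Type u} [CommRing R] [IsLocalRing R]
  [Algebra K R] {d : ℕ} (δ : R ≃ₐ[K] MvPowerSeries (Fin d) K)

theorem span_cotangentCoeff_eq_top :
    Submodule.span K (Submodule.span (𝓞 K) (Set.range (cotangentCoeff δ)) :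
      Set (Module.Dual K (CotangentSpace R))) = ⊤ := by
  rw [eq_top_iff]
  intro l _
  have h : l = ∑ j, l ((maximalIdeal R).toCotangent (coordinate δ j)) • cotangentCoeff δ j := by
    ext w
    conv_lhs => rw [eq_sum_cotangentCoeff_smul δ w]
    simp [mul_comm]
  rw [h]
  exact Submodule.sum_mem _ fun j _ => Submodule.smul_mem _ _
    (Submodule.subset_span (Submodule.subset_span ⟨j, rfl⟩))

theorem mem_dualLattice_span_iff (w : CotangentSpace R) :
    w ∈ dualLattice (Submodule.span (𝓞 K) (Set.range (cotangentCoeff δ))) ↔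
      ∀ j, cotangentCoeff δ j w ∈ Set.range (algebraMap (𝓞 K) K) := by
  refine ⟨fun h j => h _ (Submodule.subset_span ⟨j, rfl⟩), fun h t ht => ?_⟩
  induction ht using Submodule.span_induction with
  | mem t h1 => obtain ⟨j, rfl⟩ := h1; exact h j
  | zero => exact ⟨0, by simp⟩
  | add s t _ _ hs ht =>
    obtain ⟨a, ha⟩ := hs
    obtain ⟨b, hb⟩ := ht
    exact ⟨a + b, by rw [map_add, ha, hb]; rfl⟩
  | smul c t _ ht =>
    obtain ⟨a, ha⟩ := ht
    exact ⟨c * a, by rw [map_mul, ha]; exact (Algebra.smul_def c (t w)).symm⟩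

theorem exists_smul_mem_dualLattice [NumberField K] (w : CotangentSpace R) : ∃ b : 𝓞 K, b ≠ 0 ∧
    b • w ∈ dualLattice (Submodule.span (𝓞 K) (Set.range (cotangentCoeff δ))) := by
  obtain ⟨b, hb⟩ := IsLocalization.exist_integer_multiples_of_finite (nonZeroDivisors (𝓞 K))
    fun j => cotangentCoeff δ j w
  refine ⟨b, nonZeroDivisors.ne_zero b.2, (mem_dualLattice_span_iff δ _).2 fun j => ?_⟩
  rw [← algebraMap_smul K (b : 𝓞 K) w, map_smul, algebraMap_smul]
  exact hb j

theorem exists_forall_smul_mem {W ι : Type*} [AddCommGroup W] [Module (𝓞 K) W]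
    {Λ : Submodule (𝓞 K) W} (hΛ : ∀ w, ∃ b : 𝓞 K, b ≠ 0 ∧ b • w ∈ Λ) (s : Finset ι) (w : ι → W) :
    ∃ b : 𝓞 K, b ≠ 0 ∧ ∀ i ∈ s, b • w i ∈ Λ := by
  classical
  choose b hb h using fun i => hΛ (w i)
  refine ⟨∏ i ∈ s, b i, Finset.prod_ne_zero_iff.2 fun i _ => hb i, fun i hi => ?_⟩
  rw [← Finset.prod_erase_mul _ _ hi, mul_smul]
  exact Submodule.smul_mem _ _ (h i)

theorem exists_coordinate_multiples_mem {Λ : Submodule (𝓞 K) (CotangentSpace R)}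
    (hΛ : ∀ w, ∃ b : 𝓞 K, b ≠ 0 ∧ b • w ∈ Λ) :
    ∃ b : 𝓞 K, b ≠ 0 ∧ ∀ j, ∃ x : maximalIdeal R,
      (x : R) = algebraMap (𝓞 K) R b * δ.symm (MvPowerSeries.X j) ∧
        (maximalIdeal R).toCotangent x ∈ Λ := by
  obtain ⟨b, hb, h⟩ := exists_forall_smul_mem hΛ Finset.univ
    fun j => (maximalIdeal R).toCotangent (coordinate δ j)
  refine ⟨b, hb, fun j => ⟨algebraMap (𝓞 K) R b • coordinate δ j, rfl, ?_⟩⟩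
  rw [map_smul, algebraMap_smul]
  exact h j (Finset.mem_univ j)

end Lattices

/-! ### The integral structure induced by the model -/

section CotangentModel

variable {K : Type u} [Field K] {X : Scheme.{u}} {π : X ⟶ Spec (.of K)}
  {P : Spec (.of K) ⟶ X} {d : ℕ} {V : FormalGerm π P d}

theorem FormalGerm.restrict_mem_maximalIdeal {f : LocalRing P} (hf : f ∈ maximalIdeal (LocalRing P)) :
    V.restrict f ∈ maximalIdeal V.A := by
  obtain ⟨δ⟩ := V.smooth
  let _ : Algebra K (LocalRing P) := (constants π P).toAlgebra
  rw [mem_maximalIdeal_iff_of_equiv δ]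
  exact algHom_mem_maximalIdeal (V.paramHom δ) hf

theorem FormalGerm.restrict_mem_pow_maximalIdeal {n : ℕ} {f : LocalRing P}
    (hf : f ∈ maximalIdeal (LocalRing P) ^ n) : V.restrict f ∈ maximalIdeal V.A ^ n := by
  obtain ⟨δ⟩ := V.smooth
  let _ : Algebra K (LocalRing P) := (constants π P).toAlgebra
  rw [mem_pow_maximalIdeal_iff_of_equiv δ, ← mem_pow_maximalIdeal_iff]
  exact algHom_mem_pow_maximalIdeal (V.paramHom δ) hf

/-- The restriction to the cotangent space of `V` of a function vanishing at the rational point. -/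
def FormalGerm.differential (V : FormalGerm π P d) (f : maximalIdeal (LocalRing P)) :
    CotangentSpace V.A :=
  (maximalIdeal V.A).toCotangent ⟨V.restrict f, V.restrict_mem_maximalIdeal f.2⟩

end CotangentModel

section CotangentModelNF

variable {K : Type u} [Field K] [NumberField K] {X : Scheme.{u}} {π : X ⟶ Spec (.of K)}
  {P : Spec (.of K) ⟶ X} {d : ℕ} {V : FormalGerm π P d}

/-- A function on the germ lifts to a series in the algebraic coordinates, and its linear part, an
algebraic function, has the same differential. Convergence plays no role. -/
theorem FormalGerm.IsAnalyticAt.differential_surjective (hP : P ≫ π = 𝟙 _) {N : ℕ}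
    {v : HeightOneSpectrum (𝓞 K)} (hV : V.IsAnalyticAt N v) :
    Function.Surjective V.differential := by
  intro w
  obtain ⟨⟨t, ht⟩, rfl⟩ := (maximalIdeal V.A).toCotangent_surjective w
  obtain ⟨z, Θ, hC, hX, -⟩ := hV
  obtain ⟨δ⟩ := V.smooth
  let θ : MvPowerSeries (Fin N) K →ₐ[K] MvPowerSeries (Fin d) K :=
    { (δ : V.A →+* MvPowerSeries (Fin d) K).comp (V.res.comp Θ.toRingHom) with
      commutes' := fun c => by
        change δ (V.res (Θ (MvPowerSeries.C c))) = _
        rw [hC, V.res_constants, δ.commutes] }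
  have hθX : ∀ k, θ (MvPowerSeries.X k) = δ (V.restrict (z k)) := fun k => by
    change δ (V.res (Θ (MvPowerSeries.X k))) = _
    rw [hX]; rfl
  obtain ⟨τ, hτ⟩ := V.res_surjective t
  obtain ⟨F, rfl⟩ := Θ.surjective τ
  have hθF : θ F = δ t := by rw [← hτ]; rfl
  have hF : F ∈ maximalIdeal (MvPowerSeries (Fin N) K) := fun h => by
    have h1 := h.map θ
    rw [hθF, MulEquiv.isUnit_map] at h1
    exact ht h1
  have h1 := algHom_mem_pow_maximalIdeal θ
    (sub_linear_mem_pow_two (mem_maximalIdeal_mvPowerSeries.1 hF))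
  set f : LocalRing P := ∑ k, constants π P (MvPowerSeries.coeff (Finsupp.single k 1) F) * z k
    with hf
  have h2 : θ (∑ k, MvPowerSeries.coeff (Finsupp.single k 1) F • MvPowerSeries.X k) =
      δ (V.restrict f) := by
    rw [hf, map_sum, map_sum, map_sum]
    refine Finset.sum_congr rfl fun k _ => ?_
    rw [map_smul, hθX, map_mul, map_mul, V.restrict_constants, δ.commutes, Algebra.smul_def]
  rw [map_sub, h2, hθF] at h1
  have hfm : f ∈ maximalIdeal (LocalRing P) := by
    rw [← ker_value, RingHom.mem_ker, ← V.constantCoeff_restrict hP δ, ← h2,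
      ← mem_maximalIdeal_mvPowerSeries]
    refine algHom_mem_maximalIdeal θ (Ideal.sum_mem _ fun k _ => ?_)
    rw [mem_maximalIdeal_mvPowerSeries]
    simp
  refine ⟨⟨f, hfm⟩, ?_⟩
  rw [FormalGerm.differential, eq_comm, Ideal.toCotangent_eq,
    mem_pow_maximalIdeal_iff_of_equiv δ, ← mem_pow_maximalIdeal_iff, map_sub]
  exact h1

variable (K) in
theorem nonempty_heightOneSpectrum : Nonempty (HeightOneSpectrum (𝓞 K)) := by
  obtain ⟨m, hm⟩ := Ideal.exists_maximal (𝓞 K)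
  exact ⟨⟨m, hm.isPrime, Ring.ne_bot_of_isMaximal_of_not_isField hm
    (RingOfIntegers.not_isField K)⟩⟩

/-- The germs at a point of the section of functions that vanish along the section. -/
def PointedModel.LocalDifferential (V : FormalGerm π P d) (M : PointedModel (𝓞 K) π P)
    (v : HeightOneSpectrum (𝓞 K)) (t : CotangentSpace V.A) : Prop :=
  ∃ (x : M.space.presheaf.stalk (M.sec (placePt v)))
    (hx : M.localize (placePt v) x ∈ maximalIdeal (LocalRing P)),
      t = V.differential ⟨_, hx⟩

omit [NumberField K] in
theorem PointedModel.localDifferential_iff (M : PointedModel (𝓞 K) π P)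
    (v : HeightOneSpectrum (𝓞 K)) (t : CotangentSpace V.A) :
    M.LocalDifferential V v t ↔ ∃ (U : M.space.Opens) (hU : M.pt ∈ U) (f : Γ(M.space, U))
      (x : maximalIdeal V.A), M.sec (placePt v) ∈ U ∧ M.sec.app U f = 0 ∧
        (x : V.A) = V.resOpen M U hU f ∧ t = (maximalIdeal V.A).toCotangent x := by
  constructor
  · rintro ⟨x, hx, rfl⟩
    obtain ⟨U, hq, s, rfl⟩ := TopCat.Presheaf.exists_germ_eq M.space.presheaf x
    have h1 := M.localize_germ (placePt v) U (M.mem_of_sec_mem hq) hq s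
    refine ⟨U, M.mem_of_sec_mem hq, s, _, hq, ?_, ?_, rfl⟩
    · rw [M.app_sec_eq_zero_iff U (M.mem_of_sec_mem hq), ← h1, ← RingHom.mem_ker, ker_value]
      exact hx
    · exact congrArg V.restrict h1
  · rintro ⟨U, hU, f, x, hq, hf, hx, rfl⟩
    have h1 := M.localize_germ (placePt v) U hU hq f
    rw [M.app_sec_eq_zero_iff U hU, ← h1, ← RingHom.mem_ker, ker_value] at hf
    refine ⟨_, hf, ?_⟩
    congr 1
    ext
    rw [hx]
    exact (congrArg V.restrict h1).symm

omit [NumberField K] in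
theorem PointedModel.LocalDifferential.smul {M : PointedModel (𝓞 K) π P}
    {v : HeightOneSpectrum (𝓞 K)} {t : CotangentSpace V.A} (h : M.LocalDifferential V v t)
    (b : 𝓞 K) : M.LocalDifferential V v (b • t) := by
  obtain ⟨x, hx, rfl⟩ := h
  refine ⟨LGGerm.stalkConstants M.str _ b * x, ?_, ?_⟩
  · rw [map_mul]
    exact Ideal.mul_mem_left _ _ hx
  · rw [← algebraMap_smul V.A b, FormalGerm.differential, FormalGerm.differential, ← map_smul]
    congr 1
    ext
    rw [Submodule.coe_smul, smul_eq_mul]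
    change _ = V.restrict (M.localize _ _)
    rw [map_mul, map_mul, M.localize_stalkConstants, V.restrict_constants,
      ← IsScalarTower.algebraMap_apply]

theorem PointedModel.eventually_localDifferential (M : PointedModel (𝓞 K) π P)
    (f : maximalIdeal (LocalRing P)) : ∀ᶠ v : HeightOneSpectrum (𝓞 K) in Filter.cofinite,
      M.LocalDifferential V v (V.differential f) := by
  obtain ⟨f, hf⟩ := f
  obtain ⟨x, rfl⟩ := M.stalkMap_surjective f
  obtain ⟨U, hU, s, rfl⟩ := TopCat.Presheaf.exists_germ_eq M.space.presheaf x
  filter_upwards [M.eventually_sec_mem hU] with v hq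
  have h1 := M.localize_germ (placePt v) U hU hq s
  exact ⟨_, by rw [h1]; exact hf, by congr 2; exact h1.symm⟩

/-- Near the point above `v` the function is `s / h`. As it vanishes at `P`, the differential of `s`
is `h(P)` times its own, and `h(P) = a / b` is a non-zero fraction. -/
theorem PointedModel.exists_smul_localDifferential (hP : P ≫ π = 𝟙 _)
    (M : PointedModel (𝓞 K) π P) (v : HeightOneSpectrum (𝓞 K))
    (f : maximalIdeal (LocalRing P)) :
    ∃ b : 𝓞 K, b ≠ 0 ∧ M.LocalDifferential V v (b • V.differential f) := by
  obtain ⟨f, hf⟩ := f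
  obtain ⟨x, rfl⟩ := M.stalkMap_surjective f
  obtain ⟨W, hW, hqW, -⟩ := exists_isAffineOpen_mem_and_subset
    (TopologicalSpace.Opens.mem_top (M.sec (placePt v)))
  have hptW := M.mem_of_sec_mem hqW
  obtain ⟨s, h, hh, hx⟩ := exists_eq_div_germ hW M.pt hptW x
  set ρ : Γ(M.space, W) → LocalRing P := fun s =>
    M.localize (placePt v) (M.space.presheaf.germ W _ hqW s) with hρ
  have hρs : ∀ s, ρ s = M.gen.stalkMap (LGGerm.pt P) (M.space.presheaf.germ W M.pt hptW s) :=
    fun s => M.localize_germ (placePt v) W hptW hqW s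
  obtain ⟨a, b, hb, hab⟩ := M.exists_value_mul_eq (placePt v) (M.space.presheaf.germ W _ hqW h)
  have hval : value P (ρ h) ≠ 0 := by
    rw [hρs]
    exact ((hh.map (M.gen.stalkMap (LGGerm.pt P)).hom).map (value P)).ne_zero
  have hb0 : algebraMap (𝓞 K) K b ≠ 0 := by
    intro h0
    have : b = 0 := by simpa using h0
    rw [this] at hb
    exact hb (zero_mem _)
  have ha : a ≠ 0 := by
    rintro rfl
    rw [map_zero] at hab
    exact (mul_ne_zero hb0 hval) hab
  have hs : ρ s = ρ h * M.gen.stalkMap (LGGerm.pt P) x := by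
    rw [hρs, hρs, ← hx]
    exact map_mul (M.gen.stalkMap (LGGerm.pt P)).hom _ _
  have hsm : ρ s ∈ maximalIdeal (LocalRing P) := by
    rw [hs]; exact Ideal.mul_mem_left _ _ hf
  refine ⟨a, ha, ?_⟩
  have h1 : a • V.differential ⟨M.gen.stalkMap (LGGerm.pt P) x, hf⟩ =
      b • V.differential ⟨ρ s, hsm⟩ := by
    rw [← algebraMap_smul V.A a, ← algebraMap_smul V.A b, FormalGerm.differential,
      FormalGerm.differential, ← map_smul, ← map_smul, Ideal.toCotangent_eq]
    -- The difference is `(a - b h) x`, and both factors vanish at `P`.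
    have h2 : LGGerm.constants π P (algebraMap (𝓞 K) K a) * M.gen.stalkMap (LGGerm.pt P) x -
        LGGerm.constants π P (algebraMap (𝓞 K) K b) * ρ s ∈ maximalIdeal (LocalRing P) ^ 2 := by
      rw [hs, ← mul_assoc, ← sub_mul, pow_two]
      refine Ideal.mul_mem_mul ?_ hf
      rw [← ker_value, RingHom.mem_ker, map_sub, map_mul, value_constants hP, value_constants hP,
        ← hab]
      exact sub_self _
    have h3 := V.restrict_mem_pow_maximalIdeal h2
    rw [map_sub, map_mul, map_mul, V.restrict_constants, V.restrict_constants,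
      ← IsScalarTower.algebraMap_apply, ← IsScalarTower.algebraMap_apply] at h3
    exact h3
  rw [h1]
  exact PointedModel.LocalDifferential.smul ⟨_, hsm, rfl⟩ b

/-- An algebraic function with the given differential extends over the section near almost all
places; the product of the finitely many remaining denominators works everywhere. -/
theorem PointedModel.exists_smul_mem_cotangentModel (hP : P ≫ π = 𝟙 _) {N : ℕ}
    (hV : ∀ v, V.IsAnalyticAt N v) (M : PointedModel (𝓞 K) π P) (w : CotangentSpace V.A) :
    ∃ b : 𝓞 K, b ≠ 0 ∧ b • w ∈ V.cotangentModel M := by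
  classical
  obtain ⟨v₀⟩ := nonempty_heightOneSpectrum K
  obtain ⟨f, rfl⟩ := (hV v₀).differential_surjective hP w
  have hfin := M.eventually_localDifferential (V := V) f
  rw [Filter.eventually_cofinite] at hfin
  choose b hb h using fun v => M.exists_smul_localDifferential (V := V) hP v f
  refine ⟨∏ v ∈ hfin.toFinset, b v, Finset.prod_ne_zero_iff.2 fun v _ => hb v,
    Submodule.subset_span fun v => (M.localDifferential_iff v _).1 ?_⟩
  by_cases hv : M.LocalDifferential V v (V.differential f)
  · exact hv.smul _
  · rw [← Finset.prod_erase_mul _ _ (hfin.mem_toFinset.2 hv), mul_smul]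
    exact (h v).smul _

theorem PointedModel.abv_cotangentCoeff_le_one (M : PointedModel (𝓞 K) π P)
    (δ : V.A ≃ₐ[K] MvPowerSeries (Fin d) K) (v : HeightOneSpectrum (𝓞 K))
    (h : ∀ (x : M.space.presheaf.stalk (M.sec (placePt v))) j, HeightOneSpectrum.adicAbv K v
      (MvPowerSeries.coeff (Finsupp.single j 1) (δ (V.restrict (M.localize (placePt v) x)))) ≤ 1)
    (w : CotangentSpace V.A) (hw : w ∈ V.cotangentModel M) (j : Fin d) :
    HeightOneSpectrum.adicAbv K v (cotangentCoeff δ j w) ≤ 1 := by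
  induction hw using Submodule.span_induction with
  | mem w hw =>
    obtain ⟨x, hx, rfl⟩ := (M.localDifferential_iff v w).2 (hw v)
    rw [FormalGerm.differential, cotangentCoeff_toCotangent]
    exact h x j
  | zero => simp
  | add v w _ _ hv hw =>
    rw [map_add]
    exact (HeightOneSpectrum.isNonarchimedean_adicAbv K _ _ _).trans (max_le hv hw)
  | smul c w _ hw =>
    rw [← algebraMap_smul K c w, map_smul, smul_eq_mul, map_mul]
    exact mul_le_one₀ (abv_algebraMap_le_one v c) (apply_nonneg _ _) hw

end CotangentModelNF

/-! ### Summable coefficient bounds over all places -/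

section Coefficients

variable {K : Type u} [Field K] [NumberField K]

/-- The product is at least 1, so the logarithm is continuous at it. -/
theorem summable_log_of_multipliable {ι : Type*} {C : ι → ℝ} (hC : ∀ i, 1 ≤ C i)
    (h : Multipliable C) : Summable fun i => Real.log (C i) := by
  obtain ⟨p, hp⟩ := h
  have hp1 : 1 ≤ p := ge_of_tendsto' hp fun s => by
    simpa using Finset.prod_le_prod (s := s) (fun i _ => zero_le_one) fun i _ => hC i
  refine ⟨Real.log p, ?_⟩
  have h1 := ((Real.continuousAt_log (by positivity : p ≠ 0)).tendsto.comp hp)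
  refine h1.congr fun s => ?_
  exact Real.log_prod fun i _ => by have := hC i; positivity

theorem le_div_rpow_abv (v : HeightOneSpectrum (𝓞 K)) {α : ℝ} (hα : 0 ≤ α) {n : ℕ} (hn : n ≠ 0)
    {x : ℝ} (hx : 0 ≤ x) : x ≤ x / HeightOneSpectrum.adicAbv K v (n : K) ^ α :=
  le_div_self hx (Real.rpow_pos_of_pos (abv_natCast_pos v hn) _)
    (Real.rpow_le_one (abv_natCast_pos v hn).le (abv_natCast_le_one v n) hα)

variable {X : Scheme.{u}} {π : X ⟶ Spec (.of K)} {P : Spec (.of K) ⟶ X} {d : ℕ}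

/-- The restrictions to `V` of the germs of functions at the point of the section above `v`. -/
def FormalGerm.integralGerms (V : FormalGerm π P d) (M : PointedModel (𝓞 K) π P)
    (v : HeightOneSpectrum (𝓞 K)) : Subring V.A :=
  (V.restrict.comp (M.localize (placePt v))).range

/-- There is a parametrization of `V` for which the restrictions of the germs of functions at the
point of the section above `v` have coefficients bounded by `exp (r |I|) / |I!|_v ^ α`, up to
multiples of the parameters that have integral differentials. -/
def FormalGerm.GermBound (V : FormalGerm π P d) (M : PointedModel (𝓞 K) π P)
    (Λ : Submodule (𝓞 K) (CotangentSpace V.A)) (α : ℝ) (v : HeightOneSpectrum (𝓞 K))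
    (r : ℝ) : Prop :=
  ∃ (δ : V.A ≃ₐ[K] MvPowerSeries (Fin d) K) (b : 𝓞 K), b ≠ 0 ∧
    (∀ j, ∃ x : maximalIdeal V.A, (x : V.A) = algebraMap (𝓞 K) V.A b *
      δ.symm (MvPowerSeries.X j) ∧ (maximalIdeal V.A).toCotangent x ∈ Λ) ∧
    ∀ f ∈ V.integralGerms M v, ∀ I, HeightOneSpectrum.adicAbv K v (MvPowerSeries.coeff I (δ f)) ≤
      (Real.exp r * HeightOneSpectrum.adicAbv K v (algebraMap (𝓞 K) K b)) ^ I.degree /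
        HeightOneSpectrum.adicAbv K v (multiFactorial I : K) ^ α

variable {V : FormalGerm π P d}

/-- Glues the two regimes: the good parametrization at almost all places, an analytic one depending
on `v` at the others. The last clause retains the fixed `δ`, which the finiteness of supports
requires. -/
theorem FormalGerm.IsGood.exists_summable_germBound [LocallyOfFiniteType π] (hP : P ≫ π = 𝟙 _)
    {N : ℕ} {α : ℝ} (hα : 0 ≤ α) (hV : ∀ v, V.IsAnalyticAt N v)
    {S : Set (HeightOneSpectrum (𝓞 K))} (hS : S.Finite) {M' : PointedModel (S.integer K) π P}
    {δ : V.A ≃ₐ[K] MvPowerSeries (Fin d) K} (hδ : V.IsGood N α S M' δ)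
    (M : PointedModel (𝓞 K) π P) {Λ : Submodule (𝓞 K) (CotangentSpace V.A)}
    (hΛ : ∀ w : CotangentSpace V.A, ∃ b : 𝓞 K, b ≠ 0 ∧ b • w ∈ Λ) :
    ∃ g : HeightOneSpectrum (𝓞 K) → ℝ, (∀ v, 0 ≤ g v) ∧ Summable g ∧
      (∀ v, V.GermBound M Λ α v (g v)) ∧
      ∀ᶠ v in Filter.cofinite, ∀ f ∈ V.integralGerms M v, ∀ I,
        HeightOneSpectrum.adicAbv K v (MvPowerSeries.coeff I (δ f)) ≤ Real.exp (g v) ^ I.degree /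
          HeightOneSpectrum.adicAbv K v (multiFactorial I : K) ^ α := by
  obtain ⟨C, hC, hCm, hev⟩ := hδ.eventually_localize_mem hP hα hS M
  obtain ⟨b, hb, hbΛ⟩ := exists_coordinate_multiples_mem δ hΛ
  set good : HeightOneSpectrum (𝓞 K) → Prop := fun v => b ∉ v.asIdeal ∧
    ∀ (x : M.space.presheaf.stalk (M.sec (placePt v))) I, HeightOneSpectrum.adicAbv K v
      (MvPowerSeries.coeff I (δ (V.restrict (M.localize (placePt v) x)))) ≤
        C v ^ I.degree / HeightOneSpectrum.adicAbv K v (multiFactorial I : K) ^ α with hgood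
  have hgev : ∀ᶠ v in Filter.cofinite, good v := (eventually_notMem_asIdeal hb).and hev
  have key : ∀ v, ∃ r, 0 ≤ r ∧ V.GermBound M Λ α v r ∧ (good v → r = Real.log (C v)) := by
    intro v
    by_cases hv : good v
    · refine ⟨Real.log (C v), Real.log_nonneg (hC v), ⟨δ, b, hb, hbΛ, ?_⟩, fun _ => rfl⟩
      rintro _ ⟨x, rfl⟩ I
      rw [(abv_algebraMap_eq_one_iff v b).2 hv.1, mul_one,
        Real.exp_log (zero_lt_one.trans_le (hC v))]
      exact hv.2 x I
    -- With `exp r = D / |b'|` the denominator `b'` cancels. Since `|n|_v ≤ 1`, the factor `1 /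
    -- |I!|_v ^ α` only weakens the bound.
    · obtain ⟨δ', D, hD, hx⟩ := (hV v).exists_localize_bound hP M
      obtain ⟨b', hb', hb'Λ⟩ := exists_coordinate_multiples_mem δ' hΛ
      have hbpos : 0 < HeightOneSpectrum.adicAbv K v (algebraMap (𝓞 K) K b') :=
        (HeightOneSpectrum.adicAbv K v).pos (by simpa using hb')
      have h1 : 1 ≤ D / HeightOneSpectrum.adicAbv K v (algebraMap (𝓞 K) K b') :=
        (one_le_div hbpos).2 ((abv_algebraMap_le_one v b').trans hD)
      refine ⟨_, Real.log_nonneg h1, ⟨δ', b', hb', hb'Λ, ?_⟩, fun h => (hv h).elim⟩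
      rintro _ ⟨x, rfl⟩ I
      rw [Real.exp_log (zero_lt_one.trans_le h1), div_mul_cancel₀ _ hbpos.ne']
      exact (hx x I).trans (le_div_rpow_abv v hα (multiFactorial_ne_zero I) (by positivity))
  choose g hg0 hg hgC using key
  refine ⟨g, hg0, ?_, hg, ?_⟩
  · refine (summable_congr_cofinite ?_).2 (summable_log_of_multipliable hC hCm)
    filter_upwards [hgev] with v hv using hgC v hv
  · filter_upwards [hgev] with v hv
    rintro _ ⟨x, rfl⟩ I
    rw [hgC v hv, Real.exp_log (zero_lt_one.trans_le (hC v))]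
    exact hv.2 x I

end Coefficients

/-! ### Norms of jets at one place and at almost all places -/

section JetBounds

variable {K : Type u} [Field K] [NumberField K] {X : Scheme.{u}} {π : X ⟶ Spec (.of K)}
  {P : Spec (.of K) ⟶ X} {d : ℕ} {V : FormalGerm π P d} {M : PointedModel (𝓞 K) π P}
  {Λ : Submodule (𝓞 K) (CotangentSpace V.A)} {α : ℝ}
  {W : Type u} [AddCommGroup W] [Module V.A W] [Module K W] [IsScalarTower K V.A W]
  [Module (𝓞 K) W] [IsScalarTower (𝓞 K) V.A W]

/-- The vector `w` lies in `a` times the localisation of `Λ` at `v`, for some `a` with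
`|a|_v ≤ B`. -/
def LatticeBounded {W : Type u} [AddCommGroup W] [Module K W] [Module (𝓞 K) W]
    (v : HeightOneSpectrum (𝓞 K)) (Λ : Submodule (𝓞 K) W) (B : ℝ) (w : W) : Prop :=
  ∃ (a : K) (b : 𝓞 K), b ∉ v.asIdeal ∧ (∃ x ∈ Λ, b • w = a • x) ∧
    HeightOneSpectrum.adicAbv K v a ≤ B

theorem LatticeBounded.latticeNorm_le {W : Type u} [AddCommGroup W] [Module K W]
    [Module (𝓞 K) W] {v : HeightOneSpectrum (𝓞 K)} {Λ : Submodule (𝓞 K) W} {B : ℝ} {w : W}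
    (h : LatticeBounded v Λ B w) : latticeNorm v Λ w ≤ B := by
  obtain ⟨a, b, hb, ⟨x, hx, h⟩, hB⟩ := h
  exact (LGGerm.latticeNorm_le hb hx h).trans hB

/-- The factor `|b| ^ i` built into `GermBound` cancels the loss in `exists_smul_jet_eq`, and `I!`
divides `i!` when `|I| = i`, which makes the bound uniform over monomials. -/
theorem FormalGerm.GermBound.latticeBounded_jet {v : HeightOneSpectrum (𝓞 K)} {r : ℝ}
    (hr : V.GermBound M Λ α v r) (hα : 0 ≤ α) (ε : V.A ≃ₗ[V.A] W) {E : Set W} (hE : ε 1 ∈ E)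
    {i : ℕ} (y : vanishing V.A W i) (hy : ε.symm y ∈ V.integralGerms M v) :
    LatticeBounded v (jetLattice Λ E i)
      (Real.exp (r * i) / HeightOneSpectrum.adicAbv K v (i ! : K) ^ α) (jet V.A W i y) := by
  obtain ⟨δ, b, hb, hbΛ, hbd⟩ := hr
  have hbpos : 0 < HeightOneSpectrum.adicAbv K v (algebraMap (𝓞 K) K b) :=
    (HeightOneSpectrum.adicAbv K v).pos (by simpa using hb)
  obtain ⟨a, s, x, hs, hx, h, ha⟩ := exists_smul_jet_eq δ ε hb hbΛ hE (i := i)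
    (v := v) (B := (Real.exp r * HeightOneSpectrum.adicAbv K v (algebraMap (𝓞 K) K b)) ^ i /
      HeightOneSpectrum.adicAbv K v (i ! : K) ^ α) (by positivity) y fun I hI => by
    refine (hbd _ hy I).trans ?_
    rw [hI]
    refine div_le_div_of_nonneg_left (by positivity)
      (Real.rpow_pos_of_pos (abv_natCast_pos v (Nat.factorial_ne_zero i)) _)
      (Real.rpow_le_rpow (apply_nonneg _ _) (abv_natCast_le_of_dvd v ?_) hα)
    rw [← hI]
    exact multiFactorial_dvd I
  refine ⟨a, s, hs, ⟨x, hx, h⟩, ha.trans_eq ?_⟩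
  rw [mul_pow, Real.exp_mul, Real.rpow_natCast]
  field_simp

/-- For fixed `i`, summability makes `exp (g v) ^ i` tend to 1 and `i!` is a unit at almost all
places, so the bound is eventually below 2, hence at most 1 by discreteness. -/
theorem eventually_abv_coeff_le_one {δ : V.A ≃ₐ[K] MvPowerSeries (Fin d) K}
    {g : HeightOneSpectrum (𝓞 K) → ℝ} (hg : Summable g)
    (h : ∀ᶠ v in Filter.cofinite, ∀ f ∈ V.integralGerms M v, ∀ I,
        HeightOneSpectrum.adicAbv K v (MvPowerSeries.coeff I (δ f)) ≤ Real.exp (g v) ^ I.degree /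
          HeightOneSpectrum.adicAbv K v (multiFactorial I : K) ^ α) (i : ℕ) :
    ∀ᶠ v in Filter.cofinite, ∀ f ∈ V.integralGerms M v, ∀ I, I.degree = i →
      HeightOneSpectrum.adicAbv K v (MvPowerSeries.coeff I (δ f)) ≤ 1 := by
  have hlim : Filter.Tendsto (fun v => Real.exp (g v) ^ i) Filter.cofinite (nhds 1) := by
    have := ((Real.continuous_exp.tendsto 0).comp hg.tendsto_cofinite_zero).pow i
    simpa using this
  have hi : ((i ! : ℕ) : K) ≠ 0 := by exact_mod_cast Nat.factorial_ne_zero i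
  filter_upwards [h, hlim.eventually_lt_const one_lt_two, eventually_abv_eq_one hi]
    with v hv hlt hfac f hf I hI
  refine abv_le_one_of_lt_two v ((hv _ hf I).trans_lt ?_)
  have h1 : HeightOneSpectrum.adicAbv K v (multiFactorial I : K) = 1 := by
    refine le_antisymm (abv_natCast_le_one v _) ?_
    rw [← hfac, ← hI]
    exact abv_natCast_le_of_dvd v (multiFactorial_dvd I)
  rw [h1, Real.one_rpow, div_one, hI]
  exact hlt

theorem eventually_latticeBounded_jet {δ : V.A ≃ₐ[K] MvPowerSeries (Fin d) K}
    {g : HeightOneSpectrum (𝓞 K) → ℝ} (hg : Summable g)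
    (h : ∀ᶠ v in Filter.cofinite, ∀ f ∈ V.integralGerms M v, ∀ I,
        HeightOneSpectrum.adicAbv K v (MvPowerSeries.coeff I (δ f)) ≤ Real.exp (g v) ^ I.degree /
          HeightOneSpectrum.adicAbv K v (multiFactorial I : K) ^ α)
    (hΛ : ∀ w : CotangentSpace V.A, ∃ b : 𝓞 K, b ≠ 0 ∧ b • w ∈ Λ) (i : ℕ) :
    ∀ᶠ v in Filter.cofinite, ∀ (ε : V.A ≃ₗ[V.A] W) (E : Set W), ε 1 ∈ E →
      ∀ y : vanishing V.A W i, ε.symm y ∈ V.integralGerms M v →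
        LatticeBounded v (jetLattice Λ E i) 1 (jet V.A W i y) := by
  obtain ⟨b, hb, hbΛ⟩ := exists_coordinate_multiples_mem δ hΛ
  filter_upwards [eventually_abv_coeff_le_one hg h i, eventually_notMem_asIdeal hb]
    with v hv hbv ε E hE y hy
  obtain ⟨a, s, x, hs, hx, h, ha⟩ := exists_smul_jet_eq δ ε hb hbΛ hE (i := i)
    (v := v) (B := 1) zero_le_one y fun I hI => hv _ hy I hI
  rw [(abv_algebraMap_eq_one_iff v b).2 hbv, one_pow, div_one] at ha
  exact ⟨a, s, hs, ⟨x, hx, h⟩, ha⟩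

/-- A non-zero jet has a non-zero coefficient, which is a unit at almost all places and bounds the
norm from below. Together with the upper bound, the norm is eventually 1. -/
theorem eventually_one_le_latticeNorm_jet (hP : P ≫ π = 𝟙 _)
    {δ : V.A ≃ₐ[K] MvPowerSeries (Fin d) K}
    (hΛ : ∀ w : CotangentSpace V.A, ∃ b : 𝓞 K, b ≠ 0 ∧ b • w ∈ Λ)
    (hΛ' : ∀ᶠ v : HeightOneSpectrum (𝓞 K) in Filter.cofinite, ∀ w ∈ Λ, ∀ j,
      HeightOneSpectrum.adicAbv K v (cotangentCoeff δ j w) ≤ 1)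
    (ε : V.A ≃ₗ[V.A] W) {i : ℕ} (y : vanishing V.A W i) (hy : jet V.A W i y ≠ 0) :
    ∀ᶠ v in Filter.cofinite, ∀ E : Set W, ε 1 ∈ E → (∀ e ∈ E, ε.symm e ∈ V.integralGerms M v) →
      1 ≤ latticeNorm v (jetLattice Λ E i) (jet V.A W i y) := by
  obtain ⟨b, hb, hbΛ⟩ := exists_coordinate_multiples_mem δ hΛ
  rw [Ne, jet_eq_zero_iff δ ε] at hy
  push Not at hy
  obtain ⟨I₀, hI₀, hne⟩ := hy
  have hfin : {I : Fin d →₀ ℕ | I.degree = i}.Finite :=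
    (Finsupp.finite_of_degree_le i).subset fun I hI => le_of_eq hI
  have hall := (Filter.eventually_all_finite hfin).2 fun I _ =>
    eventually_abv_le_one (MvPowerSeries.coeff I (δ (ε.symm y)))
  filter_upwards [hall, hΛ', eventually_abv_eq_one hne] with v hv hΛv hone E hE hE'
  refine le_latticeNorm ?_ fun a s x hs hx h => ?_
  · obtain ⟨a, s, x, hs, hx, h, -⟩ := exists_smul_jet_eq δ ε hb hbΛ hE (i := i)
      (v := v) (B := 1) zero_le_one y fun I hI => hv I hI
    exact ⟨a, s, hs, x, hx, h⟩
  · obtain ⟨z, rfl, hz⟩ := exists_jet_eq_of_mem_jetLattice (v := v) δ ε (fun x hx j => by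
        rw [← cotangentCoeff_toCotangent]
        exact hΛv _ hx j) (fun e he => by
        obtain ⟨f, hf⟩ := hE' e he
        rw [← hf]
        change HeightOneSpectrum.adicAbv K v (MvPowerSeries.constantCoeff (δ (V.restrict _))) ≤ 1
        rw [V.constantCoeff_restrict hP]
        exact M.abv_value_localize_le_one v f) hx
    rw [← hone]
    exact abv_coeff_le_of_smul_jet_eq δ ε hs h I₀ hI₀ (hz I₀ hI₀)

end JetBounds

/-! ### Local generators of invertible sheaves -/

section LocalGenerators

variable {Y : Scheme.{u}} {L : Y.Modules}

/-- The section `e` over `U` freely generates the restriction of `L` to `U`. -/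
def IsLocalGenerator {U : Y.Opens} (e : Γ(L, U)) : Prop :=
  ∀ (W : Y.Opens) (h : W ≤ U), Function.Bijective fun f : Γ(Y, W) =>
    f • (L.presheaf.map (homOfLE h).op e : Γ(L, W))

theorem IsInvertibleSheaf.exists_isLocalGenerator (hL : IsInvertibleSheaf L) (y : Y) :
    ∃ (U : Y.Opens) (_ : y ∈ U) (e : Γ(L, U)), IsLocalGenerator e := by
  obtain ⟨U, hy, ⟨θ⟩⟩ := hL y
  refine ⟨U.ι ''ᵁ ⊤, by simpa using hy, θ.inv.app ⊤ (1 : Γ(U.toScheme, ⊤)), fun W h => ?_⟩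
  obtain ⟨V, rfl⟩ : ∃ V : U.toScheme.Opens, U.ι ''ᵁ V = W :=
    ⟨U.ι ⁻¹ᵁ W, by
      rw [Scheme.Hom.image_preimage_eq_opensRange_inf, Scheme.Opens.opensRange_ι]
      exact inf_eq_right.2 (h.trans_eq (by simp))⟩
  have h1 : L.presheaf.map (homOfLE h).op (θ.inv.app ⊤ (1 : Γ(U.toScheme, ⊤))) =
      θ.inv.app V (1 : Γ(U.toScheme, V)) := by
    have h2 := congr($(θ.inv.mapPresheaf.naturality (homOfLE (le_top : V ≤ ⊤)).op)
      (1 : Γ(U.toScheme, ⊤)))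
    refine Eq.trans h2.symm ?_
    exact congrArg (θ.inv.app V) (map_one (U.toScheme.presheaf.map (homOfLE (le_top : V ≤ ⊤)).op).hom)
  have h3 : (fun f : Γ(Y, U.ι ''ᵁ V) => f • (L.presheaf.map (homOfLE h).op
      (θ.inv.app ⊤ (1 : Γ(U.toScheme, ⊤))) : Γ(L, U.ι ''ᵁ V))) =
      fun f => θ.inv.app V ((U.ι.appIso V).hom f : Γ(U.toScheme, V)) := by
    funext f
    rw [h1]
    have h4 := θ.inv.app_smul (U := V) ((U.ι.appIso V).hom f : Γ(U.toScheme, V))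
      (1 : Γ(U.toScheme, V))
    have h5 : ((U.ι.appIso V).hom f : Γ(U.toScheme, V)) • (1 : Γ(U.toScheme, V)) =
      (U.ι.appIso V).hom f := mul_one _
    refine Eq.trans ?_ (h4.symm.trans (congrArg (θ.inv.app V) h5))
    have h6 : ∀ (r : Γ(U.toScheme, V)) (x : Γ(L.restrict U.ι, V)),
        r • x = ((U.ι.appIso V).inv r • (show Γ(L, U.ι ''ᵁ V) from x) : Γ(L, U.ι ''ᵁ V)) :=
      fun _ _ => rfl
    refine Eq.trans ?_ (h6 _ _).symm
    rw [Iso.hom_inv_id_apply]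
  rw [h3]
  have h7 : IsIso (θ.inv.app V) := Scheme.Modules.Hom.isIso_iff_isIso_app.1
    ⟨θ.hom, θ.inv_hom_id, θ.hom_inv_id⟩ V
  exact (ConcreteCategory.bijective_of_isIso (θ.inv.app V)).comp
    (ConcreteCategory.bijective_of_isIso (U.ι.appIso V).hom)

theorem moduleGerm_map {y : Y} {U W : Y.Opens} (h : W ≤ U) (hy : y ∈ W) (s : Γ(L, U)) :
    moduleGerm L y W hy (L.presheaf.map (homOfLE h).op s) = moduleGerm L y U (h hy) s :=
  TopCat.Presheaf.germ_res_apply L.presheaf (homOfLE h) y hy s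

theorem IsLocalGenerator.exists_map_eq_smul {U : Y.Opens} {e : Γ(L, U)} (he : IsLocalGenerator e)
    {W : Y.Opens} (s : Γ(L, W)) : ∃ f : Γ(Y, W ⊓ U),
      (L.presheaf.map (homOfLE inf_le_left).op s : Γ(L, W ⊓ U)) =
        f • (L.presheaf.map (homOfLE inf_le_right).op e : Γ(L, W ⊓ U)) := by
  obtain ⟨f, hf⟩ := (he (W ⊓ U) inf_le_right).2 (L.presheaf.map (homOfLE inf_le_left).op s)
  exact ⟨f, hf.symm⟩

theorem IsLocalGenerator.bijective_smul_germ {U : Y.Opens} {e : Γ(L, U)}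
    (he : IsLocalGenerator e) {y : Y} (hy : y ∈ U) :
    Function.Bijective fun a : Y.presheaf.stalk y => a • moduleGerm L y U hy e := by
  constructor
  · refine (injective_iff_map_eq_zero
      ((LinearMap.toSpanSingleton (Y.presheaf.stalk y) _
        (moduleGerm L y U hy e)).toAddMonoidHom)).2 fun a ha => ?_
    replace ha : a • moduleGerm L y U hy e = 0 := ha
    obtain ⟨W₀, hW₀, f₀, rfl⟩ := TopCat.Presheaf.exists_germ_eq Y.presheaf a
    have hyW : y ∈ W₀ ⊓ U := ⟨hW₀, hy⟩
    rw [← Y.presheaf.germ_res_apply (homOfLE (inf_le_left : W₀ ⊓ U ≤ W₀)) y hyW] at ha ⊢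
    generalize Y.presheaf.map (homOfLE (inf_le_left : W₀ ⊓ U ≤ W₀)).op f₀ = f at ha ⊢
    rw [← moduleGerm_map (inf_le_right : W₀ ⊓ U ≤ U) hyW, ← moduleGerm_smul,
      ← map_zero (moduleGerm L y (W₀ ⊓ U) hyW)] at ha
    obtain ⟨W, hyW', i, j, h⟩ := TopCat.Presheaf.germ_eq L.presheaf y hyW hyW _ _ ha
    rw [Scheme.Modules.map_smul, map_zero, ← ConcreteCategory.comp_apply, ← Functor.map_comp] at h
    have h1 : Y.presheaf.map i.op f = 0 := by
      refine (he W (i.le.trans inf_le_right)).1 ?_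
      dsimp only
      rw [zero_smul]
      exact h
    rw [← Y.presheaf.germ_res_apply i y hyW', h1, map_zero]
  · intro m
    obtain ⟨W, hW, s, rfl⟩ := TopCat.Presheaf.exists_germ_eq L.presheaf m
    obtain ⟨f, hf⟩ := he.exists_map_eq_smul s
    have hyW : y ∈ W ⊓ U := ⟨hW, hy⟩
    refine ⟨Y.presheaf.germ _ y hyW f, ?_⟩
    change _ = moduleGerm L y W hW s
    dsimp only
    rw [← moduleGerm_map (inf_le_left : W ⊓ U ≤ W) hyW, hf, moduleGerm_smul, moduleGerm_map]

end LocalGenerators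

/-! ### Sections of invertible sheaves as functions on the germ -/

section Trivialization

variable {K : Type u} [Field K] [NumberField K] {X : Scheme.{u}} {π : X ⟶ Spec (.of K)}
  {P : Spec (.of K) ⟶ X} {d : ℕ} (V : FormalGerm π P d) (M : PointedModel (𝓞 K) π P)
  {L : M.space.Modules}

omit [NumberField K] in
theorem FormalGerm.resOpen_mem_integralGerms (v : HeightOneSpectrum (𝓞 K)) (U : M.space.Opens)
    (hU : M.pt ∈ U) (hv : M.sec (placePt v) ∈ U) (s : Γ(M.space, U)) :
    V.resOpen M U hU s ∈ V.integralGerms M v :=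
  ⟨M.space.presheaf.germ U _ hv s, congrArg V.restrict (M.localize_germ (placePt v) U hU hv s)⟩

omit [NumberField K] in
theorem FormalGerm.resSection_map {U W : M.space.Opens} (h : W ≤ U) (hW : M.pt ∈ W)
    (s : Γ(L, U)) : V.resSection M L W hW (L.presheaf.map (homOfLE h).op s) =
      V.resSection M L U (h hW) s :=
  congrArg (fun t => (1 : V.A) ⊗ₜ[M.space.presheaf.stalk M.pt] t) (moduleGerm_map h hW s)

omit [NumberField K] in
theorem IsLocalGenerator.exists_trivialization {U : M.space.Opens} {e : Γ(L, U)}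
    (he : IsLocalGenerator e) (hU : M.pt ∈ U) :
    ∃ ε : V.A ≃ₗ[V.A] V.SheafSections M L, ε 1 = V.resSection M L U hU e := by
  let τ : M.space.presheaf.stalk M.pt ≃ₗ[M.space.presheaf.stalk M.pt] ModuleStalk L M.pt :=
    LinearEquiv.ofBijective (LinearMap.toSpanSingleton _ _ (moduleGerm L M.pt U hU e))
      (he.bijective_smul_germ hU)
  refine ⟨(TensorProduct.AlgebraTensorModule.rid (M.space.presheaf.stalk M.pt) V.A V.A).symm ≪≫ₗ
    TensorProduct.AlgebraTensorModule.congr (LinearEquiv.refl V.A V.A) τ, ?_⟩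
  have h1 : τ 1 = moduleGerm L M.pt U hU e :=
    one_smul (M.space.presheaf.stalk M.pt) _
  exact congrArg (fun t => (1 : V.A) ⊗ₜ[M.space.presheaf.stalk M.pt] t) h1

theorem IsLocalGenerator.symm_resSection_mem {U : M.space.Opens} {e : Γ(L, U)}
    (he : IsLocalGenerator e) (hU : M.pt ∈ U) {ε : V.A ≃ₗ[V.A] V.SheafSections M L}
    (hε : ε 1 = V.resSection M L U hU e) (v : HeightOneSpectrum (𝓞 K))
    (hv : M.sec (placePt v) ∈ U) {W : M.space.Opens} (hW : M.pt ∈ W)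
    (hvW : M.sec (placePt v) ∈ W) (s : Γ(L, W)) :
    ε.symm (V.resSection M L W hW s) ∈ V.integralGerms M v := by
  obtain ⟨f, hf⟩ := he.exists_map_eq_smul s
  have hpt : M.pt ∈ W ⊓ U := ⟨hW, hU⟩
  have h1 : V.resSection M L W hW s = ε (V.resOpen M _ hpt f) := by
    rw [← V.resSection_map M (inf_le_left : W ⊓ U ≤ W) hpt, hf, V.resSection_smul,
      V.resSection_map, ← hε, ← map_smul, smul_eq_mul, mul_one]
  rw [h1, LinearEquiv.symm_apply_apply]
  exact V.resOpen_mem_integralGerms M v _ hpt ⟨hvW, hv⟩ f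

/-- Near the point of the section above `v`, sections of an invertible sheaf are identified with
functions. -/
theorem IsInvertibleSheaf.exists_trivialization (hL : IsInvertibleSheaf L)
    (v : HeightOneSpectrum (𝓞 K)) : ∃ ε : V.A ≃ₗ[V.A] V.SheafSections M L,
      ε 1 ∈ V.fibreLattice M L v ∧ ∀ e ∈ V.fibreLattice M L v, ε.symm e ∈ V.integralGerms M v := by
  obtain ⟨U, hv, e, he⟩ := hL.exists_isLocalGenerator (M.sec (placePt v))
  have hU := M.mem_of_sec_mem hv
  obtain ⟨ε, hε⟩ := he.exists_trivialization V M hU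
  refine ⟨ε, ⟨U, hU, e, hv, hε⟩, ?_⟩
  rintro _ ⟨W, hW, s, hvW, rfl⟩
  exact he.symm_resSection_mem V M hU hε v hv hW hvW s

/-- A generator near the generic point of the section serves at almost all places. The lower bound
on jets follows one fixed coefficient through varying places, so `ε` must not vary there. -/
theorem IsInvertibleSheaf.exists_eventual_trivialization (hL : IsInvertibleSheaf L) :
    ∃ ε : V.A ≃ₗ[V.A] V.SheafSections M L, ∀ᶠ v in Filter.cofinite,
      ε 1 ∈ V.fibreLattice M L v ∧ ∀ e ∈ V.fibreLattice M L v, ε.symm e ∈ V.integralGerms M v := by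
  obtain ⟨U, hU, e, he⟩ := hL.exists_isLocalGenerator M.pt
  obtain ⟨ε, hε⟩ := he.exists_trivialization V M hU
  refine ⟨ε, ?_⟩
  filter_upwards [M.eventually_sec_mem hU] with v hv
  refine ⟨⟨U, hU, e, hv, hε⟩, ?_⟩
  rintro _ ⟨W, hW, s, hvW, rfl⟩
  exact he.symm_resSection_mem V M hU hε v hv hW hvW s

theorem FormalGerm.resGlobal_mem_fibreLattice (v : HeightOneSpectrum (𝓞 K))
    (s : M.GlobalSections L) : V.resGlobal M L s ∈ V.fibreLattice M L v :=
  ⟨⊤, trivial, s, trivial, rfl⟩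

end Trivialization

/-! ### Summation over the places -/

section Summation

variable {K : Type u} [Field K] [NumberField K]

theorem one_le_exp_div_rpow_abv {r α : ℝ} (hr : 0 ≤ r) (hα : 0 ≤ α) (v : HeightOneSpectrum (𝓞 K))
    (i : ℕ) : 1 ≤ Real.exp (r * i) / HeightOneSpectrum.adicAbv K v (i ! : K) ^ α :=
  (Real.one_le_exp (by positivity)).trans
    (le_div_rpow_abv v hα (Nat.factorial_ne_zero i) (Real.exp_pos _).le)

/-- The local bounds add up to `i ∑ g v` plus `α [K : ℚ] log i!`, by the product formula, and `i! ≤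
i ^ i`. -/
theorem finsum_log_le {g N : HeightOneSpectrum (𝓞 K) → ℝ} {α : ℝ} (hα : 0 ≤ α) (hg : ∀ v, 0 ≤ g v)
    (hgs : Summable g) (i : ℕ) (hN : ∀ v, 0 ≤ N v)
    (h : ∀ v, N v ≤ Real.exp (g v * i) / HeightOneSpectrum.adicAbv K v (i ! : K) ^ α)
    (hfin : (Function.support fun v => Real.log (N v)).Finite) :
    ∑ᶠ v, Real.log (N v) ≤ Module.finrank ℚ K * (α * i * Real.log i) + (∑' v, g v) * i := by
  classical
  have hi := Nat.factorial_ne_zero i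
  have hfin' := hasFiniteSupport_log_abv (K := K) hi
  set F := (hfin.union hfin').toFinset with hF
  have hle : ∀ v, Real.log (N v) ≤
      g v * i - α * Real.log (HeightOneSpectrum.adicAbv K v (i ! : K)) := fun v => by
    have hB := one_le_exp_div_rpow_abv (hg v) hα v i
    have h1 : Real.log (Real.exp (g v * i) / HeightOneSpectrum.adicAbv K v (i ! : K) ^ α) =
        g v * i - α * Real.log (HeightOneSpectrum.adicAbv K v (i ! : K)) := by
      have hpos := abv_natCast_pos v hi
      rw [Real.log_div (Real.exp_pos _).ne' (Real.rpow_pos_of_pos hpos _).ne', Real.log_exp,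
        Real.log_rpow hpos]
    rw [← h1]
    rcases (hN v).eq_or_lt with h0 | h0
    -- Where the norm is zero its logarithm is 0 by convention, so the bound must itself be at least
    -- 1.
    · rw [← h0, Real.log_zero]
      exact Real.log_nonneg hB
    · exact Real.log_le_log h0 (h v)
  have h1 : ∑ᶠ v, Real.log (N v) = ∑ v ∈ F, Real.log (N v) :=
    finsum_eq_sum_of_support_subset _ (by rw [hF, Set.Finite.coe_toFinset]; exact Set.subset_union_left)
  have h2 : ∑ v ∈ F, Real.log (HeightOneSpectrum.adicAbv K v (i ! : K)) =
      -(Module.finrank ℚ K * Real.log (i ! : ℕ)) := by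
    rw [← finsum_log_abv_natCast hi]
    exact (finsum_eq_sum_of_support_subset _
      (by rw [hF, Set.Finite.coe_toFinset]; exact Set.subset_union_right)).symm
  have h3 : Real.log (i ! : ℕ) ≤ i * Real.log i := by
    rw [← Real.log_pow]
    exact Real.log_le_log (by positivity) (by exact_mod_cast Nat.factorial_le_pow i)
  rw [h1]
  calc ∑ v ∈ F, Real.log (N v)
      ≤ ∑ v ∈ F, (g v * i - α * Real.log (HeightOneSpectrum.adicAbv K v (i ! : K))) :=
        Finset.sum_le_sum fun v _ => hle v
    _ = Module.finrank ℚ K * (α * Real.log (i ! : ℕ)) + (∑ v ∈ F, g v) * i := by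
        rw [Finset.sum_sub_distrib, ← Finset.sum_mul, ← Finset.mul_sum, h2]
        ring
    _ ≤ _ := by
        rw [mul_assoc α]
        gcongr
        exact hgs.sum_le_tsum F fun v _ => hg v

omit [NumberField K] in
theorem finite_support_log_of_eventually {N : HeightOneSpectrum (𝓞 K) → ℝ}
    (h : ∀ᶠ v in Filter.cofinite, N v = 1) :
    (Function.support fun v => Real.log (N v)).Finite := by
  rw [Filter.eventually_cofinite] at h
  refine h.subset fun v hv h1 => hv ?_
  dsimp only
  rw [h1, Real.log_one]

end Summation

/-! ### First part: jets of functions -/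

section FunctionJets

variable {K : Type u} [Field K] [NumberField K] {X : Scheme.{u}} {π : X ⟶ Spec (.of K)}
  {P : Spec (.of K) ⟶ X} {d N : ℕ} {V : FormalGerm π P d}

theorem FormalGerm.IsLG.exists_functionJetNorm_bound [LocallyOfFiniteType π] (hP : P ≫ π = 𝟙 _)
    {α : ℝ} (hα : 0 ≤ α) (hV : V.IsLG N α) (M : PointedModel (𝓞 K) π P) :
    ∃ C : ℝ, ∀ (U : M.space.Opens) (hU : M.pt ∈ U), M.sec ⁻¹ᵁ U = ⊤ →
      ∀ (s : Γ(M.space, U)) (i : ℕ) (hs : V.resOpen M U hU s ∈ vanishing V.A V.A i),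
        (Function.support fun v =>
          Real.log (V.functionJetNorm (V.cotangentModel M) v i ⟨V.resOpen M U hU s, hs⟩)).Finite ∧
        ∑ᶠ v : HeightOneSpectrum (𝓞 K),
          Real.log (V.functionJetNorm (V.cotangentModel M) v i ⟨V.resOpen M U hU s, hs⟩) ≤
            Module.finrank ℚ K * (α * i * Real.log i) + C * i := by
  obtain ⟨hV, S, hS, M', -, δ, hδ⟩ := hV
  have hΛ := M.exists_smul_mem_cotangentModel hP hV
  obtain ⟨g, hg, hgs, hgb, hge⟩ := hδ.exists_summable_germBound hP hα hV hS M hΛ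
  -- The family `g` bounds all germs along the section, so the constant is fixed before `U`, `s` and
  -- `i`.
  refine ⟨∑' v, g v, fun U hU hsec s i hs => ?_⟩
  have hmem : ∀ v, V.resOpen M U hU s ∈ V.integralGerms M v := fun v => by
    refine V.resOpen_mem_integralGerms M v U hU ?_ s
    have : placePt v ∈ M.sec ⁻¹ᵁ U := by rw [hsec]; trivial
    exact this
  have hsupp : (Function.support fun v => Real.log (V.functionJetNorm (V.cotangentModel M) v i
      ⟨V.resOpen M U hU s, hs⟩)).Finite := by
    by_cases hjet : jet V.A V.A i ⟨V.resOpen M U hU s, hs⟩ = 0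
    · refine Set.finite_empty.subset fun v hv => hv ?_
      dsimp only
      rw [FormalGerm.functionJetNorm, hjet, latticeNorm_zero, Real.log_zero]
    · refine finite_support_log_of_eventually ?_
      have hΛ' : ∀ᶠ v : HeightOneSpectrum (𝓞 K) in Filter.cofinite, ∀ w ∈ V.cotangentModel M,
          ∀ j, HeightOneSpectrum.adicAbv K v (cotangentCoeff δ j w) ≤ 1 := by
        filter_upwards [eventually_abv_coeff_le_one hgs hge 1] with v hv w hw j
        exact M.abv_cotangentCoeff_le_one δ v (fun x j => hv _ ⟨x, rfl⟩ _ (by simp)) w hw j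
      filter_upwards [eventually_latticeBounded_jet (W := V.A) hgs hge hΛ i,
        eventually_one_le_latticeNorm_jet (M := M) hP hΛ hΛ' (LinearEquiv.refl V.A V.A) _ hjet]
        with v h1 h2
      refine le_antisymm (h1 (LinearEquiv.refl V.A V.A) {1} rfl ⟨_, hs⟩ (hmem v)).latticeNorm_le
        (h2 {1} rfl ?_)
      rintro _ rfl
      exact one_mem _
  exact ⟨hsupp, finsum_log_le hα hg hgs i (fun v => latticeNorm_nonneg _) (fun v =>
    ((hgb v).latticeBounded_jet hα (LinearEquiv.refl V.A V.A) (E := {1}) rfl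
      ⟨_, hs⟩ (hmem v)).latticeNorm_le)
    hsupp⟩

end FunctionJets

/-! ### Second part: operator norms of jet maps on sections -/

section LatticeBounds

variable {K : Type u} [Field K] [NumberField K] {W : Type u} [AddCommGroup W] [Module K W]
  [Module (𝓞 K) W] {v : HeightOneSpectrum (𝓞 K)} {Λ : Submodule (𝓞 K) W}

theorem LatticeBounded.of_smul_eq_smul [IsScalarTower (𝓞 K) K W] {B : ℝ} {w x : W}
    (hB : LatticeBounded v Λ B x) {a : K} {b : 𝓞 K} (hb : b ∉ v.asIdeal) (h : b • w = a • x) :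
    LatticeBounded v Λ (B * HeightOneSpectrum.adicAbv K v a) w := by
  obtain ⟨c, s, hs, ⟨y, hy, hxy⟩, hc⟩ := hB
  refine ⟨c * a, s * b, fun hmem => (v.isPrime.mem_or_mem hmem).elim hs hb, ⟨y, hy, ?_⟩, ?_⟩
  · rw [mul_smul, h, ← algebraMap_smul K s (a • x), smul_comm, algebraMap_smul, hxy, smul_smul,
      mul_comm]
  · rw [map_mul]
    gcongr

theorem quotientNorm_nonneg (W₂ : Submodule K W) (w : W) : 0 ≤ quotientNorm v Λ W₂ w := by
  refine Real.sInf_nonneg ?_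
  rintro _ ⟨y, -, rfl⟩
  exact latticeNorm_nonneg _

theorem quotientNorm_le_latticeNorm (W₂ : Submodule K W) (w : W) :
    quotientNorm v Λ W₂ w ≤ latticeNorm v Λ w := by
  refine csInf_le ⟨0, ?_⟩ ⟨0, zero_mem _, by rw [add_zero]⟩
  rintro _ ⟨y, -, rfl⟩
  exact latticeNorm_nonneg _

end LatticeBounds

section SectionJets

variable {K : Type u} [Field K] [NumberField K] {X : Scheme.{u}} {π : X ⟶ Spec (.of K)}
  {P : Spec (.of K) ⟶ X} {d N : ℕ} {V : FormalGerm π P d} {M : PointedModel (𝓞 K) π P}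
  {L : M.space.Modules} {Λ : Submodule (𝓞 K) (CotangentSpace V.A)}

theorem PointedModel.exists_smul_mem_integralSections (s : M.GenericSections L) :
    ∃ b : 𝓞 K, b ≠ 0 ∧ b • s ∈ M.integralSections L := by
  induction s using TensorProduct.induction_on with
  | zero => exact ⟨1, one_ne_zero, by simp⟩
  | tmul c g =>
    obtain ⟨⟨n, m⟩, h⟩ := IsLocalization.surj (nonZeroDivisors (𝓞 K)) c
    refine ⟨m, nonZeroDivisors.ne_zero m.2, n • g, ?_⟩
    rw [TensorProduct.mk_apply, ← TensorProduct.smul_tmul, TensorProduct.smul_tmul',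
      Algebra.smul_def, Algebra.smul_def, mul_one, ← h, mul_comm]
  | add s t hs ht =>
    obtain ⟨b, hb, hbs⟩ := hs
    obtain ⟨c, hc, hct⟩ := ht
    refine ⟨b * c, mul_ne_zero hb hc, ?_⟩
    rw [smul_add, mul_comm, mul_smul, mul_comm, mul_smul]
    exact add_mem (Submodule.smul_mem _ _ hbs) (Submodule.smul_mem _ _ hct)

/-- The jets of the integral sections of `L` vanishing to order `i - 1` are bounded by `B`. -/
def FormalGerm.IntegralJetBound (V : FormalGerm π P d) (L : M.space.Modules)
    (Λ : Submodule (𝓞 K) (CotangentSpace V.A)) (v : HeightOneSpectrum (𝓞 K)) (i : ℕ)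
    (B : ℝ) : Prop :=
  ∀ (g : M.GlobalSections L) (hg : V.resGlobal M L g ∈ vanishing V.A (V.SheafSections M L) i),
    LatticeBounded v (jetLattice Λ (V.fibreLattice M L v) i) B
      (jet V.A (V.SheafSections M L) i ⟨_, hg⟩)

variable {v : HeightOneSpectrum (𝓞 K)} {i : ℕ} {B : ℝ}

instance : IsScalarTower (𝓞 K) K (JetSpace V.A (V.SheafSections M L) i) :=
  IsScalarTower.of_algebraMap_smul fun r x => by
    rw [← algebraMap_smul V.A r x, ← algebraMap_smul V.A (algebraMap (𝓞 K) K r) x,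
      ← IsScalarTower.algebraMap_apply]

theorem FormalGerm.jetMap_add_of_mem (s : V.sectionFiltration M L i)
    {y : M.GenericSections L} (hy : y ∈ V.sectionFiltration M L (i + 1))
    (hsy : (s : M.GenericSections L) + y ∈ V.sectionFiltration M L i) :
    V.jetMap M L i ⟨s + y, hsy⟩ = V.jetMap M L i s := by
  refine (jet_eq_iff i _ _).2 ?_
  dsimp only
  rw [map_add, add_sub_cancel_left]
  exact hy

theorem FormalGerm.sectionFiltration_succ_le (V : FormalGerm π P d) (L : M.space.Modules) (i : ℕ) :
    V.sectionFiltration M L (i + 1) ≤ V.sectionFiltration M L i :=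
  fun _ hy => Submodule.smul_mono_left (Ideal.pow_le_pow_right i.le_succ) hy

/-- Homogeneity: if `b • s = a • g` with `g` integral and `a ≠ 0`, then `g` vanishes to the same
order as `s`, since vanishing is stable under `K`, and the bound for `g` scales by `|a|`. -/
theorem FormalGerm.IntegralJetBound.latticeNorm_jetMap_le (h : V.IntegralJetBound L Λ v i B)
    (hB : 0 < B) (s : V.sectionFiltration M L i) :
    latticeNorm v (jetLattice Λ (V.fibreLattice M L v) i) (V.jetMap M L i s) ≤
      B * latticeNorm v (M.integralSections L) s := by
  rw [← div_le_iff₀' hB]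
  refine le_latticeNorm ?_ fun a b x hb hx hab => ?_
  · obtain ⟨b, hb, hs⟩ := M.exists_smul_mem_integralSections (s : M.GenericSections L)
    have hb' : algebraMap (𝓞 K) K b ≠ 0 := by simpa using hb
    refine ⟨(algebraMap (𝓞 K) K b)⁻¹, 1, one_notMem_asIdeal v, _, hs, ?_⟩
    rw [one_smul, ← algebraMap_smul K b, smul_smul, inv_mul_cancel₀ hb', one_smul]
  · rw [div_le_iff₀' hB]
    rcases eq_or_ne a 0 with rfl | ha
    · have hs : (s : M.GenericSections L) = 0 := by
        have hb' : algebraMap (𝓞 K) K b ≠ 0 := by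
          intro h0
          have : b = 0 := by simpa using h0
          exact hb (this ▸ zero_mem _)
        rw [zero_smul, ← algebraMap_smul K b] at hab
        exact (smul_eq_zero.1 hab).resolve_left hb'
      have : V.jetMap M L i s = 0 := by
        have h1 : (⟨V.resGeneric M L s, s.2⟩ : vanishing V.A (V.SheafSections M L) i) = 0 :=
          Subtype.ext ((congrArg (V.resGeneric M L) hs).trans (map_zero _))
        rw [FormalGerm.jetMap, h1, map_zero]
      rw [this, latticeNorm_zero]
      simp
    · obtain ⟨g, rfl⟩ := hx
      have hres : a • V.resGlobal M L g = b • V.resGeneric M L s := by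
        have h1 : V.resGeneric M L (TensorProduct.mk (𝓞 K) K (M.GlobalSections L) 1 g) =
            V.resGlobal M L g :=
          ((V.resGlobal M L).liftBaseChange_tmul (A := K) 1 g).trans (one_smul _ _)
        rw [← h1, ← map_smul, ← hab, ← algebraMap_smul K b, map_smul, algebraMap_smul]
      have hg : V.resGlobal M L g ∈ vanishing V.A (V.SheafSections M L) i := by
        have h1 : V.resGlobal M L g = a⁻¹ • b • V.resGeneric M L s := by
          rw [← hres, smul_smul, inv_mul_cancel₀ ha, one_smul]
        rw [h1, ← algebraMap_smul V.A a⁻¹, ← algebraMap_smul V.A b]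
        exact Submodule.smul_mem _ _ (Submodule.smul_mem _ _ s.2)
      refine ((h g hg).of_smul_eq_smul hb ?_).latticeNorm_le
      rw [FormalGerm.jetMap, ← LinearMap.map_smul_of_tower, ← LinearMap.map_smul_of_tower]
      congr 1
      ext
      exact hres.symm

/-- All representatives of a class modulo the next step of the filtration have the same jet, so the
previous bound passes to the infimum. -/
theorem FormalGerm.IntegralJetBound.latticeNorm_jetMap_le_quotientNorm
    (h : V.IntegralJetBound L Λ v i B) (hB : 0 < B) (s : V.sectionFiltration M L i) :
    latticeNorm v (jetLattice Λ (V.fibreLattice M L v) i) (V.jetMap M L i s) ≤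
      B * quotientNorm v (M.integralSections L) (V.sectionFiltration M L (i + 1)) s := by
  rw [← div_le_iff₀' hB]
  refine le_csInf ⟨_, 0, zero_mem _, rfl⟩ ?_
  rintro _ ⟨y, hy, rfl⟩
  rw [div_le_iff₀' hB]
  have hsy := add_mem s.2 (V.sectionFiltration_succ_le L i hy)
  rw [← V.jetMap_add_of_mem s hy hsy]
  exact h.latticeNorm_jetMap_le hB ⟨_, hsy⟩

theorem FormalGerm.IntegralJetBound.le_of_mem_jetRatios (h : V.IntegralJetBound L Λ v i B)
    (hB : 0 < B) {r : ℝ} (hr : r ∈ V.jetRatios M L Λ v i) : r ≤ B := by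
  obtain ⟨s, rfl⟩ := hr
  exact div_le_of_le_mul₀ (quotientNorm_nonneg _ _) hB.le (h.latticeNorm_jetMap_le_quotientNorm hB s)

theorem FormalGerm.IntegralJetBound.jetOpNorm_le (h : V.IntegralJetBound L Λ v i B)
    (hB : 0 < B) : V.jetOpNorm M L Λ v i ≤ B :=
  Real.sSup_le (fun _ hr => h.le_of_mem_jetRatios hB hr) hB.le

theorem FormalGerm.jetOpNorm_nonneg (V : FormalGerm π P d) (L : M.space.Modules)
    (Λ : Submodule (𝓞 K) (CotangentSpace V.A)) (v : HeightOneSpectrum (𝓞 K)) (i : ℕ) :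
    0 ≤ V.jetOpNorm M L Λ v i := by
  refine Real.sSup_nonneg ?_
  rintro _ ⟨s, rfl⟩
  exact div_nonneg (latticeNorm_nonneg _) (quotientNorm_nonneg _ _)

theorem FormalGerm.jetOpNorm_eq_zero (h : ∀ s, V.jetMap M L i s = 0) :
    V.jetOpNorm M L Λ v i = 0 := by
  refine le_antisymm (Real.sSup_le ?_ le_rfl) (V.jetOpNorm_nonneg L Λ v i)
  rintro _ ⟨s, rfl⟩
  rw [h, latticeNorm_zero, zero_div]

theorem PointedModel.eventually_latticeNorm_integralSections_le (s : M.GenericSections L) :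
    ∀ᶠ v in Filter.cofinite, latticeNorm v (M.integralSections L) s ≤ 1 := by
  obtain ⟨b, hb, hs⟩ := M.exists_smul_mem_integralSections s
  filter_upwards [eventually_notMem_asIdeal hb] with v hv
  simpa using latticeNorm_le (a := 1) hv hs (one_smul _ _).symm

theorem FormalGerm.IntegralJetBound.one_le_jetOpNorm (h : V.IntegralJetBound L Λ v i B)
    (hB : 0 < B) (s : V.sectionFiltration M L i)
    (hs : latticeNorm v (M.integralSections L) (s : M.GenericSections L) ≤ 1)
    (hjet : 1 ≤ latticeNorm v (jetLattice Λ (V.fibreLattice M L v) i) (V.jetMap M L i s)) :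
    1 ≤ V.jetOpNorm M L Λ v i := by
  refine le_trans ?_ (le_csSup ⟨B, fun r hr => h.le_of_mem_jetRatios hB hr⟩ ⟨s, rfl⟩)
  have h1 := h.latticeNorm_jetMap_le_quotientNorm hB s
  -- Positivity is essential, since a ratio with zero denominator would be 0; it follows from the
  -- upper bound and the non-vanishing of the jet norm.
  have h2 : 0 < quotientNorm v (M.integralSections L) (V.sectionFiltration M L (i + 1))
      (s : M.GenericSections L) := by
    refine (quotientNorm_nonneg _ _).lt_of_ne fun h0 => ?_
    rw [← h0, mul_zero] at h1
    exact absurd (hjet.trans h1) (by norm_num)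
  rw [one_le_div h2]
  exact ((quotientNorm_le_latticeNorm _ _).trans hs).trans hjet

theorem FormalGerm.IsLG.exists_jetOpNorm_bound [LocallyOfFiniteType π] (hP : P ≫ π = 𝟙 _)
    {α : ℝ} (hα : 0 ≤ α) (hV : V.IsLG N α) (M : PointedModel (𝓞 K) π P) :
    ∃ T : TangentModel V, ∃ C ≥ (0 : ℝ), ∀ L : M.space.Modules, IsInvertibleSheaf L → ∀ i : ℕ,
      (∀ v, BddAbove (V.jetRatios M L (dualLattice T.lattice) v i)) ∧
      (Function.support fun v =>
        Real.log (V.jetOpNorm M L (dualLattice T.lattice) v i)).Finite ∧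
      ∑ᶠ v, Real.log (V.jetOpNorm M L (dualLattice T.lattice) v i) ≤
        Module.finrank ℚ K * (α * i * Real.log i) + C * i := by
  obtain ⟨hV, S, hS, M', -, δ, hδ⟩ := hV
  -- The dual lattice consists of the cotangent vectors with coordinates in `𝓞 K` for the good
  -- parametrization, so these coordinates are integral at every place.
  let T : TangentModel V := ⟨Submodule.span (𝓞 K) (Set.range (cotangentCoeff δ)),
    Submodule.fg_span (Set.finite_range _), span_cotangentCoeff_eq_top δ⟩
  have hΛ : ∀ w : CotangentSpace V.A, ∃ b : 𝓞 K, b ≠ 0 ∧ b • w ∈ dualLattice T.lattice :=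
    exists_smul_mem_dualLattice δ
  have hΛ' : ∀ (v : HeightOneSpectrum (𝓞 K)), ∀ w ∈ dualLattice T.lattice, ∀ j,
      HeightOneSpectrum.adicAbv K v (cotangentCoeff δ j w) ≤ 1 := fun v w hw j => by
    obtain ⟨c, hc⟩ := (mem_dualLattice_span_iff δ w).1 hw j
    rw [← hc]
    exact abv_algebraMap_le_one v c
  obtain ⟨g, hg, hgs, hgb, hge⟩ := hδ.exists_summable_germBound hP hα hV hS M hΛ
  refine ⟨T, ∑' v, g v, tsum_nonneg hg, fun L hL i => ?_⟩
  have hbound : ∀ v, V.IntegralJetBound L (dualLattice T.lattice) v i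
      (Real.exp (g v * i) / HeightOneSpectrum.adicAbv K v (i ! : K) ^ α) := fun v f hf => by
    -- The trivialization may change with the place because the bound concerns only germs of
    -- functions; hence the constant does not depend on `L`.
    obtain ⟨ε, hε, hmem⟩ := hL.exists_trivialization V M v
    exact (hgb v).latticeBounded_jet hα ε hε ⟨_, hf⟩
      (hmem _ (V.resGlobal_mem_fibreLattice M v f))
  have hB0 := fun v => zero_lt_one.trans_le (one_le_exp_div_rpow_abv (hg v) hα v i)
  have hsupp : (Function.support fun v =>
      Real.log (V.jetOpNorm M L (dualLattice T.lattice) v i)).Finite := by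
    by_cases hjet : ∀ s, V.jetMap M L i s = 0
    · refine Set.finite_empty.subset fun v hv => hv ?_
      dsimp only
      rw [FormalGerm.jetOpNorm_eq_zero hjet, Real.log_zero]
    · push Not at hjet
      obtain ⟨s, hs⟩ := hjet
      obtain ⟨ε, hε⟩ := hL.exists_eventual_trivialization V M
      refine finite_support_log_of_eventually ?_
      filter_upwards [hε,
        eventually_latticeBounded_jet (W := V.SheafSections M L) hgs hge hΛ i,
        eventually_one_le_latticeNorm_jet (M := M) hP hΛ (.of_forall hΛ') ε _ hs,
        M.eventually_latticeNorm_integralSections_le (s : M.GenericSections L)]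
        with v hεv h1 h2 h3
      have h4 : V.IntegralJetBound L (dualLattice T.lattice) v i 1 := fun f hf =>
        h1 ε _ hεv.1 ⟨_, hf⟩ (hεv.2 _ (V.resGlobal_mem_fibreLattice M v f))
      exact le_antisymm (h4.jetOpNorm_le zero_lt_one)
        (h4.one_le_jetOpNorm zero_lt_one s h3 (h2 _ hεv.1 hεv.2))
  exact ⟨fun v => ⟨_, fun r hr => (hbound v).le_of_mem_jetRatios (hB0 v) hr⟩, hsupp,
    finsum_log_le hα hg hgs i (fun v => V.jetOpNorm_nonneg L _ v i)
      (fun v => (hbound v).jetOpNorm_le (hB0 v)) hsupp⟩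

end SectionJets

end LGGerm

end

/-! ### Normalization by the degree of the field -/

theorem theorem3p12 {K : Type u} [Field K] [NumberField K] {X : Scheme.{u}} {N d : ℕ}
    (π : X ⟶ Spec (.of K)) [SmoothOfRelativeDimension N π] [IsSeparated π] [QuasiCompact π]
    (P : Spec (.of K) ⟶ X) (hP : P ≫ π = 𝟙 _) (V : LGGerm.FormalGerm π P d)
    (α : ℝ) (hα : 0 ≤ α) (hV : V.IsLG N α) (M : LGGerm.PointedModel (𝓞 K) π P) :
    (∃ C : ℝ, ∀ (U : M.space.Opens) (hU : M.pt ∈ U), M.sec ⁻¹ᵁ U = ⊤ →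
      ∀ (s : Γ(M.space, U)) (i : ℕ) (hs : V.resOpen M U hU s ∈ LGGerm.vanishing V.A V.A i),
        (Function.support fun v =>
          Real.log (V.functionJetNorm (V.cotangentModel M) v i ⟨V.resOpen M U hU s, hs⟩)).Finite ∧
        (Module.finrank ℚ K : ℝ)⁻¹ * ∑ᶠ v : HeightOneSpectrum (𝓞 K),
          Real.log (V.functionJetNorm (V.cotangentModel M) v i ⟨V.resOpen M U hU s, hs⟩) ≤
            α * i * Real.log i + C * i) ∧
    (∃ T : LGGerm.TangentModel V, ∃ C > (0 : ℝ), ∀ L : M.space.Modules,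
      LGGerm.IsInvertibleSheaf L → ∀ i : ℕ,
        (∀ v : HeightOneSpectrum (𝓞 K),
          BddAbove (V.jetRatios M L (LGGerm.dualLattice T.lattice) v i)) ∧
        (Function.support fun v =>
          Real.log (V.jetOpNorm M L (LGGerm.dualLattice T.lattice) v i)).Finite ∧
        ∑ᶠ v : HeightOneSpectrum (𝓞 K),
          Real.log (V.jetOpNorm M L (LGGerm.dualLattice T.lattice) v i) ≤
            Module.finrank ℚ K * (α * i * Real.log i + C * i)) := by
  have : Smooth π := SmoothOfRelativeDimension.smooth N π
  have hn : (0 : ℝ) < Module.finrank ℚ K := by exact_mod_cast Module.finrank_pos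
  refine ⟨?_, ?_⟩
  · obtain ⟨C, hC⟩ := hV.exists_functionJetNorm_bound hP hα M
    refine ⟨C / Module.finrank ℚ K, fun U hU hsec s i hs => ⟨(hC U hU hsec s i hs).1, ?_⟩⟩
    rw [inv_mul_le_iff₀ hn]
    refine (hC U hU hsec s i hs).2.trans_eq ?_
    field_simp
  · obtain ⟨T, C, hC0, hC⟩ := hV.exists_jetOpNorm_bound hP hα M
    -- Adding 1 makes the constant strictly positive, as it might otherwise be zero.
    refine ⟨T, C / Module.finrank ℚ K + 1, by positivity, fun L hL i =>
      ⟨(hC L hL i).1, (hC L hL i).2.1, (hC L hL i).2.2.trans ?_⟩⟩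
    have h1 : (Module.finrank ℚ K : ℝ) * (α * i * Real.log i +
        (C / Module.finrank ℚ K + 1) * i) =
        Module.finrank ℚ K * (α * i * Real.log i) + C * i + Module.finrank ℚ K * i := by
      field_simp
      ring
    rw [h1]
    exact le_add_of_nonneg_right (by positivity)
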